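/- Let $\ell\ge 3$ be an odd integer and $\xi=e^{2\pi i/\ell}$, and let $(a_{ij})_{i,j=1,2}$ be the matrix with $a_{11}=2$, $a_{12}=a_{21}=-1$, $a_{22}=0$. Let $\mathcal U_{\overline 0}$ (the restricted quantum $\mathfrak{sl}(2|1)$, bosonized) be the unital associative $\mathbb C$-algebra generated by $k_i^{\pm1},e_i,f_i$ $(i=1,2)$ and $\sigma$ with the relations $$k_1k_2=k_2k_1,\quad k_ik_i^{-1}=k_i^{-1}k_i=1,\quad k_ie_jk_i^{-1}=\xi^{a_{ij}}e_j,\quad k_if_jk_i^{-1}=\xi^{-a_{ij}}f_j,$$ $$e_1f_1-f_1e_1=\frac{k_1-k_1^{-1}}{\xi-\xi^{-1}},\quad e_2f_2+f_2e_2=\frac{k_2-k_2^{-1}}{\xi-\xi^{-1}},\quad e_1f_2=f_2e_1,\quad e_2f_1=f_1e_2,\quad e_2^2=f_2^2=0,$$ $$e_1^2e_2-(\xi+\xi^{-1})e_1e_2e_1+e_2e_1^2=0,\quad f_1^2f_2-(\xi+\xi^{-1})f_1f_2f_1+f_2f_1^2=0,$$ $$e_1^\ell=f_1^\ell=0,\quad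 k_i^\ell=1,\quad \sigma^2=1,\quad \sigma k_i=k_i\sigma,\quad \sigma e_i=(-1)^{i-1}e_i\sigma,\quad \sigma f_i=(-1)^{i-1}f_i\sigma .$$ It is a Hopf algebra with coproduct, counit and antipode given by $$\Delta(k_i)=k_i\otimes k_i,\quad \Delta(\sigma)=\sigma\otimes\sigma,\quad \Delta(e_i)=e_i\otimes 1+k_i^{-1}\sigma^{i-1}\otimes e_i,\quad \Delta(f_i)=f_i\otimes k_i+\sigma^{i-1}\otimes f_i,$$ $$\varepsilon(k_i)=\varepsilon(\sigma)=1,\quad \varepsilon(e_i)=\varepsilon(f_i)=0,$$ $$S(k_i)=k_i^{-1},\quad S(\sigma)=\sigma,\quad S(e_i)=-\sigma^{i-1}k_ie_i,\quad S(f_i)=-\sigma^{i-1}f_ik_i^{-1}.$$ Put $e_3=e_1e_2-\xi^{-1}e_2e_1$ and $f_3=f_2f_1-\xi f_1f_2$. Then the monomials $$f_1^{i}f_3^{\rho}f_2^{\delta}e_1^{i'}e_3^{\rho'}e_2^{\delta'}k_1^{j_1}k_2^{j_2}\sigma^{m},\qquad 0\le i,i',j_1,j_2\le \ell-1,\quad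 \rho,\delta,\rho',\delta',m\in\{0,1\},$$ form a basis of $\mathcal U_{\overline 0}$ (the PBW basis), and for every $\eta\in\mathbb C^*$ the linear form $\lambda_{\overline 0}:\mathcal U_{\overline 0}\to\mathbb C$ that takes the value $\eta$ at $f_1^{\ell-1}f_3f_2e_1^{\ell-1}e_3e_2k_2^{\ell-2}$ and the value $0$ at all other monomials of this basis is a right integral of $\mathcal U_{\overline 0}$, that is, $$(\lambda_{\overline 0}\otimes \mathrm{Id})\Delta(x)=\lambda_{\overline 0}(x)\,1\qquad\text{for all }x\in\mathcal U_{\overline 0}.$$ -/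

import Mathlib

open scoped TensorProduct

noncomputable section

namespace QSl21

/-- `ξ = exp (2πi / ℓ)`. -/
def xi (ℓ : ℕ) : ℂ := Complex.exp (2 * Real.pi * Complex.I / ℓ)

/-- The matrix `(a_{ij})`. The indices `1, 2` of the literature are `0, 1 : Fin 2` here, so
`i : Fin 2` is also the parity of the generators `e_i`, `f_i`. -/
def cartan : Matrix (Fin 2) (Fin 2) ℤ := !![2, -1; -1, 0]

/-- The generators `k_i`, `k_i⁻¹`, `e_i`, `f_i` and `σ`. -/
inductive Gen : Type
  | k (i : Fin 2)
  | kInv (i : Fin 2)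
  | e (i : Fin 2)
  | f (i : Fin 2)
  | sigma

open Gen

/-- The formal generators, in the free algebra. -/
abbrev X (g : Gen) : FreeAlgebra ℂ Gen := FreeAlgebra.ι ℂ g

/-- The defining relations of the restricted quantum `sl(2|1)`: those of the quantum
superalgebra `U_ξ sl(2|1)`, then `e_1^ℓ = f_1^ℓ = 0`, then those of the bosonization
(`σ² = 1`, `σ x = (-1)^{deg x} x σ`), then `k_i^ℓ = 1`. -/
inductive Rel (ℓ : ℕ) : FreeAlgebra ℂ Gen → FreeAlgebra ℂ Gen → Prop
  | k_comm : Rel ℓ (X (k 0) * X (k 1)) (X (k 1) * X (k 0))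
  | k_kInv (i : Fin 2) : Rel ℓ (X (k i) * X (kInv i)) 1
  | kInv_k (i : Fin 2) : Rel ℓ (X (kInv i) * X (k i)) 1
  | k_e (i j : Fin 2) :
      Rel ℓ (X (k i) * X (e j) * X (kInv i)) (xi ℓ ^ cartan i j • X (e j))
  | k_f (i j : Fin 2) :
      Rel ℓ (X (k i) * X (f j) * X (kInv i)) (xi ℓ ^ (-cartan i j) • X (f j))
  | e1_f1 : Rel ℓ (X (e 0) * X (f 0) - X (f 0) * X (e 0))
      ((xi ℓ - (xi ℓ)⁻¹)⁻¹ • (X (k 0) - X (kInv 0)))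
  | e2_f2 : Rel ℓ (X (e 1) * X (f 1) + X (f 1) * X (e 1))
      ((xi ℓ - (xi ℓ)⁻¹)⁻¹ • (X (k 1) - X (kInv 1)))
  | e1_f2 : Rel ℓ (X (e 0) * X (f 1) - X (f 1) * X (e 0)) 0
  | e2_f1 : Rel ℓ (X (e 1) * X (f 0) - X (f 0) * X (e 1)) 0
  | e2_sq : Rel ℓ (X (e 1) ^ 2) 0
  | f2_sq : Rel ℓ (X (f 1) ^ 2) 0
  | serre_e : Rel ℓ (X (e 0) ^ 2 * X (e 1)
      - (xi ℓ + (xi ℓ)⁻¹) • (X (e 0) * X (e 1) * X (e 0)) + X (e 1) * X (e 0) ^ 2) 0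
  | serre_f : Rel ℓ (X (f 0) ^ 2 * X (f 1)
      - (xi ℓ + (xi ℓ)⁻¹) • (X (f 0) * X (f 1) * X (f 0)) + X (f 1) * X (f 0) ^ 2) 0
  | e1_pow : Rel ℓ (X (e 0) ^ ℓ) 0
  | f1_pow : Rel ℓ (X (f 0) ^ ℓ) 0
  | sigma_sq : Rel ℓ (X sigma ^ 2) 1
  | sigma_k (i : Fin 2) : Rel ℓ (X sigma * X (k i)) (X (k i) * X sigma)
  | sigma_e (i : Fin 2) : Rel ℓ (X sigma * X (e i)) ((-1 : ℂ) ^ (i : ℕ) • (X (e i) * X sigma))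
  | sigma_f (i : Fin 2) : Rel ℓ (X sigma * X (f i)) ((-1 : ℂ) ^ (i : ℕ) • (X (f i) * X sigma))
  | k_pow (i : Fin 2) : Rel ℓ (X (k i) ^ ℓ) 1

/-- The restricted quantum `sl(2|1)` (with `σ` adjoined), as an algebra. -/
def U0 (ℓ : ℕ) : Type := RingQuot (Rel ℓ)

instance (ℓ : ℕ) : Ring (U0 ℓ) := inferInstanceAs (Ring (RingQuot (Rel ℓ)))
instance (ℓ : ℕ) : Algebra ℂ (U0 ℓ) := inferInstanceAs (Algebra ℂ (RingQuot (Rel ℓ)))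

/-- The quotient map from the free algebra. -/
def mk (ℓ : ℕ) : FreeAlgebra ℂ Gen →ₐ[ℂ] U0 ℓ := RingQuot.mkAlgHom ℂ (Rel ℓ)

/-- The generators of `U0 ℓ`. -/
def gen (ℓ : ℕ) (g : Gen) : U0 ℓ := mk ℓ (X g)

/-! ### The universal property -/

/-- A family of elements of an algebra that satisfies the defining relations. -/
structure Satisfies (ℓ : ℕ) {B : Type*} [Ring B] [Algebra ℂ B] (g : Gen → B) : Prop where
  k_comm : g (k 0) * g (k 1) = g (k 1) * g (k 0)
  k_kInv (i : Fin 2) : g (k i) * g (kInv i) = 1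
  kInv_k (i : Fin 2) : g (kInv i) * g (k i) = 1
  k_e (i j : Fin 2) : g (k i) * g (e j) * g (kInv i) = xi ℓ ^ cartan i j • g (e j)
  k_f (i j : Fin 2) : g (k i) * g (f j) * g (kInv i) = xi ℓ ^ (-cartan i j) • g (f j)
  e1_f1 : g (e 0) * g (f 0) - g (f 0) * g (e 0) =
    (xi ℓ - (xi ℓ)⁻¹)⁻¹ • (g (k 0) - g (kInv 0))
  e2_f2 : g (e 1) * g (f 1) + g (f 1) * g (e 1) =
    (xi ℓ - (xi ℓ)⁻¹)⁻¹ • (g (k 1) - g (kInv 1))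
  e1_f2 : g (e 0) * g (f 1) - g (f 1) * g (e 0) = 0
  e2_f1 : g (e 1) * g (f 0) - g (f 0) * g (e 1) = 0
  e2_sq : g (e 1) ^ 2 = 0
  f2_sq : g (f 1) ^ 2 = 0
  serre_e : g (e 0) ^ 2 * g (e 1)
    - (xi ℓ + (xi ℓ)⁻¹) • (g (e 0) * g (e 1) * g (e 0)) + g (e 1) * g (e 0) ^ 2 = 0
  serre_f : g (f 0) ^ 2 * g (f 1)
    - (xi ℓ + (xi ℓ)⁻¹) • (g (f 0) * g (f 1) * g (f 0)) + g (f 1) * g (f 0) ^ 2 = 0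
  e1_pow : g (e 0) ^ ℓ = 0
  f1_pow : g (f 0) ^ ℓ = 0
  sigma_sq : g sigma ^ 2 = 1
  sigma_k (i : Fin 2) : g sigma * g (k i) = g (k i) * g sigma
  sigma_e (i : Fin 2) : g sigma * g (e i) = (-1 : ℂ) ^ (i : ℕ) • (g (e i) * g sigma)
  sigma_f (i : Fin 2) : g sigma * g (f i) = (-1 : ℂ) ^ (i : ℕ) • (g (f i) * g sigma)
  k_pow (i : Fin 2) : g (k i) ^ ℓ = 1

theorem gen_satisfies (ℓ : ℕ) : Satisfies ℓ (gen ℓ) := by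
  have key : ∀ {x y}, Rel ℓ x y → mk ℓ x = mk ℓ y := fun h => RingQuot.mkAlgHom_rel ℂ h
  constructor
  case k_comm => simpa [gen] using key .k_comm
  case k_kInv => intro i; simpa [gen] using key (.k_kInv i)
  case kInv_k => intro i; simpa [gen] using key (.kInv_k i)
  case k_e => intro i j; simpa [gen] using key (.k_e i j)
  case k_f => intro i j; simpa [gen] using key (.k_f i j)
  case e1_f1 => simpa [gen] using key .e1_f1
  case e2_f2 => simpa [gen] using key .e2_f2
  case e1_f2 => simpa [gen] using key .e1_f2
  case e2_f1 => simpa [gen] using key .e2_f1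
  case e2_sq => simpa [gen] using key .e2_sq
  case f2_sq => simpa [gen] using key .f2_sq
  case serre_e => simpa [gen] using key .serre_e
  case serre_f => simpa [gen] using key .serre_f
  case e1_pow => simpa [gen] using key .e1_pow
  case f1_pow => simpa [gen] using key .f1_pow
  case sigma_sq => simpa [gen] using key .sigma_sq
  case sigma_k => intro i; simpa [gen] using key (.sigma_k i)
  case sigma_e => intro i; simpa [gen] using key (.sigma_e i)
  case sigma_f => intro i; simpa [gen] using key (.sigma_f i)
  case k_pow => intro i; simpa [gen] using key (.k_pow i)

section lift

variable {ℓ : ℕ} {B : Type*} [Ring B] [Algebra ℂ B] {g : Gen → B}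

/-- The algebra map out of `U0 ℓ` given by a family that satisfies the relations. -/
def lift (h : Satisfies ℓ g) : U0 ℓ →ₐ[ℂ] B :=
  RingQuot.liftAlgHom ℂ ⟨FreeAlgebra.lift ℂ g, by
    intro x y r
    cases r <;> simp only [map_mul, map_one, map_add, map_sub, map_pow, map_smul, map_zero,
      FreeAlgebra.lift_ι_apply, h.k_comm, h.k_kInv, h.kInv_k, h.k_e, h.k_f, h.e1_f1, h.e2_f2,
      h.e1_f2, h.e2_f1, h.e2_sq, h.f2_sq, h.serre_e, h.serre_f, h.e1_pow, h.f1_pow, h.sigma_sq,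
      h.sigma_k, h.sigma_e, h.sigma_f, h.k_pow]⟩

@[simp] theorem lift_gen (h : Satisfies ℓ g) (a : Gen) : lift h (gen ℓ a) = g a := by
  simp only [lift, gen, mk]
  erw [RingQuot.liftAlgHom_mkAlgHom_apply]
  simp

theorem hom_ext {φ ψ : U0 ℓ →ₐ[ℂ] B} (h : ∀ a, φ (gen ℓ a) = ψ (gen ℓ a)) : φ = ψ := by
  apply RingQuot.ringQuot_ext'
  apply FreeAlgebra.hom_ext
  funext a
  exact h a

/-- Induction: a property of elements of `U0 ℓ`. -/
theorem induction {P : U0 ℓ → Prop} (hs : ∀ c : ℂ, P (algebraMap ℂ _ c)) (hg : ∀ a, P (gen ℓ a))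
    (ha : ∀ x y, P x → P y → P (x + y)) (hm : ∀ x y, P x → P y → P (x * y)) (x : U0 ℓ) : P x := by
  obtain ⟨y, rfl⟩ : ∃ y, mk ℓ y = x := RingQuot.mkAlgHom_surjective ℂ (Rel ℓ) x
  induction y with
  | grade0 c => simpa using hs c
  | grade1 a => exact hg a
  | mul a b h1 h2 => rw [map_mul]; exact hm _ _ h1 h2
  | add a b h1 h2 => rw [map_add]; exact ha _ _ h1 h2

end lift

/-! ### A `q`-binomial identity at a root of unity -/

/-- Gaussian binomial coefficients. -/
def gauss (q : ℂ) : ℕ → ℕ → ℂ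
  | _, 0 => 1
  | 0, _ + 1 => 0
  | n + 1, m + 1 => gauss q n m + q ^ (m + 1) * gauss q n (m + 1)

theorem gauss_zero_right (q : ℂ) (n : ℕ) : gauss q n 0 = 1 := by cases n <;> rfl

theorem gauss_step (q : ℂ) (n m : ℕ) :
    q ^ m * (q ^ (m + 1) - 1) * gauss q n (m + 1) = (q ^ n - q ^ m) * gauss q n m := by
  induction n generalizing m with
  | zero => cases m <;> simp [gauss]
  | succ n ih =>
    cases m with
    | zero =>
      have h := ih 0
      simp only [gauss_zero_right, gauss] at h ⊢
      linear_combination q * h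
    | succ m =>
      have h1 := ih (m + 1)
      have h2 := ih m
      simp only [gauss] at h1 h2 ⊢
      linear_combination q ^ (m + 2) * h1 + q * h2

theorem gauss_absorb (q : ℂ) (hq : q ≠ 0) (n m : ℕ) :
    (q ^ (m + 1) - 1) * gauss q (n + 1) (m + 1) = (q ^ (n + 1) - 1) * gauss q n m := by
  have h := gauss_step q n m
  have hqm : q ^ m ≠ 0 := pow_ne_zero _ hq
  apply mul_left_cancel₀ hqm
  simp only [gauss]
  linear_combination q ^ (m + 1) * h

section qbinom

variable {B : Type*} [Ring B] [Algebra ℂ B] {q : ℂ} {x y : B}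

theorem mul_pow_of_qcomm (h : y * x = q • (x * y)) (n : ℕ) : y * x ^ n = q ^ n • (x ^ n * y) := by
  induction n with
  | zero => simp
  | succ n ih =>
    rw [pow_succ, ← mul_assoc, ih, smul_mul_assoc, mul_assoc, h, mul_smul_comm, smul_smul,
      ← mul_assoc, ← pow_succ, ← pow_succ]

theorem add_pow_of_qcomm (h : y * x = q • (x * y)) (n : ℕ) :
    (x + y) ^ n = ∑ m ∈ Finset.range (n + 1), gauss q n m • (x ^ m * y ^ (n - m)) := by
  induction n with
  | zero => simp [gauss]
  | succ n ih =>
    rw [pow_succ', ih, add_mul, Finset.mul_sum, Finset.mul_sum]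
    have h1 : ∀ m ∈ Finset.range (n + 1), y * gauss q n m • (x ^ m * y ^ (n - m)) =
        (q ^ m * gauss q n m) • (x ^ m * y ^ (n + 1 - m)) := by
      intro m hm
      have hm' : n + 1 - m = (n - m) + 1 := by
        have := Finset.mem_range.1 hm
        omega
      rw [mul_smul_comm, ← mul_assoc, mul_pow_of_qcomm h, smul_mul_assoc, smul_smul, mul_assoc,
        ← pow_succ', hm', mul_comm]
    have h2 : ∀ m ∈ Finset.range (n + 1), x * gauss q n m • (x ^ m * y ^ (n - m)) =
        gauss q n m • (x ^ (m + 1) * y ^ (n + 1 - (m + 1))) := by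
      intro m _
      rw [mul_smul_comm, ← mul_assoc, ← pow_succ', Nat.add_sub_add_right]
    rw [Finset.sum_congr rfl h1, Finset.sum_congr rfl h2]
    rw [Finset.sum_range_succ' _ (n + 1)]
    simp only [gauss, add_smul, Finset.sum_add_distrib]
    rw [add_assoc]
    congr 1
    rw [Finset.sum_range_succ' _ n, Finset.sum_range_succ _ n]
    have h0 : gauss q n (n + 1) = 0 := by
      clear ih h1 h2
      have : ∀ n m, n < m → gauss q n m = 0 := by
        intro n
        induction n with
        | zero => intro m hm; cases m <;> simp_all [gauss]
        | succ n ih =>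
          intro m hm
          cases m with
          | zero => omega
          | succ m => simp [gauss, ih m (by omega), ih (m + 1) (by omega)]
      exact this _ _ (by omega)
    simp [h0, gauss_zero_right]

theorem add_pow_of_qcomm_root {ℓ : ℕ} (hq : IsPrimitiveRoot q ℓ) (hℓ : 0 < ℓ)
    (h : y * x = q • (x * y)) : (x + y) ^ ℓ = x ^ ℓ + y ^ ℓ := by
  obtain ⟨n, rfl⟩ : ∃ n, ℓ = n + 1 := ⟨ℓ - 1, by omega⟩
  have key : ∀ m, m < n → gauss q (n + 1) (m + 1) = 0 := by
    intro m hm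
    have h1 := gauss_absorb q (hq.ne_zero (by omega)) n m
    rw [hq.pow_eq_one, sub_self, zero_mul] at h1
    refine (mul_eq_zero.1 h1).resolve_left ?_
    exact sub_ne_zero.2 (hq.pow_ne_one_of_pos_of_lt (by omega) (by omega))
  have kn : gauss q (n + 1) (n + 1) = 1 := by
    have h0 : ∀ n m, n < m → gauss q n m = 0 := by
      intro n
      induction n with
      | zero => intro m hm; cases m <;> simp_all [gauss]
      | succ n ih =>
        intro m hm
        cases m with
        | zero => omega
        | succ m => simp [gauss, ih m (by omega), ih (m + 1) (by omega)]
    have : ∀ n, gauss q n n = 1 := by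
      intro n
      induction n with
      | zero => simp [gauss]
      | succ n ih => simp [gauss, ih, h0 n (n + 1) (by omega)]
    exact this _
  rw [add_pow_of_qcomm h, Finset.sum_range_succ, Finset.sum_range_succ', Finset.sum_eq_zero]
  · simp [gauss_zero_right, kn, add_comm]
  · intro m hm
    rw [key m (Finset.mem_range.1 hm), zero_smul]

end qbinom

/-! ### Consequences of the relations -/

theorem xi_ne_zero (ℓ : ℕ) : xi ℓ ≠ 0 := Complex.exp_ne_zero _

theorem xi_sq_primitive {ℓ : ℕ} (hℓ : Odd ℓ) : IsPrimitiveRoot (xi ℓ ^ 2) ℓ := by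
  have h : IsPrimitiveRoot (xi ℓ) ℓ := Complex.isPrimitiveRoot_exp ℓ hℓ.pos.ne'
  exact h.pow_of_coprime 2 (Nat.coprime_two_left.2 hℓ)

section general

variable {B : Type*} [Ring B] [Algebra ℂ B]

theorem assoc_swap {x y : B} {c : ℂ} (h : x * y = c • (y * x)) (z : B) :
    x * (y * z) = c • (y * (x * z)) := by
  rw [← mul_assoc, h, smul_mul_assoc, mul_assoc]

theorem assoc_comm {B : Type*} [Ring B] {x y : B} (h : x * y = y * x) (z : B) : x * (y * z) = y * (x * z) := by
  rw [← mul_assoc, h, mul_assoc]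

theorem assoc_one {B : Type*} [Ring B] {x y : B} (h : x * y = 1) (z : B) : x * (y * z) = z := by
  rw [← mul_assoc, h, one_mul]

theorem swap_of_conj {x y v : B} {c : ℂ} (h : x * y * v = c • y) (hv : v * x = 1) :
    x * y = c • (y * x) := by
  rw [← smul_mul_assoc, ← h, mul_assoc, hv, mul_one]

theorem swap_inv_of_conj {x y v : B} {c : ℂ} (hc : c ≠ 0) (h : x * y * v = c • y)
    (hv : v * x = 1) : v * y = c⁻¹ • (y * v) := by
  have h1 : v * (x * y * v) = y * v := by rw [mul_assoc, assoc_one hv]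
  rw [h, mul_smul_comm] at h1
  rw [← h1, smul_smul, inv_mul_cancel₀ hc, one_smul]

theorem inv_comm {B : Type*} [Ring B] {x y v : B} (h : x * y = y * x) (hv : v * x = 1) (hv' : x * v = 1) :
    v * y = y * v := by
  calc v * y = v * (y * x) * v := by rw [mul_assoc, mul_assoc, hv', mul_one]
    _ = y * v := by rw [← h, ← mul_assoc, hv, one_mul]

theorem serre_add {q : ℂ} (hq : q ≠ 0) {a b c d : B}
    (hba : b * a = (q ^ 2)⁻¹ • (a * b)) (hbc : b * c = q • (c * b)) (hda : d * a = q • (a * d))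
    (h1 : a ^ 2 * c - (q + q⁻¹) • (a * c * a) + c * a ^ 2 = 0)
    (h2 : b ^ 2 * d - (q + q⁻¹) • (b * d * b) + d * b ^ 2 = 0) :
    (a + b) ^ 2 * (c + d) - (q + q⁻¹) • ((a + b) * (c + d) * (a + b)) + (c + d) * (a + b) ^ 2
      = 0 := by
  have e : (a + b) ^ 2 * (c + d) - (q + q⁻¹) • ((a + b) * (c + d) * (a + b))
      + (c + d) * (a + b) ^ 2 =
      (a ^ 2 * c - (q + q⁻¹) • (a * c * a) + c * a ^ 2) +
      (b ^ 2 * d - (q + q⁻¹) • (b * d * b) + d * b ^ 2) := by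
    simp only [pow_two a, pow_two b, pow_two (a + b), mul_add, add_mul, mul_assoc, hba, hbc, hda,
      assoc_swap hba, assoc_swap hbc, assoc_swap hda, mul_smul_comm, smul_mul_assoc, smul_add,
      smul_smul]
    match_scalars <;> field_simp <;> ring
  rw [e, h1, h2, add_zero]

theorem mul_pow_eq_zero {x y : B} {q : ℂ} {n : ℕ} (h : y * x = q • (x * y)) (hx : x ^ n = 0) :
    (x * y) ^ n = 0 := by
  have : ∀ m, ∃ c : ℂ, (x * y) ^ m = c • (x ^ m * y ^ m) := by
    intro m
    induction m with
    | zero => exact ⟨1, by simp⟩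
    | succ m ih =>
      obtain ⟨c, hc⟩ := ih
      refine ⟨q ^ m * c, ?_⟩
      have h' : ∀ m : ℕ, y ^ m * x = q ^ m • (x * y ^ m) := by
        intro m
        induction m with
        | zero => simp
        | succ m ih =>
          rw [pow_succ, mul_assoc, h, mul_smul_comm, ← mul_assoc, ih, smul_mul_assoc, smul_smul,
            mul_assoc, ← pow_succ, ← pow_succ']
      rw [pow_succ, hc, smul_mul_assoc, mul_assoc, ← mul_assoc (y ^ m), h', smul_mul_assoc,
        mul_smul_comm, smul_smul, mul_comm c, mul_assoc x, ← pow_succ, ← mul_assoc, ← pow_succ]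
  obtain ⟨c, hc⟩ := this n
  rw [hc, hx, zero_mul, smul_zero]

end general

theorem cartan_00 : cartan 0 0 = 2 := rfl
theorem cartan_01 : cartan 0 1 = -1 := rfl
theorem cartan_10 : cartan 1 0 = -1 := rfl
theorem cartan_11 : cartan 1 1 = 0 := rfl

namespace Satisfies

variable {ℓ : ℕ} {B : Type*} [Ring B] [Algebra ℂ B] {g : Gen → B}

theorem k_e' (h : Satisfies ℓ g) (i j : Fin 2) : g (k i) * g (e j) = xi ℓ ^ cartan i j • (g (e j) * g (k i)) :=
  swap_of_conj (h.k_e i j) (h.kInv_k i)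

theorem k_f' (h : Satisfies ℓ g) (i j : Fin 2) : g (k i) * g (f j) = xi ℓ ^ (-cartan i j) • (g (f j) * g (k i)) :=
  swap_of_conj (h.k_f i j) (h.kInv_k i)

theorem kInv_e' (h : Satisfies ℓ g) (i j : Fin 2) :
    g (kInv i) * g (e j) = xi ℓ ^ (-cartan i j) • (g (e j) * g (kInv i)) := by
  rw [zpow_neg]
  exact swap_inv_of_conj (zpow_ne_zero _ (xi_ne_zero ℓ)) (h.k_e i j) (h.kInv_k i)

theorem kInv_f' (h : Satisfies ℓ g) (i j : Fin 2) :
    g (kInv i) * g (f j) = xi ℓ ^ (cartan i j) • (g (f j) * g (kInv i)) := by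
  have := swap_inv_of_conj (zpow_ne_zero _ (xi_ne_zero ℓ)) (h.k_f i j) (h.kInv_k i)
  rwa [zpow_neg, inv_inv] at this

theorem k_k (h : Satisfies ℓ g) (i j : Fin 2) : g (k i) * g (k j) = g (k j) * g (k i) := by
  fin_cases i <;> fin_cases j
  · rfl
  · exact h.k_comm
  · exact h.k_comm.symm
  · rfl

theorem kInv_kk (h : Satisfies ℓ g) (i j : Fin 2) : g (kInv i) * g (k j) = g (k j) * g (kInv i) :=
  inv_comm (h.k_k i j) (h.kInv_k i) (h.k_kInv i)

theorem kInv_kInv (h : Satisfies ℓ g) (i j : Fin 2) : g (kInv i) * g (kInv j) = g (kInv j) * g (kInv i) :=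
  inv_comm (h.kInv_kk j i).symm (h.kInv_k i) (h.k_kInv i)

theorem kInv_sigma (h : Satisfies ℓ g) (i : Fin 2) : g (kInv i) * g sigma = g sigma * g (kInv i) :=
  inv_comm (h.sigma_k i).symm (h.kInv_k i) (h.k_kInv i)

theorem kInv_pow (h : Satisfies ℓ g) (i : Fin 2) : g (kInv i) ^ ℓ = 1 := by
  have : (g (k i) * g (kInv i)) ^ ℓ = g (k i) ^ ℓ * g (kInv i) ^ ℓ :=
    Commute.mul_pow (h.kInv_kk i i).symm ℓ
  rwa [h.k_kInv, one_pow, h.k_pow, one_mul, eq_comm] at this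

theorem e2_e2 (h : Satisfies ℓ g) : g (e 1) * g (e 1) = 0 := by rw [← pow_two, h.e2_sq]
theorem f2_f2 (h : Satisfies ℓ g) : g (f 1) * g (f 1) = 0 := by rw [← pow_two, h.f2_sq]
theorem sigma_sigma (h : Satisfies ℓ g) : g sigma * g sigma = 1 := by rw [← pow_two, h.sigma_sq]

end Satisfies

/-! ### The coproduct, the counit and the antipode -/

/-- The coproduct on generators: `k_i ↦ k_i ⊗ k_i`, `σ ↦ σ ⊗ σ`,
`e_i ↦ e_i ⊗ 1 + k_i⁻¹ σ^{deg e_i} ⊗ e_i`, `f_i ↦ f_i ⊗ k_i + σ^{deg f_i} ⊗ f_i`. -/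
def comulGen {B : Type*} [Ring B] [Algebra ℂ B] (g : Gen → B) : Gen → B ⊗[ℂ] B
  | k i => g (k i) ⊗ₜ g (k i)
  | kInv i => g (kInv i) ⊗ₜ g (kInv i)
  | e i => g (e i) ⊗ₜ 1 + (g (kInv i) * g sigma ^ (i : ℕ)) ⊗ₜ g (e i)
  | f i => g (f i) ⊗ₜ g (k i) + (g sigma ^ (i : ℕ)) ⊗ₜ g (f i)
  | sigma => g sigma ⊗ₜ g sigma

/-- The counit on generators: `ε(k_i) = ε(σ) = 1`, `ε(e_i) = ε(f_i) = 0`. -/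
def counitGen : Gen → ℂ
  | k _ => 1
  | kInv _ => 1
  | e _ => 0
  | f _ => 0
  | sigma => 1

/-- The antipode on generators: `k_i ↦ k_i⁻¹`, `σ ↦ σ`, `e_i ↦ -σ^{deg e_i} k_i e_i`,
`f_i ↦ -σ^{deg f_i} f_i k_i⁻¹`. It is an algebra map to the opposite algebra. -/
def antipodeGen {B : Type*} [Ring B] [Algebra ℂ B] (g : Gen → B) : Gen → Bᵐᵒᵖ
  | k i => .op (g (kInv i))
  | kInv i => .op (g (k i))
  | e i => .op (-(g sigma ^ (i : ℕ) * g (k i) * g (e i)))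
  | f i => .op (-(g sigma ^ (i : ℕ) * g (f i) * g (kInv i)))
  | sigma => .op (g sigma)

theorem counit_satisfies (ℓ : ℕ) [Fact (Odd ℓ)] : Satisfies ℓ counitGen := by
  have hℓ : ℓ ≠ 0 := (Fact.out : Odd ℓ).pos.ne'
  constructor <;> intros <;> simp [counitGen, hℓ]

section structureMaps

set_option linter.unusedSimpArgs false
set_option linter.unnecessarySeqFocus false

variable {ℓ : ℕ} {B : Type*} [Ring B] [Algebra ℂ B] {g : Gen → B}

open Algebra.TensorProduct in
theorem comul_satisfies (hodd : Odd ℓ) (h : Satisfies ℓ g) : Satisfies ℓ (comulGen g) := by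
  have hx := xi_ne_zero ℓ
  constructor
  case k_comm => simp [comulGen, h.k_comm]
  case k_kInv => intro i; simp [comulGen, h.k_kInv, one_def]
  case kInv_k => intro i; simp [comulGen, h.kInv_k, one_def]
  case k_e =>
    intro i j
    have h1 : g (k i) * (g (kInv j) * g sigma ^ (j : ℕ)) * g (kInv i)
        = g (kInv j) * g sigma ^ (j : ℕ) := by
      have c1 : Commute (g (k i)) (g (kInv j) * g sigma ^ (j : ℕ)) :=
        Commute.mul_right (h.kInv_kk j i).symm (Commute.pow_right (h.sigma_k i).symm _)
      rw [c1.eq, mul_assoc, h.k_kInv, mul_one]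
    simp only [comulGen, mul_add, add_mul, tmul_mul_tmul, h1, h.k_e, mul_one, h.k_kInv, smul_add,
      TensorProduct.tmul_smul, TensorProduct.smul_tmul']
  case k_f =>
    intro i j
    have h1 : g (k i) * g sigma ^ (j : ℕ) * g (kInv i) = g sigma ^ (j : ℕ) := by
      have c1 : Commute (g (k i)) (g sigma ^ (j : ℕ)) := Commute.pow_right (h.sigma_k i).symm _
      rw [c1.eq, mul_assoc, h.k_kInv, mul_one]
    have h2 : g (k i) * g (k j) * g (kInv i) = g (k j) := by
      rw [h.k_k, mul_assoc, h.k_kInv, mul_one]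
    simp only [comulGen, mul_add, add_mul, tmul_mul_tmul, h1, h2, h.k_f, smul_add,
      TensorProduct.tmul_smul, TensorProduct.smul_tmul']
  case e1_f1 =>
    have r : g (e 0) * g (f 0) = g (f 0) * g (e 0) +
      (xi ℓ - (xi ℓ)⁻¹)⁻¹ • (g (k 0) - g (kInv 0)) := by rw [← h.e1_f1]; abel
    simp only [comulGen, Fin.val_zero, pow_zero, mul_add, add_mul, tmul_mul_tmul, mul_one,
      one_mul, r, h.kInv_f', h.k_e', cartan_00, zpow_ofNat, TensorProduct.tmul_add, TensorProduct.add_tmul,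
      TensorProduct.tmul_sub, TensorProduct.sub_tmul, TensorProduct.tmul_neg,
      TensorProduct.neg_tmul, TensorProduct.tmul_smul, ← TensorProduct.smul_tmul', smul_sub,
      smul_add, smul_smul]
    match_scalars <;> ring
  case e2_f2 =>
    have r : g (e 1) * g (f 1) = -(g (f 1) * g (e 1)) +
      (xi ℓ - (xi ℓ)⁻¹)⁻¹ • (g (k 1) - g (kInv 1)) := by rw [← h.e2_f2]; abel
    have s1 := h.sigma_e 1
    have s2 := h.sigma_f 1
    simp only [Fin.val_one, pow_one, neg_one_smul] at s1 s2
    have s3 : ∀ z, g sigma * (g (f 1) * z) = -(g (f 1) * (g sigma * z)) := by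
      intro z
      rw [← mul_assoc, s2, neg_mul, mul_assoc]
    simp only [comulGen, Fin.val_one, pow_one, mul_add, add_mul, tmul_mul_tmul, mul_one,
      one_mul, r, mul_assoc, s1, s2, s3, h.kInv_f', assoc_swap (h.kInv_f' 1 1), mul_neg,
      h.k_e', h.sigma_sigma, h.kInv_sigma, assoc_one h.sigma_sigma,
      cartan_11, neg_zero, zpow_zero, one_smul, TensorProduct.tmul_add, TensorProduct.add_tmul,
      TensorProduct.tmul_sub, TensorProduct.sub_tmul, TensorProduct.tmul_neg,
      TensorProduct.neg_tmul, TensorProduct.tmul_smul, ← TensorProduct.smul_tmul', smul_sub,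
      smul_add, smul_smul]
    match_scalars <;> ring
  case e1_f2 =>
    have r : g (e 0) * g (f 1) = g (f 1) * g (e 0) := sub_eq_zero.1 h.e1_f2
    have s1 := h.sigma_e 0
    simp only [Fin.val_zero, pow_zero, one_smul] at s1
    simp only [comulGen, Fin.val_one, Fin.val_zero, pow_zero, pow_one, mul_add, add_mul,
      tmul_mul_tmul, mul_one, one_mul, r, s1, h.kInv_f', h.k_e', h.kInv_sigma, cartan_01,
      cartan_10, TensorProduct.tmul_add, TensorProduct.add_tmul,
      TensorProduct.tmul_sub, TensorProduct.sub_tmul, TensorProduct.tmul_neg,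
      TensorProduct.neg_tmul, TensorProduct.tmul_smul, ← TensorProduct.smul_tmul', smul_sub,
      smul_add, smul_smul]
    match_scalars <;> ring
  case e2_f1 =>
    have r : g (e 1) * g (f 0) = g (f 0) * g (e 1) := sub_eq_zero.1 h.e2_f1
    have s1 := h.sigma_f 0
    simp only [Fin.val_zero, pow_zero, one_smul] at s1
    simp only [comulGen, Fin.val_one, Fin.val_zero, pow_zero, pow_one, mul_add, add_mul,
      tmul_mul_tmul, mul_one, one_mul, r, mul_assoc, s1, h.kInv_f', assoc_swap (h.kInv_f' 1 0),
      mul_smul_comm, h.k_e', cartan_01, cartan_10, TensorProduct.tmul_add, TensorProduct.add_tmul,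
      TensorProduct.tmul_sub, TensorProduct.sub_tmul, TensorProduct.tmul_neg,
      TensorProduct.neg_tmul, TensorProduct.tmul_smul, ← TensorProduct.smul_tmul', smul_sub,
      smul_add, smul_smul]
    match_scalars <;> ring
  case e2_sq =>
    have s1 := h.sigma_e 1
    simp only [Fin.val_one, pow_one, neg_one_smul] at s1
    simp only [comulGen, Fin.val_one, pow_one, pow_two, mul_add, add_mul, tmul_mul_tmul, mul_one,
      one_mul, h.e2_e2, TensorProduct.tmul_zero, TensorProduct.zero_tmul, mul_assoc, s1, mul_neg,
      h.kInv_e', assoc_swap (h.kInv_e' 1 1), cartan_11, neg_zero, zpow_zero, one_smul,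
      TensorProduct.neg_tmul]
    abel
  case f2_sq =>
    have s1 := h.sigma_f 1
    simp only [Fin.val_one, pow_one, neg_one_smul] at s1
    simp only [comulGen, Fin.val_one, pow_one, pow_two, mul_add, add_mul, tmul_mul_tmul, mul_one,
      one_mul, h.f2_f2, TensorProduct.tmul_zero, TensorProduct.zero_tmul, s1,
      h.k_f', cartan_11, neg_zero, zpow_zero, one_smul, TensorProduct.neg_tmul]
    abel
  case serre_e =>
    have s1 := h.sigma_e 0
    simp only [Fin.val_zero, pow_zero, one_smul] at s1
    have q1 := h.kInv_e' 0 0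
    have q2 := h.kInv_e' 0 1
    have q3 := h.kInv_e' 1 0
    rw [cartan_00, zpow_neg, zpow_ofNat] at q1
    rw [cartan_01, neg_neg, zpow_one] at q2
    rw [cartan_10, neg_neg, zpow_one] at q3
    simp only [comulGen, Fin.val_zero, Fin.val_one, pow_zero, pow_one, mul_one]
    apply serre_add hx
    · simp only [tmul_mul_tmul, mul_one, one_mul, q1, ← TensorProduct.smul_tmul']
    · simp only [tmul_mul_tmul, mul_one, one_mul, q2, ← TensorProduct.smul_tmul']
    · simp only [tmul_mul_tmul, mul_one, one_mul, mul_assoc, s1, assoc_swap q3,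
        ← TensorProduct.smul_tmul']
    · have := congrArg (fun x => x ⊗ₜ[ℂ] (1 : B)) h.serre_e
      simpa only [TensorProduct.add_tmul, TensorProduct.sub_tmul, ← TensorProduct.smul_tmul',
        tmul_mul_tmul, pow_two, mul_one, TensorProduct.zero_tmul] using this
    · have := congrArg (fun x => (g (kInv 0) ^ 2 * (g (kInv 1) * g sigma)) ⊗ₜ[ℂ] x) h.serre_e
      have c1 : g (kInv 0) * (g (kInv 1) * g sigma) = g (kInv 1) * g sigma * g (kInv 0) := by
        rw [mul_assoc, ← h.kInv_sigma, ← mul_assoc, h.kInv_kInv, mul_assoc]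
      simp only [pow_two, tmul_mul_tmul, mul_assoc (g (kInv 0)), c1, ← mul_assoc (g (kInv 0))]
      simp only [pow_two, mul_assoc (g (kInv 0)), c1, ← mul_assoc (g (kInv 0))] at this
      simpa only [TensorProduct.tmul_add, TensorProduct.tmul_sub, TensorProduct.tmul_smul,
        TensorProduct.tmul_zero, mul_assoc] using this
  case serre_f =>
    have s1 := h.sigma_f 0
    simp only [Fin.val_zero, pow_zero, one_smul] at s1
    have q1 := h.k_f' 0 0
    have q2 := h.k_f' 1 0
    have q3 := h.k_f' 0 1
    rw [cartan_00, zpow_neg, zpow_ofNat] at q1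
    rw [cartan_10, neg_neg, zpow_one] at q2
    rw [cartan_01, neg_neg, zpow_one] at q3
    have hs : xi ℓ + (xi ℓ)⁻¹ = (xi ℓ)⁻¹ + ((xi ℓ)⁻¹)⁻¹ := by rw [inv_inv, add_comm]
    simp only [comulGen, Fin.val_zero, Fin.val_one, pow_zero, pow_one]
    rw [hs]
    apply serre_add (inv_ne_zero hx)
    · simp only [tmul_mul_tmul, mul_one, one_mul, q1, TensorProduct.tmul_smul, smul_smul]
      rw [inv_pow, inv_inv, mul_inv_cancel₀ (pow_ne_zero _ hx), one_smul]
    · simp only [tmul_mul_tmul, mul_one, one_mul, q2, TensorProduct.tmul_smul, smul_smul]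
      rw [inv_mul_cancel₀ hx, one_smul]
    · simp only [tmul_mul_tmul, mul_one, one_mul, s1, q3, TensorProduct.tmul_smul, smul_smul]
      rw [inv_mul_cancel₀ hx, one_smul]
    · have := congrArg (fun x => x ⊗ₜ[ℂ] (g (k 0) ^ 2 * g (k 1))) h.serre_f
      have c1 := h.k_k 1 0
      rw [← hs]
      simp only [pow_two, tmul_mul_tmul, mul_assoc (g (k 0)), c1, assoc_comm c1]
      simpa only [pow_two, TensorProduct.add_tmul, TensorProduct.sub_tmul,
        ← TensorProduct.smul_tmul', TensorProduct.zero_tmul, mul_assoc (g (k 0))] using this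
    · have := congrArg (fun x => (g sigma) ⊗ₜ[ℂ] x) h.serre_f
      rw [← hs]
      simp only [pow_two, tmul_mul_tmul, one_mul, mul_one]
      simpa only [pow_two, TensorProduct.tmul_add, TensorProduct.tmul_sub,
        TensorProduct.tmul_smul, TensorProduct.tmul_zero] using this
  case e1_pow =>
    have q1 := h.kInv_e' 0 0
    rw [cartan_00, zpow_neg, zpow_ofNat] at q1
    simp only [comulGen, Fin.val_zero, pow_zero, mul_one]
    rw [add_pow_of_qcomm_root (xi_sq_primitive hodd).inv hodd.pos]
    · simp [tmul_pow, h.e1_pow]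
    · simp only [tmul_mul_tmul, mul_one, one_mul, q1, ← TensorProduct.smul_tmul']
  case f1_pow =>
    have q1 := h.k_f' 0 0
    rw [cartan_00, zpow_neg, zpow_ofNat] at q1
    simp only [comulGen, Fin.val_zero, pow_zero]
    rw [add_pow_of_qcomm_root (xi_sq_primitive hodd) hodd.pos]
    · simp [tmul_pow, h.f1_pow]
    · simp only [tmul_mul_tmul, mul_one, one_mul, q1, TensorProduct.tmul_smul, smul_smul]
      rw [mul_inv_cancel₀ (pow_ne_zero _ hx), one_smul]
  case sigma_sq => simp [comulGen, pow_two, h.sigma_sigma, one_def]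
  case sigma_k => intro i; simp [comulGen, h.sigma_k]
  case sigma_e =>
    intro i
    simp only [comulGen, mul_add, add_mul, tmul_mul_tmul, h.sigma_e, mul_one, one_mul, smul_add,
      TensorProduct.tmul_smul, ← TensorProduct.smul_tmul']
    rw [← mul_assoc, ← h.kInv_sigma, mul_assoc, mul_assoc, ← pow_succ', ← pow_succ]
  case sigma_f =>
    intro i
    simp only [comulGen, mul_add, add_mul, tmul_mul_tmul, h.sigma_f, h.sigma_k, smul_add,
      TensorProduct.tmul_smul, ← TensorProduct.smul_tmul', ← pow_succ', ← pow_succ]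
  case k_pow => intro i; simp [comulGen, tmul_pow, h.k_pow, one_def]


theorem antipode_satisfies (h : Satisfies ℓ g) : Satisfies ℓ (antipodeGen g) := by
  have hx := xi_ne_zero ℓ
  have se0 := h.sigma_e 0
  have se1 := h.sigma_e 1
  have sf0 := h.sigma_f 0
  have sf1 := h.sigma_f 1
  simp only [Fin.val_zero, Fin.val_one, pow_zero, pow_one, one_smul, neg_one_smul] at se0 se1 sf0 sf1
  have re1 : ∀ z, g sigma * (g (e 1) * z) = -(g (e 1) * (g sigma * z)) := fun z => by
    rw [← mul_assoc, se1, neg_mul, mul_assoc]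
  have rf1 : ∀ z, g sigma * (g (f 1) * z) = -(g (f 1) * (g sigma * z)) := fun z => by
    rw [← mul_assoc, sf1, neg_mul, mul_assoc]
  have ke00 := h.k_e' 0 0
  have ke01 := h.k_e' 0 1
  have ke10 := h.k_e' 1 0
  have ke11 := h.k_e' 1 1
  have kf00 := h.k_f' 0 0
  have kf01 := h.k_f' 0 1
  have kf10 := h.k_f' 1 0
  have kf11 := h.k_f' 1 1
  have Ke00 := h.kInv_e' 0 0
  have Ke01 := h.kInv_e' 0 1
  have Ke10 := h.kInv_e' 1 0
  have Ke11 := h.kInv_e' 1 1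
  have Kf00 := h.kInv_f' 0 0
  have Kf01 := h.kInv_f' 0 1
  have Kf10 := h.kInv_f' 1 0
  have Kf11 := h.kInv_f' 1 1
  simp only [cartan_00, cartan_01, cartan_10, cartan_11, neg_neg, neg_zero, zpow_zero, one_smul,
    zpow_neg, zpow_one, zpow_ofNat, pow_one, pow_zero] at ke00 ke01 ke10 ke11 kf00 kf01 kf10 kf11
  simp only [cartan_00, cartan_01, cartan_10, cartan_11, neg_neg, neg_zero, zpow_zero, one_smul,
    zpow_neg, zpow_one, zpow_ofNat, pow_one, pow_zero] at Ke00 Ke01 Ke10 Ke11 Kf00 Kf01 Kf10 Kf11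
  have ks (i : Fin 2) : g (k i) * g sigma = g sigma * g (k i) := (h.sigma_k i).symm
  constructor <;> intros <;> apply MulOpposite.unop_injective
  case k_comm => simp [antipodeGen, h.kInv_kInv 1 0]
  case k_kInv i => simp [antipodeGen, h.k_kInv]
  case kInv_k i => simp [antipodeGen, h.kInv_k]
  case k_e i j =>
    have c1 : g (k i) * g sigma ^ (j : ℕ) = g sigma ^ (j : ℕ) * g (k i) :=
      Commute.pow_right (ks i) _
    simp only [antipodeGen, MulOpposite.unop_mul, MulOpposite.unop_add, MulOpposite.unop_sub,
      MulOpposite.unop_smul, MulOpposite.unop_pow, MulOpposite.unop_op, MulOpposite.unop_zero,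
      MulOpposite.unop_one, Fin.val_zero, Fin.val_one, pow_zero, pow_one, one_mul, pow_two,
      mul_assoc, neg_mul, mul_neg, neg_neg, mul_smul_comm, smul_mul_assoc, smul_smul, smul_neg,
      one_smul, mul_one, mul_add, mul_sub, smul_add, smul_sub, add_mul, sub_mul, neg_add, assoc_comm c1, assoc_comm (h.k_k i j)]
    rw [← mul_assoc (g (k i)), h.k_e, mul_smul_comm, mul_smul_comm]
  case k_f i j =>
    have c1 : g (k i) * g sigma ^ (j : ℕ) = g sigma ^ (j : ℕ) * g (k i) :=
      Commute.pow_right (ks i) _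
    have c2 := h.kInv_kInv j i
    simp only [antipodeGen, MulOpposite.unop_mul, MulOpposite.unop_add, MulOpposite.unop_sub,
      MulOpposite.unop_smul, MulOpposite.unop_pow, MulOpposite.unop_op, MulOpposite.unop_zero,
      MulOpposite.unop_one, Fin.val_zero, Fin.val_one, pow_zero, pow_one, one_mul, pow_two,
      mul_assoc, neg_mul, mul_neg, neg_neg, mul_smul_comm, smul_mul_assoc, smul_smul, smul_neg,
      one_smul, mul_one, mul_add, mul_sub, smul_add, smul_sub, add_mul, sub_mul, neg_add, assoc_comm c1, c2]
    rw [← mul_assoc (g (f j)), ← mul_assoc (g (k i)), ← mul_assoc (g (k i)), h.k_f,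
      smul_mul_assoc, mul_smul_comm]
  case e1_f1 =>
    have r : ∀ z, g (e 0) * (g (f 0) * z) = g (f 0) * (g (e 0) * z) +
        (xi ℓ - (xi ℓ)⁻¹)⁻¹ • (g (k 0) * z - g (kInv 0) * z) := fun z => by
      rw [← mul_assoc, ← mul_assoc, ← sub_mul, ← smul_mul_assoc, ← h.e1_f1]; noncomm_ring
    simp only [antipodeGen, MulOpposite.unop_mul, MulOpposite.unop_add, MulOpposite.unop_sub,
      MulOpposite.unop_smul, MulOpposite.unop_pow, MulOpposite.unop_op, MulOpposite.unop_zero,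
      MulOpposite.unop_one, Fin.val_zero, Fin.val_one, pow_zero, pow_one, one_mul, pow_two,
      mul_assoc, neg_mul, mul_neg, neg_neg, mul_smul_comm, smul_mul_assoc, smul_smul, smul_neg,
      one_smul, mul_one, mul_add, mul_sub, smul_add, smul_sub, add_mul, sub_mul, neg_add,
      assoc_one (h.kInv_k 0), r, assoc_swap kf00, assoc_swap ke00, h.k_kInv,
      assoc_one (h.k_kInv 0)]
    match_scalars <;> field_simp <;> ring
  case e2_f2 =>
    have r : ∀ z, g (e 1) * (g (f 1) * z) = -(g (f 1) * (g (e 1) * z)) +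
        (xi ℓ - (xi ℓ)⁻¹)⁻¹ • (g (k 1) * z - g (kInv 1) * z) := fun z => by
      rw [← mul_assoc, ← mul_assoc, ← sub_mul, ← smul_mul_assoc, ← h.e2_f2]; noncomm_ring
    simp only [antipodeGen, MulOpposite.unop_mul, MulOpposite.unop_add, MulOpposite.unop_sub,
      MulOpposite.unop_smul, MulOpposite.unop_pow, MulOpposite.unop_op, MulOpposite.unop_zero,
      MulOpposite.unop_one, Fin.val_zero, Fin.val_one, pow_zero, pow_one, one_mul, pow_two,
      mul_assoc, neg_mul, mul_neg, neg_neg, mul_smul_comm, smul_mul_assoc, smul_smul, smul_neg,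
      one_smul, mul_one, mul_add, mul_sub, smul_add, smul_sub, add_mul, sub_mul, neg_add, se1, sf1, re1, rf1, ks, assoc_comm (ks 1), h.kInv_sigma, assoc_comm (h.kInv_sigma 1),
      assoc_one (h.kInv_k 1), r, kf11, ke11, assoc_comm kf11, assoc_comm ke11, Ke11,
      assoc_comm Ke11, h.k_kInv, h.kInv_k, h.sigma_sigma, assoc_one h.sigma_sigma,
      assoc_one (h.k_kInv 1)]
    rw [← smul_sub, ← neg_sub (g (k 1)), smul_neg, ← h.e2_f2]
    abel
  case e1_f2 =>
    have r : g (e 0) * g (f 1) = g (f 1) * g (e 0) := sub_eq_zero.1 h.e1_f2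
    simp only [antipodeGen, MulOpposite.unop_mul, MulOpposite.unop_add, MulOpposite.unop_sub,
      MulOpposite.unop_smul, MulOpposite.unop_pow, MulOpposite.unop_op, MulOpposite.unop_zero,
      MulOpposite.unop_one, Fin.val_zero, Fin.val_one, pow_zero, pow_one, one_mul, pow_two,
      mul_assoc, neg_mul, mul_neg, neg_neg, mul_smul_comm, smul_mul_assoc, smul_smul, smul_neg,
      one_smul, mul_one, mul_add, mul_sub, smul_add, smul_sub, add_mul, sub_mul, neg_add, se0, sf1, rf1, assoc_comm se0, ks, assoc_comm (ks 0), h.kInv_sigma,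
      assoc_comm (h.kInv_sigma 1), r, assoc_comm r, kf01, ke00, ke10, Ke10, assoc_swap kf01,
      assoc_swap ke00, assoc_swap Ke10, h.kInv_kk 1 0, assoc_comm (h.kInv_kk 1 0)]
    match_scalars <;> field_simp <;> ring
  case e2_f1 =>
    have r : g (e 1) * g (f 0) = g (f 0) * g (e 1) := sub_eq_zero.1 h.e2_f1
    simp only [antipodeGen, MulOpposite.unop_mul, MulOpposite.unop_add, MulOpposite.unop_sub,
      MulOpposite.unop_smul, MulOpposite.unop_pow, MulOpposite.unop_op, MulOpposite.unop_zero,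
      MulOpposite.unop_one, Fin.val_zero, Fin.val_one, pow_zero, pow_one, one_mul, pow_two,
      mul_assoc, neg_mul, mul_neg, neg_neg, mul_smul_comm, smul_mul_assoc, smul_smul, smul_neg,
      one_smul, mul_one, mul_add, mul_sub, smul_add, smul_sub, add_mul, sub_mul, neg_add, sf0, se1, re1, assoc_comm sf0, ks, assoc_comm (ks 1), h.kInv_sigma,
      assoc_comm (h.kInv_sigma 0), r, assoc_comm r, kf10, ke11, Ke01, assoc_swap kf10,
      assoc_comm ke11, assoc_swap Ke01, h.kInv_kk 0 1, assoc_comm (h.kInv_kk 0 1)]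
    match_scalars <;> field_simp <;> ring
  case e2_sq =>
    have r : ∀ z, g (e 1) * (g (e 1) * z) = 0 := fun z => by
      rw [← mul_assoc, h.e2_e2, zero_mul]
    simp only [antipodeGen, MulOpposite.unop_mul, MulOpposite.unop_add, MulOpposite.unop_sub,
      MulOpposite.unop_smul, MulOpposite.unop_pow, MulOpposite.unop_op, MulOpposite.unop_zero,
      MulOpposite.unop_one, Fin.val_zero, Fin.val_one, pow_zero, pow_one, one_mul, pow_two,
      mul_assoc, neg_mul, mul_neg, neg_neg, mul_smul_comm, smul_mul_assoc, smul_smul, smul_neg,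
      one_smul, mul_one, mul_add, mul_sub, smul_add, smul_sub, add_mul, sub_mul, neg_add, se1, re1, ks, assoc_comm (ks 1), ke11, assoc_comm ke11, r, mul_zero, neg_zero]
  case f2_sq =>
    have r : ∀ z, g (f 1) * (g (f 1) * z) = 0 := fun z => by
      rw [← mul_assoc, h.f2_f2, zero_mul]
    simp only [antipodeGen, MulOpposite.unop_mul, MulOpposite.unop_add, MulOpposite.unop_sub,
      MulOpposite.unop_smul, MulOpposite.unop_pow, MulOpposite.unop_op, MulOpposite.unop_zero,
      MulOpposite.unop_one, Fin.val_zero, Fin.val_one, pow_zero, pow_one, one_mul, pow_two,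
      mul_assoc, neg_mul, mul_neg, neg_neg, mul_smul_comm, smul_mul_assoc, smul_smul, smul_neg,
      one_smul, mul_one, mul_add, mul_sub, smul_add, smul_sub, add_mul, sub_mul, neg_add, sf1, rf1, h.kInv_sigma, assoc_comm (h.kInv_sigma 1), Kf11, assoc_comm Kf11, r,
      mul_zero, neg_zero]
  case serre_e =>
    have r : ∀ z, g (e 0) * (g (e 0) * (g (e 1) * z)) =
        (xi ℓ + (xi ℓ)⁻¹) • (g (e 0) * (g (e 1) * (g (e 0) * z))) -
        g (e 1) * (g (e 0) * (g (e 0) * z)) := fun z => by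
      have := congrArg (fun x => x * z) h.serre_e
      simp only [add_mul, sub_mul, smul_mul_assoc, zero_mul, pow_two, mul_assoc] at this
      rw [← sub_eq_zero, ← this]
      abel
    simp only [antipodeGen, MulOpposite.unop_mul, MulOpposite.unop_add, MulOpposite.unop_sub,
      MulOpposite.unop_smul, MulOpposite.unop_pow, MulOpposite.unop_op, MulOpposite.unop_zero,
      MulOpposite.unop_one, Fin.val_zero, Fin.val_one, pow_zero, pow_one, one_mul, pow_two,
      mul_assoc, neg_mul, mul_neg, neg_neg, mul_smul_comm, smul_mul_assoc, smul_smul, smul_neg,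
      one_smul, mul_one, mul_add, mul_sub, smul_add, smul_sub, add_mul, sub_mul, neg_add, se0, se1, re1, assoc_comm se0, ks, assoc_comm (ks 0), assoc_comm (ks 1), ke00, ke01,
      ke10, ke11, assoc_swap ke00, assoc_swap ke01, assoc_swap ke10, assoc_comm ke11,
      h.k_k 1 0, assoc_comm (h.k_k 1 0), r]
    match_scalars <;> field_simp <;> ring
  case serre_f =>
    have r : ∀ z, g (f 0) * (g (f 0) * (g (f 1) * z)) =
        (xi ℓ + (xi ℓ)⁻¹) • (g (f 0) * (g (f 1) * (g (f 0) * z))) -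
        g (f 1) * (g (f 0) * (g (f 0) * z)) := fun z => by
      have := congrArg (fun x => x * z) h.serre_f
      simp only [add_mul, sub_mul, smul_mul_assoc, zero_mul, pow_two, mul_assoc] at this
      rw [← sub_eq_zero, ← this]
      abel
    simp only [antipodeGen, MulOpposite.unop_mul, MulOpposite.unop_add, MulOpposite.unop_sub,
      MulOpposite.unop_smul, MulOpposite.unop_pow, MulOpposite.unop_op, MulOpposite.unop_zero,
      MulOpposite.unop_one, Fin.val_zero, Fin.val_one, pow_zero, pow_one, one_mul, pow_two,
      mul_assoc, neg_mul, mul_neg, neg_neg, mul_smul_comm, smul_mul_assoc, smul_smul, smul_neg,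
      one_smul, mul_one, mul_add, mul_sub, smul_add, smul_sub, add_mul, sub_mul, neg_add, sf0, sf1, rf1, assoc_comm sf0, h.kInv_sigma, assoc_comm (h.kInv_sigma 0),
      assoc_comm (h.kInv_sigma 1), Kf00, Kf01,
      Kf10, Kf11, assoc_swap Kf00, assoc_swap Kf01, assoc_swap Kf10, assoc_comm Kf11,
      h.kInv_kInv 1 0, assoc_comm (h.kInv_kInv 1 0), r]
    match_scalars <;> field_simp <;> ring
  case e1_pow =>
    have q1 : g (e 0) * g (k 0) = (xi ℓ ^ 2)⁻¹ • (g (k 0) * g (e 0)) := by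
      rw [ke00, smul_smul, inv_mul_cancel₀ (pow_ne_zero _ hx), one_smul]
    have q2 : (g (e 0) * g (k 0)) ^ ℓ = 0 := mul_pow_eq_zero ke00 h.e1_pow
    rw [q1, smul_pow] at q2
    have q3 := (smul_eq_zero.1 q2).resolve_left
      (pow_ne_zero _ (inv_ne_zero (pow_ne_zero _ hx)))
    simp only [antipodeGen, Fin.val_zero, pow_zero, one_mul, MulOpposite.unop_pow,
      MulOpposite.unop_op, MulOpposite.unop_zero]
    rw [neg_pow, q3, mul_zero]
  case f1_pow =>
    simp only [antipodeGen, Fin.val_zero, pow_zero, one_mul, MulOpposite.unop_pow,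
      MulOpposite.unop_op, MulOpposite.unop_zero]
    rw [neg_pow, mul_pow_eq_zero (h.kInv_f' 0 0) h.f1_pow, mul_zero]
  case sigma_sq => simp [antipodeGen, h.sigma_sq]
  case sigma_k i => simp [antipodeGen, h.kInv_sigma]
  case sigma_e i =>
    fin_cases i <;> simp [antipodeGen, mul_assoc, se0, se1, re1, h.sigma_k,
      assoc_comm (h.sigma_k 0), assoc_comm (h.sigma_k 1), assoc_comm se0]
  case sigma_f i =>
    fin_cases i <;> simp [antipodeGen, mul_assoc, sf0, sf1, rf1, h.kInv_sigma,
      assoc_comm (h.kInv_sigma 0), assoc_comm (h.kInv_sigma 1), assoc_comm sf0]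
  case k_pow i => simp [antipodeGen, h.kInv_pow]

end structureMaps

section hopf

open Algebra.TensorProduct

variable (ℓ : ℕ)

/-- The antipode, as an algebra map to the opposite algebra. -/
def antipodeHom : U0 ℓ →ₐ[ℂ] (U0 ℓ)ᵐᵒᵖ := lift (antipode_satisfies (gen_satisfies ℓ))

@[simp] theorem antipodeHom_gen (a : Gen) : antipodeHom ℓ (gen ℓ a) = antipodeGen (gen ℓ) a :=
  lift_gen _ a

/-- The antipode, as a linear map. -/
def antipodeLin : U0 ℓ →ₗ[ℂ] U0 ℓ :=
  (MulOpposite.opLinearEquiv ℂ).symm.toLinearMap ∘ₗ (antipodeHom ℓ).toLinearMap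

theorem antipodeLin_apply (x : U0 ℓ) : antipodeLin ℓ x = (antipodeHom ℓ x).unop := rfl

variable [Fact (Odd ℓ)]

/-- The coproduct, as an algebra map. -/
def comulHom : U0 ℓ →ₐ[ℂ] U0 ℓ ⊗[ℂ] U0 ℓ :=
  lift (comul_satisfies Fact.out (gen_satisfies ℓ))

/-- The counit, as an algebra map. -/
def counitHom : U0 ℓ →ₐ[ℂ] ℂ := lift (counit_satisfies ℓ)


@[simp] theorem comulHom_gen (a : Gen) : comulHom ℓ (gen ℓ a) = comulGen (gen ℓ) a :=
  lift_gen _ a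
@[simp] theorem counitHom_gen (a : Gen) : counitHom ℓ (gen ℓ a) = counitGen a :=
  lift_gen _ a

instance : Bialgebra ℂ (U0 ℓ) :=
  Bialgebra.ofAlgHom (comulHom ℓ) (counitHom ℓ)
    (by
      apply hom_ext
      intro a
      cases a <;> simp [comulGen, TensorProduct.add_tmul, TensorProduct.tmul_add, one_def,
        add_assoc])
    (by
      apply hom_ext
      intro a
      cases a <;> simp [comulGen, counitGen])
    (by
      apply hom_ext
      intro a
      cases a <;> simp [comulGen, counitGen])

theorem comul_eq (x : U0 ℓ) : Coalgebra.comul (R := ℂ) x = comulHom ℓ x := rfl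
theorem counit_eq (x : U0 ℓ) : Coalgebra.counit (R := ℂ) x = counitHom ℓ x := rfl


theorem antipode_left (x : U0 ℓ) :
    LinearMap.mul' ℂ (U0 ℓ) ((antipodeLin ℓ).rTensor (U0 ℓ) (comulHom ℓ x)) =
      algebraMap ℂ (U0 ℓ) (counitHom ℓ x) := by
  induction x using induction with
  | hs c => simp [Algebra.TensorProduct.algebraMap_apply, antipodeLin_apply]
  | hg a =>
    have h := gen_satisfies ℓ
    cases a <;> simp [comulGen, counitGen, antipodeLin_apply, antipodeGen, h.k_kInv, h.kInv_k,
      h.sigma_sigma, mul_assoc]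
  | ha x y hx hy => simp only [map_add, hx, hy]
  | hm x y hx hy =>
    have key : ∀ t u : U0 ℓ ⊗[ℂ] U0 ℓ, LinearMap.mul' ℂ (U0 ℓ)
        ((antipodeLin ℓ).rTensor (U0 ℓ) t) = algebraMap ℂ (U0 ℓ) (counitHom ℓ x) →
        LinearMap.mul' ℂ (U0 ℓ) ((antipodeLin ℓ).rTensor (U0 ℓ) (t * u)) =
        counitHom ℓ x • LinearMap.mul' ℂ (U0 ℓ) ((antipodeLin ℓ).rTensor (U0 ℓ) u) := by
      intro t u ht
      induction u with
      | zero => simp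
      | add u v hu hv => simp only [mul_add, map_add, hu, hv, smul_add]
      | tmul p q =>
        have : LinearMap.mul' ℂ (U0 ℓ) ((antipodeLin ℓ).rTensor (U0 ℓ) (t * p ⊗ₜ q)) =
            antipodeLin ℓ p * LinearMap.mul' ℂ (U0 ℓ) ((antipodeLin ℓ).rTensor (U0 ℓ) t) * q := by
          clear ht
          induction t with
          | zero => simp
          | add u v hu hv => simp only [mul_add, add_mul, map_add, hu, hv]
          | tmul r s => simp [antipodeLin_apply, mul_assoc]
        rw [this, ht, ← Algebra.commutes, mul_assoc, ← Algebra.smul_def]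
        simp
    rw [map_mul, key _ _ hx, hy, map_mul, map_mul, Algebra.smul_def]

theorem antipode_right (x : U0 ℓ) :
    LinearMap.mul' ℂ (U0 ℓ) ((antipodeLin ℓ).lTensor (U0 ℓ) (comulHom ℓ x)) =
      algebraMap ℂ (U0 ℓ) (counitHom ℓ x) := by
  induction x using induction with
  | hs c => simp [Algebra.TensorProduct.algebraMap_apply, antipodeLin_apply]
  | hg a =>
    have h := gen_satisfies ℓ
    have sp : ∀ (n : ℕ) (z : U0 ℓ), gen ℓ sigma ^ n * (gen ℓ sigma ^ n * z) = z := fun n z => by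
      rw [← mul_assoc, ← (Commute.refl _).mul_pow, h.sigma_sigma, one_pow, one_mul]
    cases a <;> simp [comulGen, counitGen, antipodeLin_apply, antipodeGen, h.k_kInv, h.kInv_k,
      h.sigma_sigma, mul_assoc, sp, assoc_one (h.kInv_k _)]
  | ha x y hx hy => simp only [map_add, hx, hy]
  | hm x y hx hy =>
    have key : ∀ t u : U0 ℓ ⊗[ℂ] U0 ℓ, LinearMap.mul' ℂ (U0 ℓ)
        ((antipodeLin ℓ).lTensor (U0 ℓ) u) = algebraMap ℂ (U0 ℓ) (counitHom ℓ y) →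
        LinearMap.mul' ℂ (U0 ℓ) ((antipodeLin ℓ).lTensor (U0 ℓ) (t * u)) =
        counitHom ℓ y • LinearMap.mul' ℂ (U0 ℓ) ((antipodeLin ℓ).lTensor (U0 ℓ) t) := by
      intro t u ht
      induction t with
      | zero => simp
      | add u v hu hv => simp only [add_mul, map_add, hu, hv, smul_add]
      | tmul p q =>
        have : LinearMap.mul' ℂ (U0 ℓ) ((antipodeLin ℓ).lTensor (U0 ℓ) (p ⊗ₜ q * u)) =
            p * LinearMap.mul' ℂ (U0 ℓ) ((antipodeLin ℓ).lTensor (U0 ℓ) u) * antipodeLin ℓ q := by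
          clear ht
          induction u with
          | zero => simp
          | add u v hu hv => simp only [mul_add, add_mul, map_add, hu, hv]
          | tmul r s => simp [antipodeLin_apply, mul_assoc]
        rw [this, ht, ← Algebra.commutes, mul_assoc, ← Algebra.smul_def]
        simp
    rw [map_mul, key _ _ hy, hx, map_mul, map_mul, Algebra.smul_def, ← Algebra.commutes]

instance : HopfAlgebra ℂ (U0 ℓ) where
  antipode := antipodeLin ℓ
  mul_antipode_rTensor_comul := LinearMap.ext (antipode_left ℓ)
  mul_antipode_lTensor_comul := LinearMap.ext (antipode_right ℓ)

end hopf
/-! ### The PBW monomials -/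

/-- `e_3 = e_1 e_2 - ξ⁻¹ e_2 e_1`. -/
def e3 (ℓ : ℕ) : U0 ℓ := gen ℓ (e 0) * gen ℓ (e 1) - (xi ℓ)⁻¹ • (gen ℓ (e 1) * gen ℓ (e 0))

/-- `f_3 = f_2 f_1 - ξ f_1 f_2`. -/
def f3 (ℓ : ℕ) : U0 ℓ := gen ℓ (f 1) * gen ℓ (f 0) - xi ℓ • (gen ℓ (f 0) * gen ℓ (f 1))

/-- The exponents of a PBW monomial
`f_1^{f1} f_3^{f3} f_2^{f2} e_1^{e1} e_3^{e3} e_2^{e2} k_1^{k1} k_2^{k2} σ^{s}`: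
those of `f_1, e_1, k_1, k_2` run over `0, …, ℓ - 1`, the others over `0, 1`. -/
@[ext]
structure PBWIndex (ℓ : ℕ) : Type where
  f1 : Fin ℓ
  f3 : Fin 2
  f2 : Fin 2
  e1 : Fin ℓ
  e3 : Fin 2
  e2 : Fin 2
  k1 : Fin ℓ
  k2 : Fin ℓ
  s : Fin 2

/-- The PBW monomial with the given exponents. -/
def pbw (ℓ : ℕ) (a : PBWIndex ℓ) : U0 ℓ :=
  gen ℓ (f 0) ^ (a.f1 : ℕ) * f3 ℓ ^ (a.f3 : ℕ) * gen ℓ (f 1) ^ (a.f2 : ℕ) *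
    gen ℓ (e 0) ^ (a.e1 : ℕ) * e3 ℓ ^ (a.e3 : ℕ) * gen ℓ (e 1) ^ (a.e2 : ℕ) *
    gen ℓ (k 0) ^ (a.k1 : ℕ) * gen ℓ (k 1) ^ (a.k2 : ℕ) * gen ℓ sigma ^ (a.s : ℕ)

/-- The exponents of `f_1^{ℓ-1} f_3 f_2 e_1^{ℓ-1} e_3 e_2 k_2^{ℓ-2}`. -/
def IsTop (ℓ : ℕ) (a : PBWIndex ℓ) : Prop :=
  (a.f1 : ℕ) = ℓ - 1 ∧ a.f3 = 1 ∧ a.f2 = 1 ∧ (a.e1 : ℕ) = ℓ - 1 ∧ a.e3 = 1 ∧ a.e2 = 1 ∧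
    (a.k1 : ℕ) = 0 ∧ (a.k2 : ℕ) = ℓ - 2 ∧ a.s = 0

instance (ℓ : ℕ) : DecidablePred (IsTop ℓ) := fun _ => by unfold IsTop; infer_instance

end QSl21

/-- A linear form `lam` on a Hopf algebra is a right integral when
`(lam ⊗ id) (Δ x) = lam x • 1` for all `x`. -/
def IsRightIntegral {R A : Type*} [CommRing R] [Ring A] [HopfAlgebra R A] (lam : A →ₗ[R] R) :
    Prop :=
  ∀ x : A, TensorProduct.lid R A (lam.rTensor A (Coalgebra.comul x)) = lam x • (1 : A)

end

/-!
Write `F`, `E`, `K` for monomials in the `f_i`, in the `e_i`, and in `k_1, k_2, σ`. A monomial in the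
`f_i` or the `e_i` has a weight, its length as a word in the generators.

The monomials span because the span of the products `F E K` contains `1` and is stable under left
multiplication by the generators (`fSpan_mul_eSpan_mul_kSpan`). The rules for reordering `f_1, f_2`
alone, and `e_1, e_2` alone, are the same, and follow from the quantum Serre relation and the square
of the odd generator being zero (`SerrePair`).

Linear independence comes from representations. For `a^ℓ = b^ℓ = 1` and `s² = 1` the Verma module
with highest weight `(a, b, s)` has the basis `F v`; it is written down by explicit operators
(`verma_satisfies`). The relations between the `e_i` hold on it because the relators kill the
highest weight vector and commute up to sign with `f_1` and `f_2`, which generate the module. The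
Verma module with trivial highest weight, twisted by the Chevalley involution, is a lowest weight
module with basis `E v'`. Through the coproduct, the algebra acts on the tensor product of the two.
Since `v` is killed by the `e_i`, the vector `F E K (v ⊗ v')` has the component
`F v ⊗ E v'`, times a nonzero number that depends on `K` through the character `(a, b, s)`, while its
other components have on the left a vector of lower weight than `F v` (`detect_eq`). So a linear
relation can be tested on the `F` of largest weight, and the characters `(a, b, s)` separate the `K`
(`eq_zero_of_forall_character`).

For the integral, `Δ(F E K) = F E K ⊗ κ K + …` with `κ` a monomial in `k_1, k_2`, where the left
factors of the omitted terms have lower weight in the `f_i` or in the `e_i`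
(`comul_fMon_sub_mem`, `comul_eMon_sub_mem`). The form vanishes on those, because the top monomial
has the largest weight in both. For the top monomial, `κ = k_1^ℓ k_2^2` and `K = k_2^(ℓ-2)`, so that
`κ K = 1` (`kMon_of_isTop`).
-/

noncomputable section

namespace QSl21

open Gen

/-! ### Monomials in a pair of elements satisfying a quantum Serre relation -/

section serrePair

variable {B : Type*} [Ring B] [Algebra ℂ B] {q : ℂ} {x y : B}

/-- The `q`-commutator `y x - q x y`: for `q = ξ` it is `f_3` if `(x, y) = (f_1, f_2)` and
`-ξ e_3` if `(x, y) = (e_1, e_2)`. -/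
def qComm (q : ℂ) (x y : B) : B := y * x - q • (x * y)

/-- The monomial `x^i [y, x]_q^r y^d`. -/
def qMon (q : ℂ) (x y : B) (i r d : ℕ) : B := x ^ i * qComm q x y ^ r * y ^ d

/-- The balanced `q`-integer `q^(n-1) + q^(n-3) + ⋯ + q^(1-n)`. -/
def qInt (q : ℂ) : ℕ → ℂ
  | 0 => 0
  | n + 1 => q ^ n + q⁻¹ * qInt q n

theorem sub_inv_mul_qInt (hq : q ≠ 0) (n : ℕ) : (q - q⁻¹) * qInt q n = q ^ n - (q ^ n)⁻¹ := by
  induction n with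
  | zero => simp [qInt]
  | succ n ih =>
    rw [qInt, mul_add, mul_left_comm, ih]
    field_simp
    ring

theorem qInt_eq (hq : q ≠ 0) (hq' : q - q⁻¹ ≠ 0) (n : ℕ) :
    qInt q n = (q ^ n - (q ^ n)⁻¹) / (q - q⁻¹) := by
  rw [eq_div_iff hq', mul_comm, sub_inv_mul_qInt hq]

/-- The relations between `f_1` and `f_2`, and between `e_1` and `e_2`. -/
structure SerrePair (q : ℂ) (x y : B) : Prop where
  serre : x ^ 2 * y - (q + q⁻¹) • (x * y * x) + y * x ^ 2 = 0
  sq : y ^ 2 = 0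

namespace SerrePair

theorem qComm_mul_left (hq : q ≠ 0) (h : SerrePair q x y) :
    qComm q x y * x = q⁻¹ • (x * qComm q x y) := by
  have e : qComm q x y * x - q⁻¹ • (x * qComm q x y) =
      x ^ 2 * y - (q + q⁻¹) • (x * y * x) + y * x ^ 2 := by
    simp only [qComm, sub_mul, mul_sub, smul_mul_assoc, mul_smul_comm, smul_sub, smul_smul,
      inv_mul_cancel₀ hq, one_smul, pow_two, add_smul, mul_assoc]
    abel
  rw [← sub_eq_zero, e, h.serre]

theorem mul_qComm (h : SerrePair q x y) : y * qComm q x y = (-q) • (qComm q x y * y) := by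
  have hy : y * y = 0 := by rw [← pow_two, h.sq]
  simp only [qComm, sub_mul, mul_sub, smul_mul_assoc, mul_smul_comm, ← mul_assoc, hy, zero_mul,
    zero_sub, smul_sub, neg_smul]
  simp [mul_assoc, hy]

/-- The odd root vector squares to zero: `q² ≠ -1` is what makes this a consequence of the Serre
relation and `y² = 0`. -/
theorem qComm_sq (hq : q ≠ 0) (hq2 : q ^ 2 + 1 ≠ 0) (h : SerrePair q x y) :
    qComm q x y ^ 2 = 0 := by
  set z := qComm q x y with hz
  have h1 : z * x = q⁻¹ • (x * z) := h.qComm_mul_left hq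
  have h2 : y * z = (-q) • (z * y) := h.mul_qComm
  -- expand the left factor, then the right one: the two results differ by a factor `-q²`
  have e1 : z * z = y * x * z - q • (x * (y * z)) := by
    nth_rewrite 1 [hz]
    simp only [qComm, sub_mul, smul_mul_assoc, mul_assoc]
  have e2 : z * z = z * y * x - q • (z * x * y) := by
    nth_rewrite 2 [hz]
    simp only [qComm, mul_sub, mul_smul_comm, mul_assoc]
  have e3 : z * y = -(q⁻¹ • (y * z)) := by
    rw [h2, smul_smul, mul_neg, inv_mul_cancel₀ hq, neg_one_smul, neg_neg]
  have e4 : z * z = -((q⁻¹ * q⁻¹) • (y * x * z)) - x * (z * y) := by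
    rw [e2, h1, e3, neg_mul, smul_mul_assoc, mul_assoc y, h1, mul_smul_comm, smul_smul,
      smul_mul_assoc, smul_smul, mul_inv_cancel₀ hq, one_smul, ← mul_assoc, mul_assoc x z, e3]
  have e5 : (q ^ 2 + 1) • (z * z) = 0 := by
    rw [add_smul, one_smul]
    nth_rewrite 1 [e4]
    rw [e1, h2]
    simp only [mul_smul_comm, smul_sub, smul_neg, smul_smul]
    match_scalars <;> field_simp <;> ring
  rw [pow_two]
  exact (smul_eq_zero.1 e5).resolve_left hq2

theorem mul_pow_left (hq : q ≠ 0) (h : SerrePair q x y) (i : ℕ) :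
    y * x ^ i = q ^ i • (x ^ i * y) + qInt q i • (x ^ (i - 1) * qComm q x y) := by
  induction i with
  | zero => simp [qInt]
  | succ i ih =>
    have e : y * x = qComm q x y + q • (x * y) := by simp [qComm]
    rw [pow_succ x, ← mul_assoc, ih, add_mul, smul_mul_assoc, smul_mul_assoc, mul_assoc, e,
      mul_assoc, h.qComm_mul_left hq, mul_add, mul_smul_comm, mul_smul_comm, Nat.add_sub_cancel,
      ← mul_assoc, ← mul_assoc, ← pow_succ]
    cases i with
    | zero => simp [qInt, add_comm]
    | succ i =>
      rw [Nat.add_sub_cancel, ← pow_succ]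
      simp only [smul_add, smul_smul, qInt]
      match_scalars <;> ring

theorem left_mul_qMon (i r d : ℕ) : x * qMon q x y i r d = qMon q x y (i + 1) r d := by
  simp only [qMon, pow_succ', mul_assoc]

theorem right_mul_qMon (hq : q ≠ 0) (h : SerrePair q x y) (i r d : ℕ) :
    y * qMon q x y i r d = (q ^ i * (-q) ^ r) • qMon q x y i r (d + 1) +
      qInt q i • qMon q x y (i - 1) (r + 1) d := by
  have e : y * qComm q x y ^ r = (-q) ^ r • (qComm q x y ^ r * y) :=
    mul_pow_of_qcomm h.mul_qComm r
  simp only [qMon]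
  rw [← mul_assoc, ← mul_assoc, h.mul_pow_left hq, add_mul, add_mul, smul_mul_assoc,
    smul_mul_assoc, smul_mul_assoc, smul_mul_assoc, mul_assoc (x ^ i) y, e, mul_smul_comm,
    smul_mul_assoc, smul_smul, pow_succ' y, pow_succ' (qComm q x y)]
  simp only [mul_assoc]

end SerrePair

/-- The span of the monomials whose weight `i + 2 r + d` (the length as a word in `x` and `y`)
lies in `s`. -/
def qSpan (q : ℂ) (x y : B) (s : Set ℕ) : Submodule ℂ B :=
  Submodule.span ℂ {m | ∃ i r d : ℕ, i + 2 * r + d ∈ s ∧ m = qMon q x y i r d}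

theorem qMon_mem_qSpan {s : Set ℕ} {i r d : ℕ} (h : i + 2 * r + d ∈ s) :
    qMon q x y i r d ∈ qSpan q x y s :=
  Submodule.subset_span ⟨i, r, d, h, rfl⟩

theorem qSpan_mono {s t : Set ℕ} (h : s ⊆ t) : qSpan q x y s ≤ qSpan q x y t :=
  Submodule.span_mono fun _ ⟨i, r, d, hs, hm⟩ => ⟨i, r, d, h hs, hm⟩

theorem one_mem_qSpan {s : Set ℕ} (h : 0 ∈ s) : (1 : B) ∈ qSpan q x y s := by
  simpa [qMon] using qMon_mem_qSpan (q := q) (x := x) (y := y) (i := 0) (r := 0) (d := 0) h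

theorem left_mul_mem_qSpan {s t : Set ℕ} (hst : ∀ n ∈ s, n + 1 ∈ t) {m : B}
    (hm : m ∈ qSpan q x y s) : x * m ∈ qSpan q x y t := by
  suffices H : qSpan q x y s ≤ (qSpan q x y t).comap (LinearMap.mulLeft ℂ x) by exact H hm
  refine Submodule.span_le.2 ?_
  rintro _ ⟨i, r, d, hs, rfl⟩
  change x * qMon q x y i r d ∈ qSpan q x y t
  rw [SerrePair.left_mul_qMon]
  refine qMon_mem_qSpan ?_
  convert hst _ hs using 1
  ring

theorem right_mul_mem_qSpan (hq : q ≠ 0) (h : SerrePair q x y) {s t : Set ℕ}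
    (hst : ∀ n ∈ s, n + 1 ∈ t) {m : B} (hm : m ∈ qSpan q x y s) : y * m ∈ qSpan q x y t := by
  suffices H : qSpan q x y s ≤ (qSpan q x y t).comap (LinearMap.mulLeft ℂ y) by exact H hm
  refine Submodule.span_le.2 ?_
  rintro _ ⟨i, r, d, hs, rfl⟩
  change y * qMon q x y i r d ∈ qSpan q x y t
  rw [h.right_mul_qMon hq]
  refine add_mem (Submodule.smul_mem _ _ (qMon_mem_qSpan (hst _ hs))) ?_
  cases i with
  | zero => simp [qInt]
  | succ i =>
    refine Submodule.smul_mem _ _ (qMon_mem_qSpan ?_)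
    convert hst _ hs using 1
    simp only [Nat.add_sub_cancel]
    ring

/-- A subspace that contains `1` and is stable under left multiplication by `x` and `y` contains
all the monomials. -/
theorem qSpan_le {N : Submodule ℂ B} (h1 : 1 ∈ N) (hx : ∀ n ∈ N, x * n ∈ N)
    (hy : ∀ n ∈ N, y * n ∈ N) (s : Set ℕ) : qSpan q x y s ≤ N := by
  have hp : ∀ {w : B}, (∀ n ∈ N, w * n ∈ N) → ∀ (k : ℕ), ∀ n ∈ N, w ^ k * n ∈ N := by
    intro w hw k n hn
    induction k with
    | zero => simpa
    | succ k ih => rw [pow_succ', mul_assoc]; exact hw _ ih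
  have hz : ∀ n ∈ N, qComm q x y * n ∈ N := by
    intro n hn
    rw [qComm, sub_mul, smul_mul_assoc, mul_assoc, mul_assoc]
    exact sub_mem (hy _ (hx _ hn)) (N.smul_mem _ (hx _ (hy _ hn)))
  refine Submodule.span_le.2 ?_
  rintro _ ⟨i, r, d, -, rfl⟩
  rw [qMon, mul_assoc, ← mul_one (y ^ d)]
  exact hp hx _ _ (hp hz _ _ (hp hy _ _ h1))

/-- Leading terms: if left multiplication by `x` and `y` agrees with that by `x'` and `y'` up to
terms of lower filtration degree, then so do the monomials in `x, y` and in `x', y'`. -/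
theorem qMon_sub_qMon_mem {x' y' : B} {W M : ℕ → Submodule ℂ B} (h1 : 1 ∈ M 0)
    (hxW : ∀ n, ∀ w ∈ W n, x * w ∈ W (n + 1)) (hyW : ∀ n, ∀ w ∈ W n, y * w ∈ W (n + 1))
    (hxM : ∀ n, ∀ m ∈ M n, x' * m ∈ M (n + 1)) (hyM : ∀ n, ∀ m ∈ M n, y' * m ∈ M (n + 1))
    (hx : ∀ n, ∀ m ∈ M n, (x - x') * m ∈ W (n + 1))
    (hy : ∀ n, ∀ m ∈ M n, (y - y') * m ∈ W (n + 1)) (i r d : ℕ) :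
    qMon q x y i r d - qMon q x' y' i r d ∈ W (i + 2 * r + d) := by
  have sx : ∀ n t t', t - t' ∈ W n ∧ t' ∈ M n →
      x * t - x' * t' ∈ W (n + 1) ∧ x' * t' ∈ M (n + 1) := fun n t t' ⟨h, h'⟩ => by
    refine ⟨?_, hxM _ _ h'⟩
    convert add_mem (hxW _ _ h) (hx _ _ h') using 1
    noncomm_ring
  have sy : ∀ n t t', t - t' ∈ W n ∧ t' ∈ M n →
      y * t - y' * t' ∈ W (n + 1) ∧ y' * t' ∈ M (n + 1) := fun n t t' ⟨h, h'⟩ => by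
    refine ⟨?_, hyM _ _ h'⟩
    convert add_mem (hyW _ _ h) (hy _ _ h') using 1
    noncomm_ring
  have sz : ∀ n t t', t - t' ∈ W n ∧ t' ∈ M n →
      qComm q x y * t - qComm q x' y' * t' ∈ W (n + 2) ∧ qComm q x' y' * t' ∈ M (n + 2) := by
    intro n t t' h
    have a1 := sy _ _ _ (sx _ _ _ h)
    have a2 := sx _ _ _ (sy _ _ _ h)
    simp only [qComm, sub_mul, smul_mul_assoc, mul_assoc]
    refine ⟨?_, sub_mem a1.2 (Submodule.smul_mem _ _ a2.2)⟩
    convert sub_mem a1.1 (Submodule.smul_mem _ q a2.1) using 1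
    rw [smul_sub]
    abel
  have h : ∀ i r d, qMon q x y i r d - qMon q x' y' i r d ∈ W (i + 2 * r + d) ∧
      qMon q x' y' i r d ∈ M (i + 2 * r + d) := by
    intro i r d
    induction i with
    | succ i ih =>
      rw [← SerrePair.left_mul_qMon, ← SerrePair.left_mul_qMon,
        show i + 1 + 2 * r + d = i + 2 * r + d + 1 by ring]
      exact sx _ _ _ ih
    | zero =>
      induction r with
      | succ r ih =>
        have e : ∀ x y : B, qMon q x y 0 (r + 1) d = qComm q x y * qMon q x y 0 r d := fun x y => by
          simp [qMon, pow_succ', mul_assoc]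
        rw [e, e, show 0 + 2 * (r + 1) + d = 0 + 2 * r + d + 2 by ring]
        exact sz _ _ _ ih
      | zero =>
        induction d with
        | succ d ih =>
          have e : ∀ x y : B, qMon q x y 0 0 (d + 1) = y * qMon q x y 0 0 d := fun x y => by
            simp [qMon, pow_succ']
          rw [e, e]
          exact sy _ _ _ ih
        | zero => simpa [qMon] using h1
  exact (h i r d).1

/-- An element that `q`-commutes with `x` and `y` also `q`-commutes with the monomials. -/
theorem mul_qMon_of_qcomm {κ : B} {c d : ℂ} (hx : κ * x = c • (x * κ)) (hy : κ * y = d • (y * κ))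
    (i r j : ℕ) :
    κ * qMon q x y i r j = (c ^ (i + r) * d ^ (r + j)) • (qMon q x y i r j * κ) := by
  have hz : κ * qComm q x y = (c * d) • (qComm q x y * κ) := by
    simp only [qComm, mul_sub, sub_mul, mul_smul_comm, smul_mul_assoc, mul_assoc, hx, hy,
      assoc_swap hx, assoc_swap hy, smul_sub, smul_smul]
    match_scalars <;> ring
  rw [qMon, ← mul_assoc, ← mul_assoc, mul_pow_of_qcomm hx, smul_mul_assoc, mul_assoc (x ^ i) κ,
    mul_pow_of_qcomm hz, mul_smul_comm, smul_smul, smul_mul_assoc, ← mul_assoc (x ^ i),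
    mul_assoc _ κ, mul_pow_of_qcomm hy, mul_smul_comm, smul_smul, ← mul_assoc]
  congr 1
  ring

end serrePair

/-! ### The root of unity -/

section root

variable {ℓ : ℕ}

theorem xi_primitive (hℓ : 3 ≤ ℓ) : IsPrimitiveRoot (xi ℓ) ℓ :=
  Complex.isPrimitiveRoot_exp ℓ (by omega)

theorem xi_sub_inv_ne_zero (hℓ : 3 ≤ ℓ) : xi ℓ - (xi ℓ)⁻¹ ≠ 0 := by
  intro h
  refine (xi_primitive hℓ).pow_ne_one_of_pos_of_lt two_ne_zero (by omega) ?_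
  have h0 := xi_ne_zero ℓ
  field_simp at h
  linear_combination h

theorem xi_sq_add_one_ne_zero (hodd : Odd ℓ) (hℓ : 3 ≤ ℓ) : xi ℓ ^ 2 + 1 ≠ 0 := by
  intro h
  have h4 : (xi ℓ ^ 2) ^ 2 = 1 := by linear_combination (xi ℓ ^ 2 - 1) * h
  exact (xi_sq_primitive hodd).pow_ne_one_of_pos_of_lt two_ne_zero (by omega) h4

theorem qInt_xi_self (hℓ : 3 ≤ ℓ) : qInt (xi ℓ) ℓ = 0 := by
  rw [qInt_eq (xi_ne_zero ℓ) (xi_sub_inv_ne_zero hℓ), (xi_primitive hℓ).pow_eq_one]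
  simp

end root

/-! ### Commutation of the relators in the `e_i` with the `f_j` -/

section commutation

variable {B : Type*} [Ring B] [Algebra ℂ B] {q c : ℂ}

/-- The commutator of `u^n` with `v`, when that of `u` with `v` is a combination of two elements
`k`, `k'` that `q`-commute with `u`; it is used for `u = e_1` and `v = f_1`. -/
theorem pow_mul_of_bracket {u v k k' : B} (h : u * v = v * u + c • (k - k'))
    (hk : k * u = q ^ 2 • (u * k)) (hk' : k' * u = (q ^ 2)⁻¹ • (u * k')) (n : ℕ) :
    u ^ n * v = v * u ^ n + c • (u ^ (n - 1) *
      ((∑ j ∈ Finset.range n, (q ^ 2) ^ j) • k -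
        (∑ j ∈ Finset.range n, ((q ^ 2)⁻¹) ^ j) • k')) := by
  induction n with
  | zero => simp
  | succ n ih =>
    have e1 : u * (u ^ (n - 1) * ((∑ j ∈ Finset.range n, (q ^ 2) ^ j) • k -
        (∑ j ∈ Finset.range n, ((q ^ 2)⁻¹) ^ j) • k')) =
        u ^ n * ((∑ j ∈ Finset.range n, (q ^ 2) ^ j) • k -
        (∑ j ∈ Finset.range n, ((q ^ 2)⁻¹) ^ j) • k') := by
      cases n with
      | zero => simp
      | succ n => rw [Nat.add_sub_cancel, ← mul_assoc, ← pow_succ']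
    rw [pow_succ' u n, mul_assoc, ih, mul_add, mul_smul_comm, e1, ← mul_assoc, h, add_mul,
      smul_mul_assoc, sub_mul, mul_pow_of_qcomm hk, mul_pow_of_qcomm hk', Nat.add_sub_cancel,
      Finset.sum_range_succ, Finset.sum_range_succ]
    simp only [mul_sub, mul_smul_comm, smul_sub, smul_smul, mul_assoc]
    match_scalars <;> ring

/-- At a root of unity both geometric sums in the commutator of `u^n` and `v` vanish. -/
theorem pow_comm_of_bracket {n : ℕ} (hq : IsPrimitiveRoot (q ^ 2) n) (hn : 1 < n) {u v k k' : B}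
    (h : u * v = v * u + c • (k - k'))
    (hk : k * u = q ^ 2 • (u * k)) (hk' : k' * u = (q ^ 2)⁻¹ • (u * k')) :
    u ^ n * v = v * u ^ n := by
  rw [pow_mul_of_bracket h hk hk', hq.geom_sum_eq_zero hn, hq.inv.geom_sum_eq_zero hn]
  simp

/-- The left side of the quantum Serre relation. -/
def serreElt (q : ℂ) (x y : B) : B :=
  x ^ 2 * y - (q + q⁻¹) • (x * y * x) + y * x ^ 2

/-- The Serre relator commutes with `v`, when `v` brackets nontrivially with `x` only
(`x, y = e_1, e_2` and `v = f_1`). -/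
theorem serreElt_mul_left (hq : q ≠ 0) {x y v k k' : B} (h : x * v = v * x + c • (k - k'))
    (hv : y * v = v * y) (hkx : k * x = q ^ 2 • (x * k)) (hkx' : k' * x = (q ^ 2)⁻¹ • (x * k'))
    (hky : k * y = q⁻¹ • (y * k)) (hky' : k' * y = q • (y * k')) :
    serreElt q x y * v = v * serreElt q x y := by
  have h' : ∀ z, x * (v * z) = v * (x * z) + c • (k * z - k' * z) := fun z => by
    rw [← mul_assoc, h, add_mul, smul_mul_assoc, sub_mul, mul_assoc]
  simp only [serreElt, add_mul, sub_mul, mul_add, mul_sub, smul_mul_assoc, mul_smul_comm, pow_two,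
    mul_assoc, h, h', hv, assoc_comm hv, hkx, hkx', hky, hky', assoc_swap hkx, assoc_swap hkx',
    assoc_swap hky, assoc_swap hky', smul_add, smul_sub, smul_smul]
  match_scalars <;> field_simp <;> ring

/-- The Serre relator anticommutes with `v`, when `v` brackets nontrivially with `y` only
(`x, y = e_1, e_2` and `v = f_2`). -/
theorem serreElt_mul_right (hq : q ≠ 0) {x y v k k' : B} (h : y * v = -(v * y) + c • (k - k'))
    (hv : x * v = v * x) (hkx : k * x = q⁻¹ • (x * k)) (hkx' : k' * x = q • (x * k')) :
    serreElt q x y * v = -(v * serreElt q x y) := by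
  have h' : ∀ z, y * (v * z) = -(v * (y * z)) + c • (k * z - k' * z) := fun z => by
    rw [← mul_assoc, h, add_mul, smul_mul_assoc, sub_mul, neg_mul, mul_assoc]
  simp only [serreElt, add_mul, sub_mul, mul_add, mul_sub, smul_mul_assoc, mul_smul_comm, pow_two,
    mul_assoc, h, h', hv, assoc_comm hv, hkx, hkx', assoc_swap hkx, assoc_swap hkx',
    smul_add, smul_sub, smul_smul, mul_neg, neg_add, neg_sub, smul_neg]
  match_scalars <;> field_simp <;> ring

theorem sq_comm_of_bracket {y v k k' : B} (h : y * v = -(v * y) + c • (k - k'))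
    (hk : k * y = y * k) (hk' : k' * y = y * k') : y ^ 2 * v = v * y ^ 2 := by
  have h' : ∀ z, y * (v * z) = -(v * (y * z)) + c • (k * z - k' * z) := fun z => by
    rw [← mul_assoc, h, add_mul, smul_mul_assoc, sub_mul, neg_mul, mul_assoc]
  simp only [pow_two, mul_assoc, h, h', mul_add, mul_neg, mul_smul_comm, mul_sub, hk, hk']
  match_scalars <;> ring

end commutation

/-! ### The Verma modules -/

/-- The underlying space of a Verma module, with basis `f_1^i f_3^r f_2^d v`. -/
abbrev Verma (ℓ : ℕ) : Type := Fin ℓ × Fin 2 × Fin 2 → ℂ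

/-- The vector `f_1^i f_3^r f_2^d v`, where `v` is the highest weight vector. It is zero, by
convention, when the exponents are not those of a basis vector. -/
def vec (ℓ : ℕ) (i r d : ℕ) : Verma ℓ :=
  if h : i < ℓ ∧ r < 2 ∧ d < 2 then Pi.single (⟨i, h.1⟩, ⟨r, h.2.1⟩, ⟨d, h.2.2⟩) 1 else 0

theorem vec_of_not {ℓ i r d : ℕ} (h : ¬ (i < ℓ ∧ r < 2 ∧ d < 2)) : vec ℓ i r d = 0 := dif_neg h

theorem vec_fin {ℓ : ℕ} (i : Fin ℓ) (r d : Fin 2) :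
    vec ℓ i r d = Pi.single (i, r, d) 1 := by
  rw [vec, dif_pos ⟨i.2, r.2, d.2⟩]

theorem vec_left_two (ℓ i d : ℕ) : vec ℓ i 2 d = 0 := vec_of_not (by omega)

theorem vec_right_two (ℓ i r : ℕ) : vec ℓ i r 2 = 0 := vec_of_not (by omega)

/-- The operator that takes the prescribed values on the basis. -/
def vOp (ℓ : ℕ) (G : ℕ → ℕ → ℕ → Verma ℓ) : Module.End ℂ (Verma ℓ) :=
  (Pi.basisFun ℂ (Fin ℓ × Fin 2 × Fin 2)).constr ℂ fun p => G p.1 p.2.1 p.2.2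

theorem vOp_vec {ℓ : ℕ} {G : ℕ → ℕ → ℕ → Verma ℓ} {i r d : ℕ}
    (hG : ¬ (i < ℓ ∧ r < 2 ∧ d < 2) → G i r d = 0) : vOp ℓ G (vec ℓ i r d) = G i r d := by
  by_cases h : i < ℓ ∧ r < 2 ∧ d < 2
  · rw [vec, dif_pos h, ← Pi.basisFun_apply ℂ, vOp, Module.Basis.constr_basis]
  · rw [vec_of_not h, map_zero, hG h]

/-- The indices `r, d` run over `{0, 1}`; `i` is left unbounded, which spares a case distinction
in the verification of the relations. -/
theorem verma_ext {ℓ : ℕ} {S T : Module.End ℂ (Verma ℓ)}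
    (h : ∀ i r d, r < 2 → d < 2 → S (vec ℓ i r d) = T (vec ℓ i r d)) : S = T := by
  refine (Pi.basisFun ℂ (Fin ℓ × Fin 2 × Fin 2)).ext fun p => ?_
  have := h p.1 p.2.1 p.2.2 p.2.1.2 p.2.2.2
  rwa [vec_fin, ← Pi.basisFun_apply ℂ] at this

/-- The operator with the prescribed eigenvalues on the basis. -/
def diagOp (ℓ : ℕ) (w : ℕ → ℕ → ℕ → ℂ) : Module.End ℂ (Verma ℓ) :=
  vOp ℓ fun i r d => w i r d • vec ℓ i r d

theorem diagOp_vec (ℓ : ℕ) (w : ℕ → ℕ → ℕ → ℂ) (i r d : ℕ) :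
    diagOp ℓ w (vec ℓ i r d) = w i r d • vec ℓ i r d :=
  vOp_vec fun h => by rw [vec_of_not h, smul_zero]

theorem pow_apply_of_eigen {V : Type*} [AddCommGroup V] [Module ℂ V] {T : Module.End ℂ V} {v : V}
    {c : ℂ} (h : T v = c • v) (n : ℕ) : (T ^ n) v = c ^ n • v := by
  induction n with
  | zero => simp
  | succ n ih => rw [pow_succ, Module.End.mul_apply, h, map_smul, ih, smul_smul, pow_succ']

theorem diagOp_pow_vec (ℓ : ℕ) (w : ℕ → ℕ → ℕ → ℂ) (n i r d : ℕ) :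
    (diagOp ℓ w ^ n) (vec ℓ i r d) = w i r d ^ n • vec ℓ i r d :=
  pow_apply_of_eigen (diagOp_vec ℓ w i r d) n

section verma

variable (ℓ : ℕ) (a b s : ℂ)

/-- The operator `f_1`. As `vec ℓ ℓ r d = 0`, it is nilpotent. -/
def opF0 : Module.End ℂ (Verma ℓ) := vOp ℓ fun n r d => vec ℓ (n + 1) r d

/-- The operator `f_2`; the formula is that of `SerrePair.right_mul_qMon`. -/
def opF1 : Module.End ℂ (Verma ℓ) := vOp ℓ fun n r d =>
  (xi ℓ ^ n * (-xi ℓ) ^ r) • vec ℓ n r (d + 1) + qInt (xi ℓ) n • vec ℓ (n - 1) (r + 1) d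

/-- The operator `e_1`, when `k_1` acts on the highest weight vector by `a`. The first term comes
from moving `e_1` past `f_1^n`, the second one from `[e_1, f_3] = -ξ f_2 k_1`. -/
def opE0 : Module.End ℂ (Verma ℓ) := vOp ℓ fun n r d =>
  (qInt (xi ℓ) n * ((a * (xi ℓ)⁻¹ ^ r * xi ℓ ^ d * (xi ℓ)⁻¹ ^ (n - 1) -
    a⁻¹ * xi ℓ ^ r * (xi ℓ)⁻¹ ^ d * xi ℓ ^ (n - 1)) / (xi ℓ - (xi ℓ)⁻¹))) • vec ℓ (n - 1) r d +
    if r = 1 ∧ d = 0 then (-(xi ℓ * a)) • vec ℓ n 0 1 else 0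

/-- The operator `e_2`, when `k_2` acts on the highest weight vector by `b`. The first term comes
from moving `e_2` past `f_3`, which leaves a multiple of `f_1 k_2⁻¹`, the second one from moving it
past `f_2`. -/
def opE1 : Module.End ℂ (Verma ℓ) := vOp ℓ fun n r d =>
  (if r = 1 then b⁻¹ • vec ℓ (n + 1) 0 d else 0) +
    if d = 1 then ((-1) ^ r * ((b - b⁻¹) / (xi ℓ - (xi ℓ)⁻¹))) • vec ℓ n r 0 else 0

/-- The action of the generators on the Verma module whose highest weight vector `v` satisfies
`e_i v = 0`, `k_1 v = a v`, `k_2 v = b v` and `σ v = s v`. -/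
def vermaGen : Gen → Module.End ℂ (Verma ℓ)
  | k i => if i = 0 then diagOp ℓ fun n r d => a * (xi ℓ)⁻¹ ^ (2 * n + r) * xi ℓ ^ d
      else diagOp ℓ fun n r _ => b * xi ℓ ^ (n + r)
  | kInv i => if i = 0 then diagOp ℓ fun n r d => a⁻¹ * xi ℓ ^ (2 * n + r) * (xi ℓ)⁻¹ ^ d
      else diagOp ℓ fun n r _ => b⁻¹ * (xi ℓ)⁻¹ ^ (n + r)
  | sigma => diagOp ℓ fun _ r d => s * (-1) ^ (r + d)
  | f i => if i = 0 then opF0 ℓ else opF1 ℓ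
  | e i => if i = 0 then opE0 ℓ a else opE1 ℓ b

theorem vermaGen_k0 (n r d : ℕ) : vermaGen ℓ a b s (k 0) (vec ℓ n r d) =
    (a * (xi ℓ)⁻¹ ^ (2 * n + r) * xi ℓ ^ d) • vec ℓ n r d := by
  rw [vermaGen, if_pos rfl, diagOp_vec]

theorem vermaGen_k1 (n r d : ℕ) : vermaGen ℓ a b s (k 1) (vec ℓ n r d) =
    (b * xi ℓ ^ (n + r)) • vec ℓ n r d := by
  rw [vermaGen, if_neg one_ne_zero, diagOp_vec]

theorem vermaGen_kInv0 (n r d : ℕ) : vermaGen ℓ a b s (kInv 0) (vec ℓ n r d) =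
    (a⁻¹ * xi ℓ ^ (2 * n + r) * (xi ℓ)⁻¹ ^ d) • vec ℓ n r d := by
  rw [vermaGen, if_pos rfl, diagOp_vec]

theorem vermaGen_kInv1 (n r d : ℕ) : vermaGen ℓ a b s (kInv 1) (vec ℓ n r d) =
    (b⁻¹ * (xi ℓ)⁻¹ ^ (n + r)) • vec ℓ n r d := by
  rw [vermaGen, if_neg one_ne_zero, diagOp_vec]

theorem vermaGen_sigma (n r d : ℕ) : vermaGen ℓ a b s sigma (vec ℓ n r d) =
    (s * (-1) ^ (r + d)) • vec ℓ n r d := by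
  rw [vermaGen, diagOp_vec]

theorem vermaGen_f0 (n r d : ℕ) : vermaGen ℓ a b s (f 0) (vec ℓ n r d) = vec ℓ (n + 1) r d := by
  rw [vermaGen, if_pos rfl, opF0, vOp_vec]
  exact fun h => vec_of_not (by omega)

theorem vermaGen_f1 (hℓ : 3 ≤ ℓ) (n r d : ℕ) : vermaGen ℓ a b s (f 1) (vec ℓ n r d) =
    (xi ℓ ^ n * (-xi ℓ) ^ r) • vec ℓ n r (d + 1) + qInt (xi ℓ) n • vec ℓ (n - 1) (r + 1) d := by
  rw [vermaGen, if_neg one_ne_zero, opF1, vOp_vec]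
  intro h
  rw [vec_of_not (show ¬ (n < ℓ ∧ r < 2 ∧ d + 1 < 2) by omega), smul_zero, zero_add]
  -- the only vector that could survive has `n = ℓ`, where the quantum integer vanishes
  rcases eq_or_ne n ℓ with rfl | hn
  · rw [qInt_xi_self hℓ, zero_smul]
  · rw [vec_of_not (by omega), smul_zero]

theorem vermaGen_e0 (hℓ : 3 ≤ ℓ) (n r d : ℕ) : vermaGen ℓ a b s (e 0) (vec ℓ n r d) =
    (qInt (xi ℓ) n * ((a * (xi ℓ)⁻¹ ^ r * xi ℓ ^ d * (xi ℓ)⁻¹ ^ (n - 1) -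
      a⁻¹ * xi ℓ ^ r * (xi ℓ)⁻¹ ^ d * xi ℓ ^ (n - 1)) / (xi ℓ - (xi ℓ)⁻¹))) •
        vec ℓ (n - 1) r d +
      if r = 1 ∧ d = 0 then (-(xi ℓ * a)) • vec ℓ n 0 1 else 0 := by
  rw [vermaGen, if_pos rfl, opE0, vOp_vec]
  intro h
  rw [show (if r = 1 ∧ d = 0 then (-(xi ℓ * a)) • vec ℓ n 0 1 else 0) = 0 by
    split_ifs
    · rw [vec_of_not (by omega), smul_zero]
    · rfl, add_zero]
  rcases eq_or_ne n ℓ with rfl | hn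
  · rw [qInt_xi_self hℓ, zero_mul, zero_smul]
  · rw [vec_of_not (by omega), smul_zero]

theorem vermaGen_e1 (n r d : ℕ) : vermaGen ℓ a b s (e 1) (vec ℓ n r d) =
    (if r = 1 then b⁻¹ • vec ℓ (n + 1) 0 d else 0) +
      if d = 1 then ((-1) ^ r * ((b - b⁻¹) / (xi ℓ - (xi ℓ)⁻¹))) • vec ℓ n r 0 else 0 := by
  rw [vermaGen, if_neg one_ne_zero, opE1, vOp_vec]
  intro h
  have h1 : r = 1 → vec ℓ (n + 1) 0 d = 0 := fun _ => vec_of_not (by omega)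
  have h2 : d = 1 → vec ℓ n r 0 = 0 := fun _ => vec_of_not (by omega)
  split_ifs with hr hd hd
  · rw [h1 hr, h2 hd, smul_zero, smul_zero, add_zero]
  · rw [h1 hr, smul_zero, add_zero]
  · rw [h2 hd, smul_zero, add_zero]
  · rw [add_zero]

variable {ℓ a b s}

/-- The Verma module is generated by its highest weight vector under `f_1` and `f_2`. -/
theorem verma_cyclic (hℓ : 3 ≤ ℓ) {N : Submodule ℂ (Verma ℓ)} (h0 : vec ℓ 0 0 0 ∈ N)
    (hf0 : ∀ v ∈ N, vermaGen ℓ a b s (f 0) v ∈ N) (hf1 : ∀ v ∈ N, vermaGen ℓ a b s (f 1) v ∈ N) :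
    N = ⊤ := by
  have h1 : vec ℓ 0 0 1 ∈ N := by
    simpa [vermaGen_f1 ℓ a b s hℓ, qInt] using hf1 _ h0
  have h2 : ∀ d, vec ℓ 0 0 d ∈ N → vec ℓ 0 1 d ∈ N := by
    intro d hd
    have e1 := hf1 _ (hf0 _ hd)
    have e2 := hf0 _ (hf1 _ hd)
    simp only [vermaGen_f0, vermaGen_f1 ℓ a b s hℓ, map_add, map_smul, qInt] at e1 e2
    convert sub_mem e1 (N.smul_mem (xi ℓ) e2) using 1
    simp
  have h3 : ∀ i r d, vec ℓ 0 r d ∈ N → vec ℓ i r d ∈ N := by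
    intro i r d h
    induction i with
    | zero => exact h
    | succ i ih =>
      rw [← vermaGen_f0 ℓ a b s]
      exact hf0 _ ih
  have h4 : ∀ (r d : Fin 2), vec ℓ 0 r d ∈ N := by
    intro r d
    fin_cases r <;> fin_cases d
    · exact h0
    · exact h1
    · exact h2 _ h0
    · exact h2 _ h1
  rw [eq_top_iff, ← (Pi.basisFun ℂ (Fin ℓ × Fin 2 × Fin 2)).span_eq, Submodule.span_le]
  rintro _ ⟨p, rfl⟩
  rw [Pi.basisFun_apply, ← vec_fin]
  exact h3 _ _ _ (h4 _ _)

/-- An operator that kills the highest weight vector and commutes up to scalars with `f_1` and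
`f_2` is zero. -/
theorem verma_eq_zero (hℓ : 3 ≤ ℓ) {T : Module.End ℂ (Verma ℓ)} (h0 : T (vec ℓ 0 0 0) = 0)
    {c d : ℂ} (hf0 : T * vermaGen ℓ a b s (f 0) = c • (vermaGen ℓ a b s (f 0) * T))
    (hf1 : T * vermaGen ℓ a b s (f 1) = d • (vermaGen ℓ a b s (f 1) * T)) : T = 0 := by
  rw [← LinearMap.ker_eq_top]
  refine verma_cyclic (a := a) (b := b) (s := s) hℓ (by simpa using h0) ?_ ?_
  · intro v hv
    have := LinearMap.congr_fun hf0 v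
    rw [LinearMap.mem_ker] at hv ⊢
    simpa [hv] using this
  · intro v hv
    have := LinearMap.congr_fun hf1 v
    rw [LinearMap.mem_ker] at hv ⊢
    simpa [hv] using this

theorem vermaGen_k_kInv (ha : a ≠ 0) (hb : b ≠ 0) (i : Fin 2) :
    vermaGen ℓ a b s (k i) * vermaGen ℓ a b s (kInv i) = 1 := by
  have hx := xi_ne_zero ℓ
  refine verma_ext fun n r d _ _ => ?_
  fin_cases i <;> simp only [Fin.zero_eta, Fin.mk_one, Fin.isValue, Module.End.mul_apply,
    vermaGen_k0, vermaGen_k1, vermaGen_kInv0, vermaGen_kInv1, map_smul, smul_smul,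
    Module.End.one_apply, inv_pow] <;> match_scalars <;> field_simp

theorem vermaGen_k_f (hℓ : 3 ≤ ℓ) (i j : Fin 2) :
    vermaGen ℓ a b s (k i) * vermaGen ℓ a b s (f j) =
      xi ℓ ^ (-cartan i j) • (vermaGen ℓ a b s (f j) * vermaGen ℓ a b s (k i)) := by
  have hx := xi_ne_zero ℓ
  refine verma_ext fun n r d hr hd => ?_
  fin_cases i <;> fin_cases j <;> rcases n with _ | n <;>
    simp only [Fin.zero_eta, Fin.mk_one, Fin.isValue, Module.End.mul_apply, LinearMap.smul_apply,
      vermaGen_k0, vermaGen_k1, vermaGen_f0, vermaGen_f1 _ _ _ _ hℓ, map_add, map_smul,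
      cartan_00, cartan_01, cartan_10, cartan_11, neg_neg, neg_zero, zpow_neg,
      zpow_ofNat, Nat.add_sub_cancel, qInt, zero_smul, add_zero, inv_pow] <;>
    match_scalars <;> field_simp <;> ring

theorem vermaGen_k_e (hℓ : 3 ≤ ℓ) (i j : Fin 2) :
    vermaGen ℓ a b s (k i) * vermaGen ℓ a b s (e j) =
      xi ℓ ^ cartan i j • (vermaGen ℓ a b s (e j) * vermaGen ℓ a b s (k i)) := by
  have hx := xi_ne_zero ℓ
  have hx' := xi_sub_inv_ne_zero hℓ
  refine verma_ext fun n r d hr hd => ?_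
  fin_cases i <;> fin_cases j <;> interval_cases r <;> interval_cases d <;>
    rcases n with _ | n <;>
    simp [
      vermaGen_k0, vermaGen_k1, vermaGen_e0 _ _ _ _ hℓ, vermaGen_e1,
      cartan_00, cartan_01, cartan_10, cartan_11, qInt] <;>
    match_scalars <;> field_simp <;> ring

theorem vermaGen_kInv_k (ha : a ≠ 0) (hb : b ≠ 0) (i : Fin 2) :
    vermaGen ℓ a b s (kInv i) * vermaGen ℓ a b s (k i) = 1 := by
  have hx := xi_ne_zero ℓ
  refine verma_ext fun n r d _ _ => ?_
  fin_cases i <;> simp only [Fin.zero_eta, Fin.mk_one, Fin.isValue, Module.End.mul_apply,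
    vermaGen_k0, vermaGen_k1, vermaGen_kInv0, vermaGen_kInv1, map_smul, smul_smul,
    Module.End.one_apply, inv_pow] <;> match_scalars <;> field_simp

theorem vermaGen_k_pow (hℓ : 3 ≤ ℓ) (ha : a ^ ℓ = 1) (hb : b ^ ℓ = 1) (i : Fin 2) :
    vermaGen ℓ a b s (k i) ^ ℓ = 1 := by
  have hx : ∀ m : ℕ, (xi ℓ ^ m) ^ ℓ = 1 := fun m => by
    rw [pow_right_comm, (xi_primitive hℓ).pow_eq_one, one_pow]
  refine verma_ext fun n r d _ _ => ?_
  fin_cases i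
  · simp only [vermaGen, Fin.zero_eta, if_true, diagOp_pow_vec, mul_pow, inv_pow, ha, hx,
      inv_one, one_mul, one_smul, Module.End.one_apply]
  · simp only [vermaGen, Fin.mk_one, one_ne_zero, if_false, diagOp_pow_vec, mul_pow, hb, hx,
      one_mul, one_smul, Module.End.one_apply]

theorem vermaGen_sigma_f (hℓ : 3 ≤ ℓ) (i : Fin 2) :
    vermaGen ℓ a b s sigma * vermaGen ℓ a b s (f i) =
      (-1 : ℂ) ^ (i : ℕ) • (vermaGen ℓ a b s (f i) * vermaGen ℓ a b s sigma) := by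
  refine verma_ext fun n r d hr hd => ?_
  fin_cases i <;>
    simp only [Fin.zero_eta, Fin.mk_one, Fin.isValue, Module.End.mul_apply,
      LinearMap.smul_apply, vermaGen_sigma, vermaGen_f0,
      vermaGen_f1 _ _ _ _ hℓ, map_add, map_smul] <;>
    match_scalars <;> ring

theorem vermaGen_sigma_e (hℓ : 3 ≤ ℓ) (i : Fin 2) :
    vermaGen ℓ a b s sigma * vermaGen ℓ a b s (e i) =
      (-1 : ℂ) ^ (i : ℕ) • (vermaGen ℓ a b s (e i) * vermaGen ℓ a b s sigma) := by
  refine verma_ext fun n r d hr hd => ?_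
  fin_cases i <;> interval_cases r <;> interval_cases d <;>
    simp [vermaGen_sigma, vermaGen_e0 _ _ _ _ hℓ, vermaGen_e1] <;>
    match_scalars <;> ring

theorem vermaGen_f1_sq (hℓ : 3 ≤ ℓ) : vermaGen ℓ a b s (f 1) ^ 2 = 0 := by
  refine verma_ext fun n r d hr hd => ?_
  interval_cases r <;> interval_cases d <;> rcases n with _ | n <;>
    simp [pow_two, vermaGen_f1 _ _ _ _ hℓ, qInt, vec_left_two, vec_right_two]
  all_goals match_scalars; ring

theorem vermaGen_serre_f (hℓ : 3 ≤ ℓ) :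
    serreElt (xi ℓ) (vermaGen ℓ a b s (f 0)) (vermaGen ℓ a b s (f 1)) = 0 := by
  have hx := xi_ne_zero ℓ
  refine verma_ext fun n r d hr hd => ?_
  rcases n with _ | n <;>
    simp only [serreElt, pow_two, LinearMap.add_apply, LinearMap.sub_apply, LinearMap.smul_apply,
      Module.End.mul_apply, LinearMap.zero_apply, map_add, map_smul, vermaGen_f0,
      vermaGen_f1 _ _ _ _ hℓ, qInt, Nat.add_sub_cancel, zero_smul, add_zero] <;>
    match_scalars <;> field_simp <;> ring

theorem vermaGen_f0_pow : vermaGen ℓ a b s (f 0) ^ ℓ = 0 := by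
  have h : ∀ m n r d, (vermaGen ℓ a b s (f 0) ^ m) (vec ℓ n r d) = vec ℓ (n + m) r d := by
    intro m n r d
    induction m with
    | zero => simp
    | succ m ih => rw [pow_succ', Module.End.mul_apply, ih, vermaGen_f0, add_assoc]
  refine verma_ext fun n r d hr hd => ?_
  rw [h, vec_of_not (by omega), LinearMap.zero_apply]

theorem vermaGen_e0_f0 (hℓ : 3 ≤ ℓ) (ha : a ≠ 0) :
    vermaGen ℓ a b s (e 0) * vermaGen ℓ a b s (f 0) =
      vermaGen ℓ a b s (f 0) * vermaGen ℓ a b s (e 0) +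
      (xi ℓ - (xi ℓ)⁻¹)⁻¹ • (vermaGen ℓ a b s (k 0) - vermaGen ℓ a b s (kInv 0)) := by
  have hx := xi_ne_zero ℓ
  have hx' := xi_sub_inv_ne_zero hℓ
  have hx2 : xi ℓ ^ 2 - 1 ≠ 0 := by
    intro h; apply hx'; field_simp; linear_combination h
  refine verma_ext fun n r d hr hd => ?_
  interval_cases r <;> interval_cases d <;> rcases n with _ | n <;>
    simp [vermaGen_e0 _ _ _ _ hℓ, vermaGen_f0, vermaGen_k0, vermaGen_kInv0,
      qInt_eq hx hx'] <;>
    match_scalars <;> field_simp <;> ring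

theorem vermaGen_e1_f1 (hℓ : 3 ≤ ℓ) (hb : b ≠ 0) :
    vermaGen ℓ a b s (e 1) * vermaGen ℓ a b s (f 1) =
      -(vermaGen ℓ a b s (f 1) * vermaGen ℓ a b s (e 1)) +
      (xi ℓ - (xi ℓ)⁻¹)⁻¹ • (vermaGen ℓ a b s (k 1) - vermaGen ℓ a b s (kInv 1)) := by
  have hx := xi_ne_zero ℓ
  have hx' := xi_sub_inv_ne_zero hℓ
  have hx2 : xi ℓ ^ 2 - 1 ≠ 0 := by
    intro h; apply hx'; field_simp; linear_combination h
  refine verma_ext fun n r d hr hd => ?_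
  interval_cases r <;> interval_cases d <;> rcases n with _ | n <;>
    simp [vermaGen_e1, vermaGen_f1 _ _ _ _ hℓ, vermaGen_k1, vermaGen_kInv1,
      qInt_eq hx hx', vec_left_two, vec_right_two] <;>
    match_scalars <;> field_simp <;> ring

theorem vermaGen_e0_f1 (hℓ : 3 ≤ ℓ) (ha : a ≠ 0) :
    vermaGen ℓ a b s (e 0) * vermaGen ℓ a b s (f 1) =
      vermaGen ℓ a b s (f 1) * vermaGen ℓ a b s (e 0) := by
  have hx := xi_ne_zero ℓ
  have hx' := xi_sub_inv_ne_zero hℓ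
  have hx2 : xi ℓ ^ 2 - 1 ≠ 0 := by
    intro h; apply hx'; field_simp; linear_combination h
  refine verma_ext fun n r d hr hd => ?_
  interval_cases r <;> interval_cases d <;> rcases n with _ | _ | n <;>
    simp [vermaGen_e0 _ _ _ _ hℓ, vermaGen_f1 _ _ _ _ hℓ,
      qInt_eq hx hx', vec_left_two, vec_right_two] <;>
    match_scalars <;> field_simp <;> ring

theorem vermaGen_e1_f0 :
    vermaGen ℓ a b s (e 1) * vermaGen ℓ a b s (f 0) =
      vermaGen ℓ a b s (f 0) * vermaGen ℓ a b s (e 1) := by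
  refine verma_ext fun n r d hr hd => ?_
  interval_cases r <;> interval_cases d <;> simp [vermaGen_e1, vermaGen_f0]

/-- The Verma module is a module over the whole algebra. The relations between the `e_i` need no
computation in coordinates: their left sides kill the highest weight vector and commute up to sign
with `f_1` and `f_2`. -/
theorem verma_satisfies (hodd : Odd ℓ) (hℓ : 3 ≤ ℓ) (ha : a ^ ℓ = 1) (hb : b ^ ℓ = 1)
    (hs : s ^ 2 = 1) : Satisfies ℓ (vermaGen ℓ a b s) := by
  have hx := xi_ne_zero ℓ
  have ha0 : a ≠ 0 := by rintro rfl; simp [show ℓ ≠ 0 by omega] at ha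
  have hb0 : b ≠ 0 := by rintro rfl; simp [show ℓ ≠ 0 by omega] at hb
  have kk := vermaGen_k_kInv (ℓ := ℓ) (s := s) ha0 hb0
  have kk' := vermaGen_kInv_k (ℓ := ℓ) (s := s) ha0 hb0
  have k_e : ∀ i j, vermaGen ℓ a b s (k i) * vermaGen ℓ a b s (e j) * vermaGen ℓ a b s (kInv i) =
      xi ℓ ^ cartan i j • vermaGen ℓ a b s (e j) := fun i j => by
    rw [vermaGen_k_e hℓ, smul_mul_assoc, mul_assoc, kk, mul_one]
  have ke : ∀ i j, vermaGen ℓ a b s (k i) * vermaGen ℓ a b s (e j) =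
      xi ℓ ^ cartan i j • (vermaGen ℓ a b s (e j) * vermaGen ℓ a b s (k i)) :=
    vermaGen_k_e hℓ
  have ke' : ∀ i j, vermaGen ℓ a b s (kInv i) * vermaGen ℓ a b s (e j) =
      (xi ℓ ^ cartan i j)⁻¹ • (vermaGen ℓ a b s (e j) * vermaGen ℓ a b s (kInv i)) := fun i j => by
    have hc := zpow_ne_zero (cartan i j) hx
    exact swap_inv_of_conj hc (k_e i j) (kk' i)
  have ef00 := vermaGen_e0_f0 (b := b) (s := s) hℓ ha0
  have ef11 := vermaGen_e1_f1 (a := a) (s := s) hℓ hb0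
  have ef01 := vermaGen_e0_f1 (b := b) (s := s) hℓ ha0
  have ef10 := vermaGen_e1_f0 (ℓ := ℓ) (a := a) (b := b) (s := s)
  have e0v : vermaGen ℓ a b s (e 0) (vec ℓ 0 0 0) = 0 := by
    simp [vermaGen_e0 _ _ _ _ hℓ, qInt]
  have e1v : vermaGen ℓ a b s (e 1) (vec ℓ 0 0 0) = 0 := by simp [vermaGen_e1]
  refine ⟨?_, kk, kk', k_e, ?_, ?_, ?_, ?_, ?_, ?_, vermaGen_f1_sq hℓ, ?_, vermaGen_serre_f hℓ, ?_,
    vermaGen_f0_pow, ?_, ?_, vermaGen_sigma_e hℓ, vermaGen_sigma_f hℓ, vermaGen_k_pow hℓ ha hb⟩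
  · refine verma_ext fun n r d _ _ => ?_
    simp only [Module.End.mul_apply, vermaGen_k0, vermaGen_k1, map_smul, smul_smul, mul_comm]
  · intro i j
    rw [vermaGen_k_f hℓ, smul_mul_assoc, mul_assoc, kk, mul_one]
  · rw [ef00, add_sub_cancel_left]
  · rw [ef11]; abel
  · rw [ef01, sub_self]
  · rw [ef10, sub_self]
  · refine verma_eq_zero (a := a) (b := b) (s := s) (c := 1) (d := 1) hℓ ?_ ?_ ?_
    · rw [pow_two, Module.End.mul_apply, e1v, map_zero]
    · rw [one_smul]
      exact (Commute.pow_left ef10 2).eq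
    · rw [one_smul]
      refine sq_comm_of_bracket ef11 ?_ ?_
      · simpa [cartan_11] using ke 1 1
      · simpa [cartan_11] using ke' 1 1
  · refine verma_eq_zero (a := a) (b := b) (s := s) (c := 1) (d := -1) hℓ ?_ ?_ ?_
    · simp [pow_two, e0v, e1v]
    · rw [one_smul]
      refine serreElt_mul_left hx ef00 ef10 ?_ ?_ ?_ ?_
      · simpa [cartan_00] using ke 0 0
      · simpa [cartan_00] using ke' 0 0
      · simpa [cartan_01] using ke 0 1
      · simpa [cartan_01] using ke' 0 1
    · refine (serreElt_mul_right hx ef11 ef01 ?_ ?_).trans (neg_one_smul ℂ _).symm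
      · simpa [cartan_10] using ke 1 0
      · simpa [cartan_10] using ke' 1 0
  · refine verma_eq_zero (a := a) (b := b) (s := s) (c := 1) (d := 1) hℓ ?_ ?_ ?_
    · obtain ⟨n, rfl⟩ : ∃ n, ℓ = n + 1 := ⟨ℓ - 1, by omega⟩
      rw [pow_succ, Module.End.mul_apply, e0v, map_zero]
    · rw [one_smul]
      refine pow_comm_of_bracket (xi_sq_primitive hodd) (by omega) ef00 ?_ ?_
      · simpa [cartan_00] using ke 0 0
      · simpa [cartan_00] using ke' 0 0
    · rw [one_smul]
      exact (Commute.pow_left ef01 ℓ).eq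
  · refine verma_ext fun n r d _ _ => ?_
    simp only [vermaGen, diagOp_pow_vec, mul_pow, hs, one_mul, Module.End.one_apply]
    rw [pow_right_comm, neg_one_sq, one_pow, one_smul]
  · intro i
    refine verma_ext fun n r d _ _ => ?_
    fin_cases i <;>
      simp only [Fin.zero_eta, Fin.mk_one, Module.End.mul_apply, vermaGen_k0, vermaGen_k1,
        vermaGen_sigma, map_smul, smul_smul, mul_comm]

/-- The basis vectors are the monomials in `f_1` and `f_2` applied to the highest weight vector. -/
theorem verma_qMon (hℓ : 3 ≤ ℓ) (i r d : ℕ) :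
    qMon (xi ℓ) (vermaGen ℓ a b s (f 0)) (vermaGen ℓ a b s (f 1)) i r d (vec ℓ 0 0 0) =
      vec ℓ i r d := by
  induction i with
  | succ i ih => rw [← SerrePair.left_mul_qMon, Module.End.mul_apply, ih, vermaGen_f0]
  | zero =>
    simp only [qMon, pow_zero, one_mul, Module.End.mul_apply]
    induction r with
    | succ r ih =>
      rw [pow_succ', Module.End.mul_apply, ih]
      simp [qComm, vermaGen_f0, vermaGen_f1 _ _ _ _ hℓ, qInt, smul_smul]
    | zero =>
      rw [pow_zero, Module.End.one_apply]
      induction d with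
      | succ d ih => rw [pow_succ', Module.End.mul_apply, ih]; simp [vermaGen_f1 _ _ _ _ hℓ, qInt]
      | zero => simp

end verma

/-! ### The Chevalley involution -/

section twist

variable {ℓ : ℕ} {B : Type*} [Ring B] [Algebra ℂ B] {g : Gen → B}

/-- The images of the generators under the automorphism that exchanges the `e_i` and the `f_i`;
the sign makes it compatible with the relation between `e_2` and `f_2`. -/
def twistGen (g : Gen → B) : Gen → B
  | k i => g (kInv i)
  | kInv i => g (k i)
  | e i => g (f i)
  | f i => if i = 0 then g (e 0) else -g (e 1)
  | sigma => g sigma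

theorem twist_satisfies (h : Satisfies ℓ g) : Satisfies ℓ (twistGen g) := by
  have f0 : twistGen g (f 0) = g (e 0) := rfl
  have f1 : twistGen g (f 1) = -g (e 1) := rfl
  have hke : ∀ i j, g (kInv i) * g (e j) * g (k i) = xi ℓ ^ (-cartan i j) • g (e j) := fun i j => by
    rw [h.kInv_e', smul_mul_assoc, mul_assoc, h.kInv_k, mul_one]
  constructor
  case k_comm => exact h.kInv_kInv 0 1
  case k_kInv => exact h.kInv_k
  case kInv_k => exact h.k_kInv
  case k_e =>
    intro i j
    change g (kInv i) * g (f j) * g (k i) = _ • g (f j)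
    rw [h.kInv_f', smul_mul_assoc, mul_assoc, h.kInv_k, mul_one]
  case k_f =>
    intro i j
    fin_cases j
    · exact hke i 0
    · change g (kInv i) * -g (e 1) * g (k i) = _ • -g (e 1)
      rw [mul_neg, neg_mul, hke, smul_neg]
      rfl
  case e1_f1 =>
    change g (f 0) * g (e 0) - g (e 0) * g (f 0) = _ • (g (kInv 0) - g (k 0))
    rw [← neg_sub, h.e1_f1, ← smul_neg, neg_sub]
  case e2_f2 =>
    change g (f 1) * -g (e 1) + -g (e 1) * g (f 1) = _ • (g (kInv 1) - g (k 1))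
    rw [← neg_sub (g (k 1)), smul_neg, ← h.e2_f2]
    noncomm_ring
  case e1_f2 =>
    change g (f 0) * -g (e 1) - -g (e 1) * g (f 0) = 0
    rw [← h.e2_f1]
    noncomm_ring
  case e2_f1 =>
    change g (f 1) * g (e 0) - g (e 0) * g (f 1) = 0
    rw [← neg_sub, h.e1_f2, neg_zero]
  case e2_sq => exact h.f2_sq
  case f2_sq => rw [f1, neg_sq, h.e2_sq]
  case serre_e => exact h.serre_f
  case serre_f =>
    rw [f0, f1, ← neg_eq_zero, ← h.serre_e]
    simp only [mul_neg, neg_mul, smul_neg]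
    abel
  case e1_pow => exact h.f1_pow
  case f1_pow => exact h.e1_pow
  case sigma_sq => exact h.sigma_sq
  case sigma_k => exact fun i => (h.kInv_sigma i).symm
  case sigma_e => exact h.sigma_f
  case sigma_f =>
    intro i
    fin_cases i
    · exact h.sigma_e 0
    · change g sigma * -g (e 1) = _ • (-g (e 1) * g sigma)
      rw [mul_neg, h.sigma_e, neg_mul, smul_neg]
      rfl
  case k_pow => exact h.kInv_pow

end twist

/-! ### The triangular decomposition -/

section triangular

variable (ℓ : ℕ)

/-- The monomial `f_1^i f_3^r f_2^d`. -/
def fMon (i r d : ℕ) : U0 ℓ := qMon (xi ℓ) (gen ℓ (f 0)) (gen ℓ (f 1)) i r d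

/-- The monomial `e_1^i e_3^r e_2^d`, up to a nonzero scalar. -/
def eMon (i r d : ℕ) : U0 ℓ := qMon (xi ℓ) (gen ℓ (e 0)) (gen ℓ (e 1)) i r d

/-- The monomial `k_1^i k_2^j σ^m`. -/
def kMon (i j m : ℕ) : U0 ℓ := gen ℓ (k 0) ^ i * gen ℓ (k 1) ^ j * gen ℓ sigma ^ m

/-- The span of the monomials in the `f_i` whose weight lies in `s`. -/
def fSpan (s : Set ℕ) : Submodule ℂ (U0 ℓ) := qSpan (xi ℓ) (gen ℓ (f 0)) (gen ℓ (f 1)) s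

/-- The span of the monomials in the `e_i` whose weight lies in `s`. -/
def eSpan (s : Set ℕ) : Submodule ℂ (U0 ℓ) := qSpan (xi ℓ) (gen ℓ (e 0)) (gen ℓ (e 1)) s

/-- The Cartan part, spanned by the monomials in `k_1`, `k_2` and `σ`. -/
def kSpan : Submodule ℂ (U0 ℓ) := Submodule.span ℂ {x | ∃ i j m, x = kMon ℓ i j m}

/-- The span of `f_1` and `f_2`. -/
def fGen : Submodule ℂ (U0 ℓ) := Submodule.span ℂ (Set.range fun i => gen ℓ (f i))

/-- The span of `e_1` and `e_2`. -/
def eGen : Submodule ℂ (U0 ℓ) := Submodule.span ℂ (Set.range fun i => gen ℓ (e i))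

variable {ℓ}

theorem serrePair_f : SerrePair (xi ℓ) (gen ℓ (f 0)) (gen ℓ (f 1)) :=
  ⟨(gen_satisfies ℓ).serre_f, (gen_satisfies ℓ).f2_sq⟩

theorem serrePair_e : SerrePair (xi ℓ) (gen ℓ (e 0)) (gen ℓ (e 1)) :=
  ⟨(gen_satisfies ℓ).serre_e, (gen_satisfies ℓ).e2_sq⟩

theorem gen_f_mem (i : Fin 2) : gen ℓ (f i) ∈ fGen ℓ := Submodule.subset_span ⟨i, rfl⟩

theorem gen_e_mem (i : Fin 2) : gen ℓ (e i) ∈ eGen ℓ := Submodule.subset_span ⟨i, rfl⟩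

theorem fGen_mul_fSpan {s t : Set ℕ} (hst : ∀ n ∈ s, n + 1 ∈ t) :
    fGen ℓ * fSpan ℓ s ≤ fSpan ℓ t := by
  rw [fGen, Submodule.mul_le]
  intro m hm n hn
  induction hm using Submodule.span_induction with
  | mem x hx =>
    obtain ⟨i, rfl⟩ := hx
    fin_cases i
    · exact left_mul_mem_qSpan hst hn
    · exact right_mul_mem_qSpan (xi_ne_zero ℓ) serrePair_f hst hn
  | zero => simp
  | add x y _ _ hx hy => rw [add_mul]; exact add_mem hx hy
  | smul c x _ hx => rw [smul_mul_assoc]; exact Submodule.smul_mem _ _ hx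

theorem eGen_mul_eSpan {s t : Set ℕ} (hst : ∀ n ∈ s, n + 1 ∈ t) :
    eGen ℓ * eSpan ℓ s ≤ eSpan ℓ t := by
  rw [eGen, Submodule.mul_le]
  intro m hm n hn
  induction hm using Submodule.span_induction with
  | mem x hx =>
    obtain ⟨i, rfl⟩ := hx
    fin_cases i
    · exact left_mul_mem_qSpan hst hn
    · exact right_mul_mem_qSpan (xi_ne_zero ℓ) serrePair_e hst hn
  | zero => simp
  | add x y _ _ hx hy => rw [add_mul]; exact add_mem hx hy
  | smul c x _ hx => rw [smul_mul_assoc]; exact Submodule.smul_mem _ _ hx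

theorem kMon_mul_kMon (i j m i' j' m' : ℕ) :
    kMon ℓ i j m * kMon ℓ i' j' m' = kMon ℓ (i + i') (j + j') (m + m') := by
  have h := gen_satisfies ℓ
  have c1 : Commute (gen ℓ (k 1) ^ j) (gen ℓ (k 0) ^ i') := Commute.pow_pow (h.k_k 1 0) _ _
  have c2 : Commute (gen ℓ sigma ^ m) (gen ℓ (k 0) ^ i') := Commute.pow_pow (h.sigma_k 0) _ _
  have c3 : Commute (gen ℓ sigma ^ m) (gen ℓ (k 1) ^ j') := Commute.pow_pow (h.sigma_k 1) _ _
  simp only [kMon, pow_add, mul_assoc, assoc_comm c1.eq, assoc_comm c2.eq, assoc_comm c3.eq]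

theorem kMon_mem (i j m : ℕ) : kMon ℓ i j m ∈ kSpan ℓ := Submodule.subset_span ⟨i, j, m, rfl⟩

theorem one_mem_kSpan : (1 : U0 ℓ) ∈ kSpan ℓ := by simpa [kMon] using kMon_mem (ℓ := ℓ) 0 0 0

theorem kSpan_mul_kSpan : kSpan ℓ * kSpan ℓ ≤ kSpan ℓ := by
  rw [kSpan, Submodule.span_mul_span, Submodule.span_le]
  rintro _ ⟨_, ⟨i, j, m, rfl⟩, _, ⟨i', j', m', rfl⟩, rfl⟩
  change kMon ℓ i j m * kMon ℓ i' j' m' ∈ kSpan ℓ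
  rw [kMon_mul_kMon]
  exact kMon_mem _ _ _

theorem pow_mem_kSpan {x : U0 ℓ} (hx : x ∈ kSpan ℓ) (n : ℕ) : x ^ n ∈ kSpan ℓ := by
  induction n with
  | zero => simpa using one_mem_kSpan
  | succ n ih => rw [pow_succ]; exact kSpan_mul_kSpan (Submodule.mul_mem_mul ih hx)

theorem gen_k_mem (i : Fin 2) : gen ℓ (k i) ∈ kSpan ℓ := by
  fin_cases i
  · simpa [kMon] using kMon_mem (ℓ := ℓ) 1 0 0
  · simpa [kMon] using kMon_mem (ℓ := ℓ) 0 1 0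

theorem gen_sigma_mem : gen ℓ sigma ∈ kSpan ℓ := by
  simpa [kMon] using kMon_mem (ℓ := ℓ) 0 0 1

theorem gen_kInv_eq (hℓ : 3 ≤ ℓ) (i : Fin 2) : gen ℓ (kInv i) = gen ℓ (k i) ^ (ℓ - 1) := by
  have h := gen_satisfies ℓ
  have h1 : gen ℓ (k i) ^ (ℓ - 1) * gen ℓ (k i) = 1 := by
    rw [← pow_succ, Nat.sub_add_cancel (by omega), h.k_pow]
  exact (left_inv_eq_right_inv h1 (h.k_kInv i)).symm

theorem gen_kInv_mem (hℓ : 3 ≤ ℓ) (i : Fin 2) : gen ℓ (kInv i) ∈ kSpan ℓ := by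
  rw [gen_kInv_eq hℓ]
  fin_cases i
  · simpa [kMon] using kMon_mem (ℓ := ℓ) (ℓ - 1) 0 0
  · simpa [kMon] using kMon_mem (ℓ := ℓ) 0 (ℓ - 1) 0

theorem kMon_qcomm {x : U0 ℓ} {c : Fin 2 → ℂ} {d : ℂ}
    (hk : ∀ i, gen ℓ (k i) * x = c i • (x * gen ℓ (k i)))
    (hs : gen ℓ sigma * x = d • (x * gen ℓ sigma)) (i j m : ℕ) :
    kMon ℓ i j m * x = (c 0 ^ i * c 1 ^ j * d ^ m) • (x * kMon ℓ i j m) := by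
  have hp : ∀ {y : U0 ℓ} {c : ℂ}, y * x = c • (x * y) → ∀ n : ℕ, y ^ n * x = c ^ n • (x * y ^ n) := by
    intro y c hy n
    induction n with
    | zero => simp
    | succ n ih =>
      rw [pow_succ, mul_assoc, hy, mul_smul_comm, ← mul_assoc, ih, smul_mul_assoc, smul_smul,
        mul_assoc, ← pow_succ']
  rw [kMon, mul_assoc, hp hs, mul_smul_comm, mul_assoc, ← mul_assoc (_ ^ j), hp (hk 1),
    smul_mul_assoc, mul_smul_comm, mul_assoc x, ← mul_assoc (_ ^ i), hp (hk 0), smul_mul_assoc,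
    smul_smul, smul_smul]
  congr 1
  · ring
  · simp only [mul_assoc]

theorem kMon_mul_f (i j m : ℕ) (n : Fin 2) : ∃ c : ℂ,
    kMon ℓ i j m * gen ℓ (f n) = c • (gen ℓ (f n) * kMon ℓ i j m) :=
  have h := gen_satisfies ℓ
  ⟨_, kMon_qcomm (fun a => h.k_f' a n) (h.sigma_f n) i j m⟩

theorem kMon_mul_e (i j m : ℕ) (n : Fin 2) : ∃ c : ℂ,
    kMon ℓ i j m * gen ℓ (e n) = c • (gen ℓ (e n) * kMon ℓ i j m) :=
  have h := gen_satisfies ℓ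
  ⟨_, kMon_qcomm (fun a => h.k_e' a n) (h.sigma_e n) i j m⟩

theorem kSpan_mul_fSpan (s : Set ℕ) : kSpan ℓ * fSpan ℓ s ≤ fSpan ℓ s * kSpan ℓ := by
  rw [kSpan, fSpan, qSpan, Submodule.span_mul_span, Submodule.span_le]
  rintro _ ⟨_, ⟨i, j, m, rfl⟩, _, ⟨a, b, c, hs, rfl⟩, rfl⟩
  obtain ⟨c0, h0⟩ := kMon_mul_f (ℓ := ℓ) i j m 0
  obtain ⟨c1, h1⟩ := kMon_mul_f (ℓ := ℓ) i j m 1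
  change kMon ℓ i j m * qMon _ _ _ a b c ∈ fSpan ℓ s * kSpan ℓ
  rw [mul_qMon_of_qcomm h0 h1]
  exact Submodule.smul_mem _ _ (Submodule.mul_mem_mul (qMon_mem_qSpan hs) (kMon_mem _ _ _))

theorem kSpan_mul_eSpan (s : Set ℕ) : kSpan ℓ * eSpan ℓ s ≤ eSpan ℓ s * kSpan ℓ := by
  rw [kSpan, eSpan, qSpan, Submodule.span_mul_span, Submodule.span_le]
  rintro _ ⟨_, ⟨i, j, m, rfl⟩, _, ⟨a, b, c, hs, rfl⟩, rfl⟩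
  obtain ⟨c0, h0⟩ := kMon_mul_e (ℓ := ℓ) i j m 0
  obtain ⟨c1, h1⟩ := kMon_mul_e (ℓ := ℓ) i j m 1
  change kMon ℓ i j m * qMon _ _ _ a b c ∈ eSpan ℓ s * kSpan ℓ
  rw [mul_qMon_of_qcomm h0 h1]
  exact Submodule.smul_mem _ _ (Submodule.mul_mem_mul (qMon_mem_qSpan hs) (kMon_mem _ _ _))

theorem e_mul_f (hℓ : 3 ≤ ℓ) (i j : Fin 2) : ∃ c : ℂ, ∃ κ ∈ kSpan ℓ,
    gen ℓ (e i) * gen ℓ (f j) = c • (gen ℓ (f j) * gen ℓ (e i)) + κ := by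
  have h := gen_satisfies ℓ
  have hκ : ∀ i, (xi ℓ - (xi ℓ)⁻¹)⁻¹ • (gen ℓ (k i) - gen ℓ (kInv i)) ∈ kSpan ℓ := fun i =>
    Submodule.smul_mem _ _ (sub_mem (gen_k_mem i) (gen_kInv_mem hℓ i))
  fin_cases i <;> fin_cases j
  · exact ⟨1, _, hκ 0, by rw [← h.e1_f1]; simp⟩
  · exact ⟨1, 0, zero_mem _, by simpa using sub_eq_zero.1 h.e1_f2⟩
  · exact ⟨1, 0, zero_mem _, by simpa using sub_eq_zero.1 h.e2_f1⟩
  · exact ⟨-1, _, hκ 1, by rw [← h.e2_f2]; simp⟩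

/-- The generators `e_i` can be moved to the right of the monomials in the `f_i`, at the expense of
elements of the Cartan part. -/
theorem eGen_mul_fSpan (hℓ : 3 ≤ ℓ) :
    eGen ℓ * fSpan ℓ Set.univ ≤
      fSpan ℓ Set.univ * kSpan ℓ ⊔ fSpan ℓ Set.univ * eGen ℓ := by
  set P := fSpan ℓ Set.univ with hP
  set T := P * kSpan ℓ ⊔ P * eGen ℓ with hT
  have hfP : fGen ℓ * P ≤ P := fGen_mul_fSpan (by simp)
  have hfT : fGen ℓ * T ≤ T := by
    rw [hT, Submodule.mul_sup, ← mul_assoc, ← mul_assoc]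
    gcongr
  have h1 : (1 : U0 ℓ) ∈ P := one_mem_qSpan (Set.mem_univ _)
  have hstep : ∀ j, ∀ x ∈ P ⊓ ⨅ i, T.comap (LinearMap.mulLeft ℂ (gen ℓ (e i))),
      gen ℓ (f j) * x ∈ P ⊓ ⨅ i, T.comap (LinearMap.mulLeft ℂ (gen ℓ (e i))) := by
    intro j x hx
    simp only [Submodule.mem_inf, Submodule.mem_iInf, Submodule.mem_comap,
      LinearMap.mulLeft_apply] at hx ⊢
    refine ⟨hfP (Submodule.mul_mem_mul (gen_f_mem j) hx.1), fun i => ?_⟩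
    obtain ⟨c, κ, hκ, hc⟩ := e_mul_f (ℓ := ℓ) hℓ i j
    rw [← mul_assoc, hc, add_mul, smul_mul_assoc, mul_assoc]
    refine add_mem (T.smul_mem _ (hfT (Submodule.mul_mem_mul (gen_f_mem j) (hx.2 i)))) ?_
    exact Submodule.mem_sup_left (kSpan_mul_fSpan _ (Submodule.mul_mem_mul hκ hx.1))
  have key : P ≤ P ⊓ ⨅ i, T.comap (LinearMap.mulLeft ℂ (gen ℓ (e i))) := by
    refine qSpan_le ?_ (hstep 0) (hstep 1) _
    simp only [Submodule.mem_inf, Submodule.mem_iInf, Submodule.mem_comap,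
      LinearMap.mulLeft_apply, mul_one]
    refine ⟨h1, fun i => Submodule.mem_sup_right ?_⟩
    simpa using Submodule.mul_mem_mul h1 (gen_e_mem i)
  rw [Submodule.mul_le]
  intro m hm n hn
  have hn' : ∀ i, gen ℓ (e i) * n ∈ T := (Submodule.mem_iInf _).1 (key hn).2
  rw [eGen] at hm
  induction hm using Submodule.span_induction with
  | mem x hx =>
    obtain ⟨i, rfl⟩ := hx
    exact hn' i
  | zero => simp
  | add x y _ _ hx hy => rw [add_mul]; exact add_mem hx hy
  | smul c x _ hx => rw [smul_mul_assoc]; exact Submodule.smul_mem _ _ hx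

/-- Every element is a combination of products of monomials in the `f_i`, in the `e_i` and in the
`k_i` and `σ`, in this order. -/
theorem fSpan_mul_eSpan_mul_kSpan (hℓ : 3 ≤ ℓ) :
    fSpan ℓ Set.univ * eSpan ℓ Set.univ * kSpan ℓ = ⊤ := by
  set P := fSpan ℓ Set.univ with hP
  set Q := eSpan ℓ Set.univ with hQ
  set K := kSpan ℓ with hK
  have hKK : K * K ≤ K := kSpan_mul_kSpan
  have hKQ : K * Q ≤ Q * K := kSpan_mul_eSpan _
  have hKP : K * P ≤ P * K := kSpan_mul_fSpan _
  have hf : fGen ℓ * (P * Q * K) ≤ P * Q * K := by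
    rw [← mul_assoc, ← mul_assoc]
    gcongr
    exact fGen_mul_fSpan (by simp)
  have hPKQK : P * K * Q * K ≤ P * Q * K := by
    calc P * K * Q * K = P * (K * Q) * K := by simp only [mul_assoc]
      _ ≤ P * (Q * K) * K := by gcongr
      _ = P * Q * (K * K) := by simp only [mul_assoc]
      _ ≤ P * Q * K := by gcongr
  have hk : K * (P * Q * K) ≤ P * Q * K := by
    calc K * (P * Q * K) = K * P * Q * K := by simp only [mul_assoc]
      _ ≤ P * K * Q * K := by gcongr
      _ ≤ P * Q * K := hPKQK
  have he : eGen ℓ * (P * Q * K) ≤ P * Q * K := by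
    calc eGen ℓ * (P * Q * K) = eGen ℓ * P * Q * K := by simp only [mul_assoc]
      _ ≤ (P * K ⊔ P * eGen ℓ) * Q * K := by
        gcongr
        exact eGen_mul_fSpan hℓ
      _ = P * K * Q * K ⊔ P * (eGen ℓ * Q) * K := by simp only [Submodule.sup_mul, mul_assoc]
      _ ≤ P * Q * K := by
        refine sup_le hPKQK ?_
        gcongr
        exact eGen_mul_eSpan (by simp)
  have h1 : (1 : U0 ℓ) ∈ P * Q * K := by
    have hP1 : (1 : U0 ℓ) ∈ P := one_mem_qSpan (Set.mem_univ _)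
    have hQ1 : (1 : U0 ℓ) ∈ Q := one_mem_qSpan (Set.mem_univ _)
    simpa only [one_mul] using Submodule.mul_mem_mul (Submodule.mul_mem_mul hP1 hQ1) one_mem_kSpan
  rw [eq_top_iff]
  rintro x -
  suffices ∀ y ∈ P * Q * K, x * y ∈ P * Q * K by simpa using this 1 h1
  induction x using induction with
  | hs c =>
    intro y hy
    rw [← Algebra.smul_def]
    exact Submodule.smul_mem _ _ hy
  | hg a =>
    intro y hy
    cases a with
    | k i => exact hk (Submodule.mul_mem_mul (gen_k_mem i) hy)
    | kInv i => exact hk (Submodule.mul_mem_mul (gen_kInv_mem hℓ i) hy)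
    | e i => exact he (Submodule.mul_mem_mul (gen_e_mem i) hy)
    | f i => exact hf (Submodule.mul_mem_mul (gen_f_mem i) hy)
    | sigma => exact hk (Submodule.mul_mem_mul gen_sigma_mem hy)
  | ha x y hx hy =>
    intro z hz
    rw [add_mul]
    exact add_mem (hx z hz) (hy z hz)
  | hm x y hx hy =>
    intro z hz
    rw [mul_assoc x y z]
    exact hx _ (hy z hz)

end triangular

/-! ### The PBW monomials span -/

section pbwSpan

variable {ℓ : ℕ}

/-- The weight of the `f`-part of a PBW monomial. -/
def PBWIndex.fWeight (a : PBWIndex ℓ) : ℕ := a.f1 + 2 * a.f3 + a.f2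

/-- The weight of the `e`-part of a PBW monomial. -/
def PBWIndex.eWeight (a : PBWIndex ℓ) : ℕ := a.e1 + 2 * a.e3 + a.e2

theorem e3_eq : e3 ℓ = (-(xi ℓ)⁻¹) • qComm (xi ℓ) (gen ℓ (e 0)) (gen ℓ (e 1)) := by
  rw [e3, qComm, smul_sub, smul_smul, neg_mul, inv_mul_cancel₀ (xi_ne_zero ℓ)]
  simp only [neg_smul, one_smul]
  abel

theorem pbw_eq (a : PBWIndex ℓ) : pbw ℓ a = (-(xi ℓ)⁻¹) ^ (a.e3 : ℕ) •
    (fMon ℓ a.f1 a.f3 a.f2 * eMon ℓ a.e1 a.e3 a.e2 * kMon ℓ a.k1 a.k2 a.s) := by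
  rw [pbw, e3_eq, smul_pow, f3, ← qComm, fMon, eMon, kMon, qMon, qMon]
  simp only [mul_smul_comm, smul_mul_assoc, mul_assoc]

theorem qMon_eq_zero {B : Type*} [Ring B] [Algebra ℂ B] {x y : B} (hodd : Odd ℓ) (hℓ : 3 ≤ ℓ)
    (h : SerrePair (xi ℓ) x y) (hx : x ^ ℓ = 0) {i r d : ℕ} (hn : ¬ (i < ℓ ∧ r < 2 ∧ d < 2)) :
    qMon (xi ℓ) x y i r d = 0 := by
  rw [qMon]
  have hz := h.qComm_sq (xi_ne_zero ℓ) (xi_sq_add_one_ne_zero hodd hℓ)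
  by_cases hi : ℓ ≤ i
  · rw [pow_eq_zero_of_le hi hx, zero_mul, zero_mul]
  by_cases hr : 2 ≤ r
  · rw [pow_eq_zero_of_le hr hz, mul_zero, zero_mul]
  · rw [pow_eq_zero_of_le (show 2 ≤ d by omega) h.sq, mul_zero]

theorem kMon_mod (i j m : ℕ) : kMon ℓ i j m = kMon ℓ (i % ℓ) (j % ℓ) (m % 2) := by
  have h := gen_satisfies ℓ
  have hp : ∀ {x : U0 ℓ} {n : ℕ}, x ^ n = 1 → ∀ i, x ^ i = x ^ (i % n) := by
    intro x n hx i
    conv_lhs => rw [← Nat.div_add_mod i n, pow_add, pow_mul, hx, one_pow, one_mul]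
  rw [kMon, kMon, ← hp (h.k_pow 0), ← hp (h.k_pow 1), ← hp h.sigma_sq]

/-- A product of three monomials is zero or, up to a scalar, a PBW monomial, since `f_1^ℓ`, `f_3²`,
`f_2²` and their analogues in the `e_i` are zero, while `k_i^ℓ = σ² = 1`. -/
theorem fSpan_mul_eSpan_mul_kSpan_le (hodd : Odd ℓ) (hℓ : 3 ≤ ℓ) (s t : Set ℕ) :
    fSpan ℓ s * eSpan ℓ t * kSpan ℓ ≤
      Submodule.span ℂ (pbw ℓ '' {a | a.fWeight ∈ s ∧ a.eWeight ∈ t}) := by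
  have h := gen_satisfies ℓ
  rw [kSpan, fSpan, eSpan, qSpan, qSpan, Submodule.span_mul_span, Submodule.span_mul_span,
    Submodule.span_le]
  rintro _ ⟨_, ⟨_, ⟨i, r, d, hs, rfl⟩, _, ⟨i', r', d', ht, rfl⟩, rfl⟩, _, ⟨a, b, c, rfl⟩, rfl⟩
  change fMon ℓ i r d * eMon ℓ i' r' d' * kMon ℓ a b c ∈ Submodule.span ℂ _
  by_cases hf : i < ℓ ∧ r < 2 ∧ d < 2
  swap
  · rw [fMon, qMon_eq_zero hodd hℓ serrePair_f h.f1_pow hf, zero_mul, zero_mul]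
    exact zero_mem _
  by_cases he : i' < ℓ ∧ r' < 2 ∧ d' < 2
  swap
  · rw [eMon, qMon_eq_zero hodd hℓ serrePair_e h.e1_pow he, mul_zero, zero_mul]
    exact zero_mem _
  have hℓ0 : 0 < ℓ := by omega
  have hmem := Submodule.subset_span (R := ℂ) (Set.mem_image_of_mem (pbw ℓ)
    (show (⟨⟨i, hf.1⟩, ⟨r, hf.2.1⟩, ⟨d, hf.2.2⟩, ⟨i', he.1⟩, ⟨r', he.2.1⟩, ⟨d', he.2.2⟩,
      ⟨a % ℓ, Nat.mod_lt _ hℓ0⟩, ⟨b % ℓ, Nat.mod_lt _ hℓ0⟩, ⟨c % 2, Nat.mod_lt _ two_pos⟩⟩ :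
      PBWIndex ℓ) ∈ {a | a.fWeight ∈ s ∧ a.eWeight ∈ t} from ⟨hs, ht⟩))
  rw [pbw_eq] at hmem
  rw [kMon_mod]
  refine (Submodule.smul_mem_iff _ (pow_ne_zero r' ?_)).1 hmem
  exact neg_ne_zero.2 (inv_ne_zero (xi_ne_zero ℓ))

end pbwSpan

/-! ### Leading terms of the coproduct -/

section qMonMaps

variable {A B : Type*} [Ring A] [Algebra ℂ A] [Ring B] [Algebra ℂ B]

theorem map_qMon (φ : A →ₐ[ℂ] B) (q : ℂ) (x y : A) (i r d : ℕ) :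
    φ (qMon q x y i r d) = qMon q (φ x) (φ y) i r d := by
  simp only [qMon, qComm, map_mul, map_pow, map_sub, map_smul]

theorem qMon_tmul_right (q : ℂ) {x y : A} {u v : B} (h : Commute u v) (i r d : ℕ) :
    qMon q (x ⊗ₜ[ℂ] u) (y ⊗ₜ[ℂ] v) i r d = qMon q x y i r d ⊗ₜ (u ^ (i + r) * v ^ (r + d)) := by
  have hz : qComm q (x ⊗ₜ[ℂ] u) (y ⊗ₜ[ℂ] v) = qComm q x y ⊗ₜ (u * v) := by
    simp only [qComm, Algebra.TensorProduct.tmul_mul_tmul, h.eq, TensorProduct.sub_tmul,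
      TensorProduct.smul_tmul']
  simp only [qMon, hz, Algebra.TensorProduct.tmul_pow, Algebra.TensorProduct.tmul_mul_tmul,
    h.mul_pow, pow_add, mul_assoc]

theorem qMon_tmul_left (q : ℂ) {x y : A} {u v : B} (h : Commute u v) (i r d : ℕ) :
    qMon q (u ⊗ₜ[ℂ] x) (v ⊗ₜ[ℂ] y) i r d = (u ^ (i + r) * v ^ (r + d)) ⊗ₜ qMon q x y i r d := by
  have hz : qComm q (u ⊗ₜ[ℂ] x) (v ⊗ₜ[ℂ] y) = (u * v) ⊗ₜ qComm q x y := by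
    simp only [qComm, Algebra.TensorProduct.tmul_mul_tmul, h.eq, TensorProduct.tmul_sub,
      TensorProduct.tmul_smul]
  simp only [qMon, hz, Algebra.TensorProduct.tmul_pow, Algebra.TensorProduct.tmul_mul_tmul,
    h.mul_pow, pow_add, mul_assoc]

end qMonMaps

section leftTensor

variable {A : Type*} [Ring A] [Algebra ℂ A]

/-- The image of `N ⊗ A` in `A ⊗ A`. -/
def leftTensor (N : Submodule ℂ A) : Submodule ℂ (A ⊗[ℂ] A) :=
  Submodule.span ℂ {t | ∃ x ∈ N, ∃ y : A, t = x ⊗ₜ y}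

theorem tmul_mem_leftTensor {N : Submodule ℂ A} {x : A} (hx : x ∈ N) (y : A) :
    x ⊗ₜ[ℂ] y ∈ leftTensor N := Submodule.subset_span ⟨x, hx, y, rfl⟩

theorem leftTensor_mono {N N' : Submodule ℂ A} (h : N ≤ N') : leftTensor N ≤ leftTensor N' :=
  Submodule.span_mono fun _ ⟨x, hx, y, hy⟩ => ⟨x, h hx, y, hy⟩

theorem leftTensor_top : leftTensor (⊤ : Submodule ℂ A) = ⊤ := by
  rw [eq_top_iff]
  rintro t -
  induction t with
  | zero => exact zero_mem _
  | tmul x y => exact tmul_mem_leftTensor Submodule.mem_top y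
  | add x y hx hy => exact add_mem hx hy

theorem mul_mem_leftTensor {N N' P : Submodule ℂ A} (h : N * N' ≤ P) {t u : A ⊗[ℂ] A}
    (ht : t ∈ leftTensor N) (hu : u ∈ leftTensor N') : t * u ∈ leftTensor P := by
  suffices H : leftTensor N * leftTensor N' ≤ leftTensor P from H (Submodule.mul_mem_mul ht hu)
  rw [leftTensor, leftTensor, Submodule.span_mul_span, Submodule.span_le]
  rintro _ ⟨_, ⟨x, hx, y, rfl⟩, _, ⟨x', hx', y', rfl⟩, rfl⟩
  simp only [Algebra.TensorProduct.tmul_mul_tmul]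
  exact tmul_mem_leftTensor (h (Submodule.mul_mem_mul hx hx')) _

theorem rTensor_eq_zero {N : Submodule ℂ A} {α : A →ₗ[ℂ] ℂ} (h : ∀ x ∈ N, α x = 0)
    {t : A ⊗[ℂ] A} (ht : t ∈ leftTensor N) : α.rTensor A t = 0 := by
  suffices H : leftTensor N ≤ LinearMap.ker (α.rTensor A) from H ht
  refine Submodule.span_le.2 ?_
  rintro _ ⟨x, hx, y, rfl⟩
  simp [h x hx]

end leftTensor

section comul

variable {ℓ : ℕ} [Fact (Odd ℓ)]

theorem comul_kMon (i j m : ℕ) : comulHom ℓ (kMon ℓ i j m) = kMon ℓ i j m ⊗ₜ kMon ℓ i j m := by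
  simp [kMon, comulGen, Algebra.TensorProduct.tmul_pow, Algebra.TensorProduct.tmul_mul_tmul]

/-- If `Δ(g_i) = g_i ⊗ u_i + c_i ⊗ g_i` with `c_i` in the Cartan part, then the component of
highest degree on the left of the coproduct of a monomial in the `g_i` is the monomial itself,
tensored with a product of the `u_i`. -/
theorem comul_qMon_sub_mem {g u c : Fin 2 → U0 ℓ} (hu : Commute (u 0) (u 1))
    (hc : ∀ i, c i ∈ kSpan ℓ) (hΔ : ∀ i, comulHom ℓ (g i) = g i ⊗ₜ u i + c i ⊗ₜ g i)
    (hg : ∀ i, ∀ s t : Set ℕ, (∀ n ∈ s, n + 1 ∈ t) →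
      Submodule.span ℂ {g i} * qSpan (xi ℓ) (g 0) (g 1) s ≤ qSpan (xi ℓ) (g 0) (g 1) t)
    (hK : ∀ s, kSpan ℓ * qSpan (xi ℓ) (g 0) (g 1) s ≤ qSpan (xi ℓ) (g 0) (g 1) s * kSpan ℓ)
    (i r d : ℕ) :
    comulHom ℓ (qMon (xi ℓ) (g 0) (g 1) i r d) -
        qMon (xi ℓ) (g 0) (g 1) i r d ⊗ₜ (u 0 ^ (i + r) * u 1 ^ (r + d)) ∈
      leftTensor (qSpan (xi ℓ) (g 0) (g 1) (Set.Iio (i + 2 * r + d)) * kSpan ℓ) := by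
  set N := qSpan (xi ℓ) (g 0) (g 1) with hN
  have hle : ∀ {m n : ℕ}, m ≤ n → N (Set.Iio m) ≤ N (Set.Iio n) := fun h =>
    qSpan_mono (Set.Iio_subset_Iio h)
  have hgN : ∀ i n, Submodule.span ℂ {g i} * (N (Set.Iio n) * kSpan ℓ) ≤
      N (Set.Iio (n + 1)) * kSpan ℓ := by
    intro i n
    rw [← mul_assoc]
    gcongr
    exact hg i _ _ fun m hm => Nat.succ_lt_succ hm
  have hKN : ∀ s, kSpan ℓ * (N s * kSpan ℓ) ≤ N s * kSpan ℓ := by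
    intro s
    calc kSpan ℓ * (N s * kSpan ℓ) = kSpan ℓ * N s * kSpan ℓ := (mul_assoc _ _ _).symm
      _ ≤ N s * kSpan ℓ * kSpan ℓ := mul_le_mul' (hK s) le_rfl
      _ = N s * (kSpan ℓ * kSpan ℓ) := mul_assoc _ _ _
      _ ≤ N s * kSpan ℓ := by gcongr; exact kSpan_mul_kSpan
  have hlead : ∀ i n, ∀ m ∈ leftTensor (N (Set.Iio n) * kSpan ℓ),
      g i ⊗ₜ u i * m ∈ leftTensor (N (Set.Iio (n + 1)) * kSpan ℓ) := fun i n m hm =>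
    mul_mem_leftTensor (hgN i n) (tmul_mem_leftTensor (Submodule.mem_span_singleton_self _) _) hm
  have hrest : ∀ i n, ∀ m ∈ leftTensor (N (Set.Iio n) * kSpan ℓ),
      c i ⊗ₜ g i * m ∈ leftTensor (N (Set.Iio n) * kSpan ℓ) := fun i n m hm =>
    mul_mem_leftTensor (hKN _) (tmul_mem_leftTensor (hc i) _) hm
  have hΔW : ∀ i n, ∀ m ∈ leftTensor (N (Set.Iio n) * kSpan ℓ),
      comulHom ℓ (g i) * m ∈ leftTensor (N (Set.Iio (n + 1)) * kSpan ℓ) := by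
    intro i n m hm
    rw [hΔ, add_mul]
    refine add_mem (hlead i n m hm) (leftTensor_mono ?_ (hrest i n m hm))
    gcongr
    exact hle n.le_succ
  rw [map_qMon, ← qMon_tmul_right _ hu]
  refine qMon_sub_qMon_mem (W := fun n => leftTensor (N (Set.Iio n) * kSpan ℓ))
    (M := fun n => leftTensor (N (Set.Iio (n + 1)) * kSpan ℓ)) ?_ (hΔW 0) (hΔW 1)
    (fun n => hlead 0 (n + 1)) (fun n => hlead 1 (n + 1)) ?_ ?_ i r d
  · rw [Algebra.TensorProduct.one_def]
    refine tmul_mem_leftTensor ?_ 1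
    simpa using Submodule.mul_mem_mul
      (one_mem_qSpan (Nat.succ_pos 0) : (1 : U0 ℓ) ∈ N (Set.Iio (0 + 1))) one_mem_kSpan
  · intro n m hm
    rw [hΔ, add_sub_cancel_left]
    exact hrest 0 _ m hm
  · intro n m hm
    rw [hΔ, add_sub_cancel_left]
    exact hrest 1 _ m hm

/-- The component of `Δ(f_1^i f_3^r f_2^d)` of highest degree on the left. -/
theorem comul_fMon_sub_mem (i r d : ℕ) :
    comulHom ℓ (fMon ℓ i r d) - fMon ℓ i r d ⊗ₜ kMon ℓ (i + r) (r + d) 0 ∈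
      leftTensor (fSpan ℓ (Set.Iio (i + 2 * r + d)) * kSpan ℓ) := by
  have h := gen_satisfies ℓ
  have H := comul_qMon_sub_mem (ℓ := ℓ) (g := fun i => gen ℓ (f i)) (u := fun i => gen ℓ (k i))
    (c := fun i => gen ℓ sigma ^ (i : ℕ)) (h.k_k 0 1) ?_ (fun i => by simp [comulGen]) ?_
    (fun s => kSpan_mul_fSpan s) i r d
  · simpa [kMon, fMon, fSpan] using H
  · intro i
    simpa [kMon] using kMon_mem (ℓ := ℓ) 0 0 i
  · intro i s t hst
    refine le_trans ?_ (fGen_mul_fSpan hst)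
    gcongr
    · simpa using gen_f_mem i
    · exact le_rfl

/-- The component of `Δ(e_1^i e_3^r e_2^d)` of highest degree on the left. -/
theorem comul_eMon_sub_mem (hℓ : 3 ≤ ℓ) (i r d : ℕ) :
    comulHom ℓ (eMon ℓ i r d) - eMon ℓ i r d ⊗ₜ 1 ∈
      leftTensor (eSpan ℓ (Set.Iio (i + 2 * r + d)) * kSpan ℓ) := by
  have H := comul_qMon_sub_mem (ℓ := ℓ) (g := fun i => gen ℓ (e i)) (u := fun _ => 1)
    (c := fun i => gen ℓ (kInv i) * gen ℓ sigma ^ (i : ℕ)) (Commute.one_left _) ?_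
    (fun i => by simp [comulGen]) ?_ (fun s => kSpan_mul_eSpan s) i r d
  · simpa [eMon, eSpan] using H
  · intro i
    refine kSpan_mul_kSpan (Submodule.mul_mem_mul (gen_kInv_mem hℓ i) ?_)
    simpa [kMon] using kMon_mem (ℓ := ℓ) 0 0 i
  · intro i s t hst
    refine le_trans ?_ (eGen_mul_eSpan hst)
    gcongr
    · simpa using gen_e_mem i
    · exact le_rfl

/-- The component of `Δ(e_1^i e_3^r e_2^d)` of lowest degree on the left. -/
theorem comul_eMon_sub_mem' (hℓ : 3 ≤ ℓ) (i r d : ℕ) :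
    comulHom ℓ (eMon ℓ i r d) - (gen ℓ (kInv 0) ^ (i + r) *
        (gen ℓ (kInv 1) * gen ℓ sigma) ^ (r + d)) ⊗ₜ eMon ℓ i r d ∈
      leftTensor (⊤ * eGen ℓ * kSpan ℓ) := by
  have h := gen_satisfies ℓ
  have hcomm : Commute (gen ℓ (kInv 0)) (gen ℓ (kInv 1) * gen ℓ sigma) :=
    Commute.mul_right (h.kInv_kInv 0 1) (h.kInv_sigma 0)
  have hW : ∀ (t : U0 ℓ ⊗[ℂ] U0 ℓ) (n : ℕ), ∀ m ∈ leftTensor (⊤ * eGen ℓ * kSpan ℓ),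
      t * m ∈ leftTensor (⊤ * eGen ℓ * kSpan ℓ) := by
    intro t _ m hm
    refine mul_mem_leftTensor ?_ (leftTensor_top (A := U0 ℓ) ▸ trivial : t ∈ leftTensor ⊤) hm
    rw [← mul_assoc, ← mul_assoc]
    gcongr
    exact le_top
  have hM : ∀ {κ : U0 ℓ} (y : U0 ℓ), κ ∈ kSpan ℓ → ∀ n : ℕ, ∀ m ∈ leftTensor (kSpan ℓ),
      κ ⊗ₜ y * m ∈ leftTensor (kSpan ℓ) := fun y hκ _ m hm =>
    mul_mem_leftTensor kSpan_mul_kSpan (tmul_mem_leftTensor hκ y) hm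
  have hE : ∀ i, ∀ m ∈ leftTensor (kSpan ℓ),
      gen ℓ (e i) ⊗ₜ 1 * m ∈ leftTensor (⊤ * eGen ℓ * kSpan ℓ) := by
    intro i m hm
    refine mul_mem_leftTensor ?_ (tmul_mem_leftTensor (gen_e_mem i) _) hm
    gcongr
    calc eGen ℓ = 1 * eGen ℓ := (one_mul _).symm
      _ ≤ ⊤ * eGen ℓ := by gcongr; exact le_top
  have e0 : comulHom ℓ (gen ℓ (e 0)) = gen ℓ (e 0) ⊗ₜ 1 + gen ℓ (kInv 0) ⊗ₜ gen ℓ (e 0) := by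
    simp [comulGen]
  have e1 : comulHom ℓ (gen ℓ (e 1)) =
      gen ℓ (e 1) ⊗ₜ 1 + (gen ℓ (kInv 1) * gen ℓ sigma) ⊗ₜ gen ℓ (e 1) := by
    simp [comulGen]
  rw [eMon, map_qMon, ← qMon_tmul_left _ hcomm]
  refine qMon_sub_qMon_mem (W := fun _ => leftTensor (⊤ * eGen ℓ * kSpan ℓ))
    (M := fun _ => leftTensor (kSpan ℓ)) ?_ (hW _) (hW _)
    (hM _ (gen_kInv_mem hℓ 0))
    (hM _ (kSpan_mul_kSpan (Submodule.mul_mem_mul (gen_kInv_mem hℓ 1) gen_sigma_mem))) ?_ ?_ i r d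
  · rw [Algebra.TensorProduct.one_def]
    exact tmul_mem_leftTensor one_mem_kSpan 1
  · intro n m hm
    rw [e0, add_sub_cancel_right]
    exact hE 0 m hm
  · intro n m hm
    rw [e1, add_sub_cancel_right]
    exact hE 1 m hm

end comul

/-! ### Linear independence of the PBW monomials -/

section characters

theorem neg_one_pow_fin_injective : Function.Injective fun j : Fin 2 => (-1 : ℂ) ^ (j : ℕ) := by
  intro i j h
  fin_cases i <;> fin_cases j <;> first | rfl | (norm_num at h)

theorem xi_pow_fin_injective {ℓ : ℕ} (hℓ : 3 ≤ ℓ) :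
    Function.Injective fun j : Fin ℓ => xi ℓ ^ (j : ℕ) := fun i j h =>
  Fin.ext ((xi_primitive hℓ).pow_inj i.2 j.2 h)

/-- The characters of `ℤ/ℓ × ℤ/ℓ × ℤ/2` separate the functions on this group. -/
theorem eq_zero_of_forall_character {ℓ : ℕ} (hℓ : 3 ≤ ℓ) {C : Fin ℓ × Fin ℓ × Fin 2 → ℂ}
    (h : ∀ (i j : Fin ℓ) (m : Fin 2), ∑ c, C c * ((xi ℓ ^ (i : ℕ)) ^ (c.1 : ℕ) *
      (xi ℓ ^ (j : ℕ)) ^ (c.2.1 : ℕ) * ((-1) ^ (m : ℕ)) ^ (c.2.2 : ℕ)) = 0) : C = 0 := by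
  simp only [Fintype.sum_prod_type] at h
  have h1 : ∀ (j : Fin ℓ) (m : Fin 2), (fun x : Fin ℓ => ∑ y : Fin ℓ, ∑ z : Fin 2, C (x, y, z) *
      ((xi ℓ ^ (j : ℕ)) ^ (y : ℕ) * ((-1) ^ (m : ℕ)) ^ (z : ℕ))) = 0 := by
    intro j m
    refine Matrix.eq_zero_of_forall_index_sum_mul_pow_eq_zero (xi_pow_fin_injective hℓ) fun i => ?_
    rw [← h i j m]
    simp only [Finset.sum_mul]
    refine Finset.sum_congr rfl fun x _ => Finset.sum_congr rfl fun y _ =>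
      Finset.sum_congr rfl fun z _ => ?_
    ring
  have h2 : ∀ (m : Fin 2) (x : Fin ℓ), (fun y : Fin ℓ => ∑ z : Fin 2, C (x, y, z) *
      ((-1) ^ (m : ℕ)) ^ (z : ℕ)) = 0 := by
    intro m x
    refine Matrix.eq_zero_of_forall_index_sum_mul_pow_eq_zero (xi_pow_fin_injective hℓ) fun j => ?_
    refine Eq.trans ?_ (congrFun (h1 j m) x)
    simp only [Finset.sum_mul]
    refine Finset.sum_congr rfl fun y _ => Finset.sum_congr rfl fun z _ => ?_
    ring
  funext ⟨x, y, z⟩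
  have h3 : (fun z : Fin 2 => C (x, y, z)) = 0 :=
    Matrix.eq_zero_of_forall_index_sum_mul_pow_eq_zero neg_one_pow_fin_injective fun m =>
      congrFun (h2 m x) y
  exact congrFun h3 z

end characters

section detect

variable {ℓ : ℕ} [Fact (Odd ℓ)] (hℓ : 3 ≤ ℓ)

/-- The Verma module with highest weight `(a, b, s)`, as a representation. -/
def vermaRep {a b s : ℂ} (ha : a ^ ℓ = 1) (hb : b ^ ℓ = 1) (hs : s ^ 2 = 1) :
    U0 ℓ →ₐ[ℂ] Module.End ℂ (Verma ℓ) :=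
  lift (verma_satisfies Fact.out hℓ ha hb hs)

/-- The trivial Verma module twisted by the Chevalley involution: a lowest weight module. -/
def lowestRep : U0 ℓ →ₐ[ℂ] Module.End ℂ (Verma ℓ) :=
  lift (twist_satisfies
    (verma_satisfies (a := 1) (b := 1) (s := 1) Fact.out hℓ (one_pow _) (one_pow _) (one_pow _)))

variable {hℓ}

section highest

variable {a b s : ℂ} {ha : a ^ ℓ = 1} {hb : b ^ ℓ = 1} {hs : s ^ 2 = 1}

theorem vermaRep_gen (x : Gen) : vermaRep hℓ ha hb hs (gen ℓ x) = vermaGen ℓ a b s x :=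
  lift_gen _ x

theorem vermaRep_kMon (i j m : ℕ) : vermaRep hℓ ha hb hs (kMon ℓ i j m) (vec ℓ 0 0 0) =
    (a ^ i * b ^ j * s ^ m) • vec ℓ 0 0 0 := by
  have h0 : vermaGen ℓ a b s (k 0) (vec ℓ 0 0 0) = a • vec ℓ 0 0 0 := by simp [vermaGen_k0]
  have h1 : vermaGen ℓ a b s (k 1) (vec ℓ 0 0 0) = b • vec ℓ 0 0 0 := by simp [vermaGen_k1]
  have h2 : vermaGen ℓ a b s sigma (vec ℓ 0 0 0) = s • vec ℓ 0 0 0 := by simp [vermaGen_sigma]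
  simp only [kMon, map_mul, map_pow, vermaRep_gen, Module.End.mul_apply, pow_apply_of_eigen h2,
    pow_apply_of_eigen h1, pow_apply_of_eigen h0, map_smul, smul_smul]
  congr 1
  ring

theorem vermaRep_fMon (i r d : ℕ) :
    vermaRep hℓ ha hb hs (fMon ℓ i r d) (vec ℓ 0 0 0) = vec ℓ i r d := by
  rw [fMon, map_qMon, vermaRep_gen, vermaRep_gen, verma_qMon hℓ]

/-- The action of the Cartan part on the highest weight vector. -/
theorem vermaRep_kSpan {x : U0 ℓ} (hx : x ∈ kSpan ℓ) : ∃ c : ℂ,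
    vermaRep hℓ ha hb hs x (vec ℓ 0 0 0) = c • vec ℓ 0 0 0 := by
  suffices H : kSpan ℓ ≤ (Submodule.span ℂ {vec ℓ 0 0 0}).comap
      ((LinearMap.applyₗ (vec ℓ 0 0 0)) ∘ₗ (vermaRep hℓ ha hb hs).toLinearMap) by
    obtain ⟨c, hc⟩ := Submodule.mem_span_singleton.1 (H hx)
    exact ⟨c, hc.symm⟩
  refine Submodule.span_le.2 ?_
  rintro _ ⟨i, j, m, rfl⟩
  exact Submodule.mem_span_singleton.2 ⟨_, (vermaRep_kMon i j m).symm⟩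

theorem vermaRep_mul_kSpan_eq_zero {N : Submodule ℂ (U0 ℓ)} {γ : Verma ℓ →ₗ[ℂ] ℂ}
    (hN : ∀ x ∈ N, γ (vermaRep hℓ ha hb hs x (vec ℓ 0 0 0)) = 0) :
    ∀ x ∈ N * kSpan ℓ, γ (vermaRep hℓ ha hb hs x (vec ℓ 0 0 0)) = 0 := by
  intro x hx
  induction hx using Submodule.mul_induction_on' with
  | mem_mul_mem m hm n hn =>
    obtain ⟨c, hc⟩ := vermaRep_kSpan (hℓ := hℓ) (ha := ha) (hb := hb) (hs := hs) hn
    rw [map_mul, Module.End.mul_apply, hc, map_smul, map_smul, hN m hm, smul_zero]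
  | add x _ y _ hx hy => rw [map_add, LinearMap.add_apply, map_add, hx, hy, add_zero]

theorem vermaRep_top_mul_eGen {x : U0 ℓ} (hx : x ∈ (⊤ : Submodule ℂ (U0 ℓ)) * eGen ℓ) :
    vermaRep hℓ ha hb hs x (vec ℓ 0 0 0) = 0 := by
  induction hx using Submodule.mul_induction_on' with
  | add x _ y _ hx hy => rw [map_add, LinearMap.add_apply, hx, hy, add_zero]
  | mem_mul_mem m _ n hn =>
    have : vermaRep hℓ ha hb hs n (vec ℓ 0 0 0) = 0 := by
      rw [eGen] at hn
      induction hn using Submodule.span_induction with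
      | mem x hx =>
        obtain ⟨i, rfl⟩ := hx
        change vermaRep hℓ ha hb hs (gen ℓ (e i)) (vec ℓ 0 0 0) = 0
        rw [vermaRep_gen]
        fin_cases i
        · simp [vermaGen_e0 _ _ _ _ hℓ, qInt]
        · simp [vermaGen_e1]
      | zero => simp
      | add x y _ _ hx hy => rw [map_add, LinearMap.add_apply, hx, hy, add_zero]
      | smul c x _ hx => rw [map_smul, LinearMap.smul_apply, hx, smul_zero]
    rw [map_mul, Module.End.mul_apply, this, map_zero]

theorem vermaRep_fSpan {γ : Verma ℓ →ₗ[ℂ] ℂ} {n : ℕ}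
    (hγ : ∀ i r d, i + 2 * r + d < n → γ (vec ℓ i r d) = 0) :
    ∀ x ∈ fSpan ℓ (Set.Iio n), γ (vermaRep hℓ ha hb hs x (vec ℓ 0 0 0)) = 0 := by
  suffices H : fSpan ℓ (Set.Iio n) ≤ LinearMap.ker
      (γ ∘ₗ (LinearMap.applyₗ (vec ℓ 0 0 0)) ∘ₗ (vermaRep hℓ ha hb hs).toLinearMap) from
    fun x hx => H hx
  refine Submodule.span_le.2 ?_
  rintro _ ⟨i, r, d, hn, rfl⟩
  change γ (vermaRep hℓ ha hb hs (fMon ℓ i r d) (vec ℓ 0 0 0)) = 0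
  rw [vermaRep_fMon]
  exact hγ _ _ _ hn

end highest

theorem lowestRep_gen (x : Gen) :
    lowestRep hℓ (gen ℓ x) = twistGen (vermaGen ℓ 1 1 1) x :=
  lift_gen _ x

theorem lowestRep_kMon (i j m : ℕ) :
    lowestRep hℓ (kMon ℓ i j m) (vec ℓ 0 0 0) = vec ℓ 0 0 0 := by
  have h0 : vermaGen ℓ 1 1 1 (kInv 0) (vec ℓ 0 0 0) = (1 : ℂ) • vec ℓ 0 0 0 := by
    simp [vermaGen_kInv0]
  have h1 : vermaGen ℓ 1 1 1 (kInv 1) (vec ℓ 0 0 0) = (1 : ℂ) • vec ℓ 0 0 0 := by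
    simp [vermaGen_kInv1]
  have h2 : vermaGen ℓ 1 1 1 sigma (vec ℓ 0 0 0) = (1 : ℂ) • vec ℓ 0 0 0 := by
    simp [vermaGen_sigma]
  simp only [kMon, map_mul, map_pow, lowestRep_gen, twistGen, Module.End.mul_apply,
    pow_apply_of_eigen h2, pow_apply_of_eigen h1, pow_apply_of_eigen h0, one_pow, one_smul]

theorem lowestRep_eMon (i r d : ℕ) :
    lowestRep hℓ (eMon ℓ i r d) (vec ℓ 0 0 0) = vec ℓ i r d := by
  rw [eMon, map_qMon, lowestRep_gen, lowestRep_gen]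
  exact verma_qMon (a := 1) (b := 1) (s := 1) hℓ i r d

theorem lowestRep_kMon_vec (p q i r d : ℕ) : ∃ c : ℂ, c ≠ 0 ∧
    lowestRep hℓ (kMon ℓ p q 0) (vec ℓ i r d) = c • vec ℓ i r d := by
  have hx := xi_ne_zero ℓ
  simp only [kMon, pow_zero, mul_one, map_mul, map_pow, lowestRep_gen, twistGen,
    Module.End.mul_apply, pow_apply_of_eigen (vermaGen_kInv1 ℓ 1 1 1 i r d),
    pow_apply_of_eigen (vermaGen_kInv0 ℓ 1 1 1 i r d), map_smul, smul_smul]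
  exact ⟨_, by simp [hx], rfl⟩

/-- The coefficient of `f_1^i f_3^r f_2^d v ⊗ e_1^i' e_3^r' e_2^d' v'` in `Δ(x) (v ⊗ v')`, for
`p = (i, r, d)` and `q = (i', r', d')`, where `v` is the highest weight vector of a Verma module and
`v'` is the lowest weight vector of the twisted trivial one (the monomials in the `e_i` being
normalized as in `eMon`). -/
def detect (hℓ : 3 ≤ ℓ) {a b s : ℂ} (ha : a ^ ℓ = 1) (hb : b ^ ℓ = 1) (hs : s ^ 2 = 1)
    (p q : Fin ℓ × Fin 2 × Fin 2) : U0 ℓ →ₗ[ℂ] ℂ :=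
  (LinearMap.proj q ∘ₗ LinearMap.applyₗ (vec ℓ 0 0 0) ∘ₗ (lowestRep hℓ).toLinearMap) ∘ₗ
    (TensorProduct.lid ℂ (U0 ℓ)).toLinearMap ∘ₗ
    (LinearMap.proj p ∘ₗ LinearMap.applyₗ (vec ℓ 0 0 0) ∘ₗ
      (vermaRep hℓ ha hb hs).toLinearMap).rTensor (U0 ℓ) ∘ₗ (comulHom ℓ).toLinearMap

/-- On the monomials whose `f`-part has weight at most that of `p`, the form `detect p q` vanishes
except where the `f`-part is `p` and the `e`-part is `q`; there its dependence on the Cartan part is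
given by the character `(a, b, s)`. -/
theorem detect_eq {a b s : ℂ} {ha : a ^ ℓ = 1} {hb : b ^ ℓ = 1} {hs : s ^ 2 = 1}
    (p q : Fin ℓ × Fin 2 × Fin 2) : ∃ u : ℂ, u ≠ 0 ∧
      ∀ (p' q' : Fin ℓ × Fin 2 × Fin 2) (i j m : ℕ),
        (p'.1 + 2 * p'.2.1 + p'.2.2 : ℕ) ≤ p.1 + 2 * p.2.1 + p.2.2 →
        detect hℓ ha hb hs p q (fMon ℓ p'.1 p'.2.1 p'.2.2 * eMon ℓ q'.1 q'.2.1 q'.2.2 *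
          kMon ℓ i j m) = if p' = p ∧ q' = q then u * (a ^ i * b ^ j * s ^ m) else 0 := by
  have ha0 : a ≠ 0 := by rintro rfl; simp [show ℓ ≠ 0 by omega] at ha
  have hb0 : b ≠ 0 := by rintro rfl; simp [show ℓ ≠ 0 by omega] at hb
  have hs0 : s ≠ 0 := by rintro rfl; simp at hs
  obtain ⟨u, hu0, hu⟩ := lowestRep_kMon_vec (hℓ := hℓ) (p.1 + p.2.1) (p.2.1 + p.2.2)
    q.1 q.2.1 q.2.2
  refine ⟨a⁻¹ ^ (q.1 + q.2.1 : ℕ) * (s * b⁻¹) ^ (q.2.1 + q.2.2 : ℕ) * u, by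
    simp [ha0, hb0, hs0, hu0], fun p' q' i j m hw => ?_⟩
  set α : U0 ℓ →ₗ[ℂ] ℂ := LinearMap.proj p ∘ₗ LinearMap.applyₗ (vec ℓ 0 0 0) ∘ₗ
      (vermaRep hℓ ha hb hs).toLinearMap with hα
  have hαx : ∀ x, α x = vermaRep hℓ ha hb hs x (vec ℓ 0 0 0) p := fun x => rfl
  set F := fMon ℓ p'.1 p'.2.1 p'.2.2 with hF
  set E := eMon ℓ q'.1 q'.2.1 q'.2.2 with hE
  set K := kMon ℓ i j m with hK
  set κ := kMon ℓ (p'.1 + p'.2.1) (p'.2.1 + p'.2.2) 0 with hκ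
  set κ' := gen ℓ (kInv 0) ^ (q'.1 + q'.2.1 : ℕ) *
    (gen ℓ (kInv 1) * gen ℓ sigma) ^ (q'.2.1 + q'.2.2 : ℕ) with hκ'
  have hκ'mem : κ' ∈ kSpan ℓ :=
    kSpan_mul_kSpan (Submodule.mul_mem_mul (pow_mem_kSpan (gen_kInv_mem hℓ 0) _)
      (pow_mem_kSpan (kSpan_mul_kSpan
        (Submodule.mul_mem_mul (gen_kInv_mem hℓ 1) gen_sigma_mem)) _))
  have hdF := comul_fMon_sub_mem (ℓ := ℓ) p'.1 p'.2.1 p'.2.2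
  have hdE := comul_eMon_sub_mem' hℓ q'.1 q'.2.1 q'.2.2
  rw [← hF, ← hκ] at hdF
  rw [← hE, ← hκ'] at hdE
  -- split the coproduct into its leading term and two remainders
  have hsplit : comulHom ℓ (F * E * K) = (F * κ' * K) ⊗ₜ (κ * E * K) +
      (comulHom ℓ F - F ⊗ₜ κ) * (κ' ⊗ₜ E * K ⊗ₜ K) +
      comulHom ℓ F * ((comulHom ℓ E - κ' ⊗ₜ E) * K ⊗ₜ K) := by
    rw [map_mul, map_mul, hK, comul_kMon, ← hK,
      show (F * κ' * K) ⊗ₜ[ℂ] (κ * E * K) = F ⊗ₜ κ * (κ' ⊗ₜ E * K ⊗ₜ K) by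
        simp only [Algebra.TensorProduct.tmul_mul_tmul, mul_assoc]]
    noncomm_ring
  have hr1 : α.rTensor (U0 ℓ) ((comulHom ℓ F - F ⊗ₜ κ) * (κ' ⊗ₜ E * K ⊗ₜ K)) = 0 := by
    have hmem : (comulHom ℓ F - F ⊗ₜ κ) * (κ' ⊗ₜ E * K ⊗ₜ K) ∈ leftTensor
        (fSpan ℓ (Set.Iio (p'.1 + 2 * p'.2.1 + p'.2.2 : ℕ)) * kSpan ℓ * kSpan ℓ) := by
      refine mul_mem_leftTensor le_rfl hdF ?_
      exact mul_mem_leftTensor kSpan_mul_kSpan (tmul_mem_leftTensor hκ'mem _)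
        (tmul_mem_leftTensor (kMon_mem _ _ _) _)
    refine rTensor_eq_zero ?_ hmem
    refine vermaRep_mul_kSpan_eq_zero (γ := LinearMap.proj p)
      (vermaRep_mul_kSpan_eq_zero (γ := LinearMap.proj p) (vermaRep_fSpan ?_))
    intro i r d hlt
    by_cases h : i < ℓ ∧ r < 2 ∧ d < 2
    · rw [vec, dif_pos h, LinearMap.proj_apply, Pi.single_eq_of_ne]
      rintro rfl
      simp only at hw
      omega
    · rw [vec_of_not h, map_zero]
  have hr2 : α.rTensor (U0 ℓ) (comulHom ℓ F * ((comulHom ℓ E - κ' ⊗ₜ E) * K ⊗ₜ K)) = 0 := by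
    have hmem : comulHom ℓ F * ((comulHom ℓ E - κ' ⊗ₜ E) * K ⊗ₜ K) ∈ leftTensor
        (⊤ * eGen ℓ * kSpan ℓ * kSpan ℓ) := by
      refine mul_mem_leftTensor ?_ (leftTensor_top (A := U0 ℓ) ▸ Submodule.mem_top :
        comulHom ℓ F ∈ leftTensor ⊤) (mul_mem_leftTensor le_rfl hdE
          (tmul_mem_leftTensor (kMon_mem _ _ _) _))
      simp only [← mul_assoc]
      gcongr
      exact le_top
    refine rTensor_eq_zero ?_ hmem
    refine vermaRep_mul_kSpan_eq_zero (γ := LinearMap.proj p)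
      (vermaRep_mul_kSpan_eq_zero (γ := LinearMap.proj p) fun x hx => ?_)
    rw [vermaRep_top_mul_eGen hx, map_zero]
  have hval : detect hℓ ha hb hs p q (F * E * K) = α (F * κ' * K) *
      lowestRep hℓ (κ * E * K) (vec ℓ 0 0 0) q := by
    have hlead : α.rTensor (U0 ℓ) (comulHom ℓ (F * E * K)) =
        α (F * κ' * K) ⊗ₜ[ℂ] (κ * E * K) := by
      rw [hsplit, map_add, map_add, hr1, hr2, add_zero, add_zero, LinearMap.rTensor_tmul]
    simp only [detect, LinearMap.comp_apply, AlgHom.toLinearMap_apply, ← hα]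
    rw [hlead]
    simp
  have hα' : α (F * κ' * K) = (a ^ i * b ^ j * s ^ m) * (a⁻¹ ^ (q'.1 + q'.2.1 : ℕ) *
      (s * b⁻¹) ^ (q'.2.1 + q'.2.2 : ℕ)) * (if p' = p then 1 else 0) := by
    have h0 : vermaGen ℓ a b s (kInv 0) (vec ℓ 0 0 0) = a⁻¹ • vec ℓ 0 0 0 := by
      simp [vermaGen_kInv0]
    have h1 : (vermaGen ℓ a b s (kInv 1) * vermaGen ℓ a b s sigma) (vec ℓ 0 0 0) =
        (s * b⁻¹) • vec ℓ 0 0 0 := by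
      simp [vermaGen_kInv1, vermaGen_sigma, smul_smul]
    rw [hαx, map_mul, map_mul, Module.End.mul_apply, Module.End.mul_apply, hK, vermaRep_kMon,
      map_smul, hκ', map_mul, map_pow, map_pow, map_mul, vermaRep_gen, vermaRep_gen, vermaRep_gen,
      Module.End.mul_apply, pow_apply_of_eigen h1]
    simp only [map_smul, pow_apply_of_eigen h0, smul_smul]
    rw [hF, vermaRep_fMon, vec_fin, Pi.smul_apply, Pi.single_apply, smul_eq_mul]
    simp only [Prod.mk.eta, eq_comm (a := p)]
    ring
  have hβ' : lowestRep hℓ (κ * E * K) (vec ℓ 0 0 0) =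
      lowestRep hℓ κ (Pi.single q' 1) := by
    rw [map_mul, map_mul, Module.End.mul_apply, Module.End.mul_apply, hK, lowestRep_kMon, hE,
      lowestRep_eMon, vec_fin]
  rw [hval, hα', hβ']
  by_cases hp : p' = p
  swap
  · simp [hp]
  subst hp
  by_cases hq : q' = q
  · subst hq
    rw [vec_fin] at hu
    rw [hκ, hu]
    simp
    ring
  · obtain ⟨u', -, hu'⟩ := lowestRep_kMon_vec (hℓ := hℓ) (p'.1 + p'.2.1) (p'.2.1 + p'.2.2)
      q'.1 q'.2.1 q'.2.2
    rw [vec_fin] at hu'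
    rw [hκ, hu', Pi.smul_apply, Pi.single_eq_of_ne (Ne.symm hq)]
    simp [hq]

end detect

section basis

variable {ℓ : ℕ} [Fact (Odd ℓ)]

/-- The exponents of a PBW monomial, grouped into those of the `f_i`, those of the `e_i`, and those
of `k_1`, `k_2` and `σ`. -/
def pbwEquiv (ℓ : ℕ) : PBWIndex ℓ ≃
    ((Fin ℓ × Fin 2 × Fin 2) × (Fin ℓ × Fin 2 × Fin 2)) × (Fin ℓ × Fin ℓ × Fin 2) where
  toFun a := (((a.f1, a.f3, a.f2), (a.e1, a.e3, a.e2)), (a.k1, a.k2, a.s))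
  invFun x := ⟨x.1.1.1, x.1.1.2.1, x.1.1.2.2, x.1.2.1, x.1.2.2.1, x.1.2.2.2, x.2.1, x.2.2.1, x.2.2.2⟩
  left_inv _ := rfl
  right_inv _ := rfl

/-- In a linear relation, `detect` isolates the terms with a given `f`-part of maximal weight and a
given `e`-part, and the characters `(a, b, s)` then separate their Cartan parts. -/
theorem linearIndependent_monomials (hℓ : 3 ≤ ℓ) : LinearIndependent ℂ
    fun x : ((Fin ℓ × Fin 2 × Fin 2) × (Fin ℓ × Fin 2 × Fin 2)) × (Fin ℓ × Fin ℓ × Fin 2) =>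
      fMon ℓ x.1.1.1 x.1.1.2.1 x.1.1.2.2 * eMon ℓ x.1.2.1 x.1.2.2.1 x.1.2.2.2 *
        kMon ℓ x.2.1 x.2.2.1 x.2.2.2 := by
  rw [Fintype.linearIndependent_iff]
  intro C hC
  by_contra! hne
  let w : Fin ℓ × Fin 2 × Fin 2 → ℕ := fun p => p.1 + 2 * p.2.1 + p.2.2
  -- an index with nonzero coefficient whose `f`-part has the largest possible weight
  obtain ⟨x₀, hx₀, hmax⟩ := Finset.exists_max_image (Finset.univ.filter fun x => C x ≠ 0)
    (fun x => w x.1.1) ⟨hne.choose, by simpa using hne.choose_spec⟩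
  obtain ⟨⟨p, q⟩, c₀⟩ := x₀
  simp only [Finset.mem_filter, Finset.mem_univ, true_and] at hx₀ hmax
  suffices H : (fun c => C ((p, q), c)) = 0 from hx₀ (congrFun H c₀)
  refine eq_zero_of_forall_character hℓ fun i j m => ?_
  have hroot : ∀ i : Fin ℓ, (xi ℓ ^ (i : ℕ)) ^ ℓ = 1 := fun i => by
    rw [pow_right_comm, (xi_primitive hℓ).pow_eq_one, one_pow]
  have hsign : ((-1 : ℂ) ^ (m : ℕ)) ^ 2 = 1 := by rw [pow_right_comm, neg_one_sq, one_pow]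
  obtain ⟨u, hu, hval⟩ := detect_eq (hℓ := hℓ) (ha := hroot i) (hb := hroot j) (hs := hsign) p q
  have hsum := congrArg (detect hℓ (hroot i) (hroot j) hsign p q) hC
  rw [map_sum, map_zero, Fintype.sum_prod_type, Finset.sum_eq_single (p, q)] at hsum
  · refine (mul_eq_zero.1 ?_).resolve_left hu
    rw [← hsum, Finset.mul_sum]
    refine Finset.sum_congr rfl fun c _ => ?_
    rw [map_smul, hval p q _ _ _ le_rfl, if_pos ⟨rfl, rfl⟩, smul_eq_mul]
    ring
  · rintro ⟨p', q'⟩ - hpq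
    refine Finset.sum_eq_zero fun c _ => ?_
    by_cases hc : C ((p', q'), c) = 0
    · rw [hc, zero_smul, map_zero]
    · rw [map_smul, hval p' q' _ _ _ (hmax _ hc), if_neg, smul_zero]
      rintro ⟨rfl, rfl⟩
      exact hpq rfl
  · intro h
    exact absurd (Finset.mem_univ _) h

theorem linearIndependent_pbw (hℓ : 3 ≤ ℓ) : LinearIndependent ℂ (pbw ℓ) := by
  have h0 : -(xi ℓ)⁻¹ ≠ 0 := neg_ne_zero.2 (inv_ne_zero (xi_ne_zero ℓ))
  convert ((linearIndependent_monomials hℓ).comp _ (pbwEquiv ℓ).injective).units_smul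
    (fun a => Units.mk0 _ h0 ^ (a.e3 : ℕ)) using 1
  funext a
  rw [pbw_eq, Pi.smul_apply', Units.smul_def, Units.val_pow_eq_pow_val, Units.val_mk0]
  rfl

theorem span_pbw (hℓ : 3 ≤ ℓ) : ⊤ ≤ Submodule.span ℂ (Set.range (pbw ℓ)) := by
  rw [← fSpan_mul_eSpan_mul_kSpan hℓ]
  refine (fSpan_mul_eSpan_mul_kSpan_le Fact.out hℓ _ _).trans ?_
  exact Submodule.span_mono (Set.image_subset_range _ _)

/-- The PBW basis. -/
def pbwBasis (hℓ : 3 ≤ ℓ) : Module.Basis (PBWIndex ℓ) ℂ (U0 ℓ) :=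
  Module.Basis.mk (linearIndependent_pbw hℓ) (span_pbw hℓ)

theorem pbwBasis_apply (hℓ : 3 ≤ ℓ) (a : PBWIndex ℓ) : pbwBasis hℓ a = pbw ℓ a :=
  Module.Basis.mk_apply _ _ a

end basis

/-! ### The right integral -/

section integral

variable {ℓ : ℕ}

theorem PBWIndex.fWeight_le (a : PBWIndex ℓ) : a.fWeight ≤ ℓ + 2 := by
  unfold PBWIndex.fWeight; omega

theorem PBWIndex.eWeight_le (a : PBWIndex ℓ) : a.eWeight ≤ ℓ + 2 := by
  unfold PBWIndex.eWeight; omega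

theorem IsTop.fWeight_eq {a : PBWIndex ℓ} (hℓ : 3 ≤ ℓ) (h : IsTop ℓ a) : a.fWeight = ℓ + 2 := by
  obtain ⟨h1, h2, h3, -⟩ := h
  rw [PBWIndex.fWeight, h1, h2, h3, Fin.val_one]
  omega

theorem IsTop.eWeight_eq {a : PBWIndex ℓ} (hℓ : 3 ≤ ℓ) (h : IsTop ℓ a) : a.eWeight = ℓ + 2 := by
  obtain ⟨-, -, -, h1, h2, h3, -⟩ := h
  rw [PBWIndex.eWeight, h1, h2, h3, Fin.val_one]
  omega

/-- The group-like element to the right of the top monomial in its coproduct is trivial. -/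
theorem kMon_of_isTop (hℓ : 3 ≤ ℓ) {a : PBWIndex ℓ} (h : IsTop ℓ a) :
    kMon ℓ (a.f1 + a.f3) (a.f3 + a.f2) 0 * kMon ℓ a.k1 a.k2 a.s = 1 := by
  obtain ⟨h1, h2, h3, -, -, -, h4, h5, h6⟩ := h
  rw [kMon_mul_kMon, h1, h2, h3, h4, h5, h6, kMon, Fin.val_one, Fin.val_zero,
    show ℓ - 1 + 1 + 0 = ℓ by omega, show 1 + 1 + (ℓ - 2) = ℓ by omega,
    (gen_satisfies ℓ).k_pow, (gen_satisfies ℓ).k_pow]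
  simp

variable [Fact (Odd ℓ)]

/-- The linear form with value `η` at the top monomial and `0` at the others. -/
def topForm (hℓ : 3 ≤ ℓ) (η : ℂ) : U0 ℓ →ₗ[ℂ] ℂ :=
  (pbwBasis hℓ).constr ℂ (fun a => if IsTop ℓ a then η else 0)

theorem topForm_pbw (hℓ : 3 ≤ ℓ) (η : ℂ) (a : PBWIndex ℓ) :
    topForm hℓ η (pbw ℓ a) = if IsTop ℓ a then η else 0 := by
  rw [topForm, ← pbwBasis_apply hℓ, Module.Basis.constr_basis]

/-- The top monomial has the largest possible weight in the `f_i` and in the `e_i`. -/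
theorem topForm_eq_zero (hℓ : 3 ≤ ℓ) (η : ℂ) {s t : Set ℕ} (h : ℓ + 2 ∉ s ∨ ℓ + 2 ∉ t)
    {x : U0 ℓ} (hx : x ∈ fSpan ℓ s * eSpan ℓ t * kSpan ℓ) : topForm hℓ η x = 0 := by
  suffices H : fSpan ℓ s * eSpan ℓ t * kSpan ℓ ≤ LinearMap.ker (topForm hℓ η) from H hx
  refine (fSpan_mul_eSpan_mul_kSpan_le Fact.out hℓ s t).trans (Submodule.span_le.2 ?_)
  rintro _ ⟨a, ⟨hs, ht⟩, rfl⟩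
  change topForm hℓ η (pbw ℓ a) = 0
  rw [topForm_pbw, if_neg]
  intro htop
  rw [htop.fWeight_eq hℓ] at hs
  rw [htop.eWeight_eq hℓ] at ht
  exact h.elim (fun h => h hs) (fun h => h ht)

/-- Only the leading term of the coproduct of a monomial contributes: in the others, the left
tensor factor has lower weight in the `f_i` or in the `e_i`. -/
theorem topForm_rTensor_comul (hℓ : 3 ≤ ℓ) (η : ℂ) (a : PBWIndex ℓ) :
    (topForm hℓ η).rTensor (U0 ℓ) (comulHom ℓ (pbw ℓ a)) =
      topForm hℓ η (pbw ℓ a) ⊗ₜ (kMon ℓ (a.f1 + a.f3) (a.f3 + a.f2) 0 * kMon ℓ a.k1 a.k2 a.s) := by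
  have hdF := comul_fMon_sub_mem (ℓ := ℓ) a.f1 a.f3 a.f2
  have hdE := comul_eMon_sub_mem hℓ a.e1 a.e3 a.e2
  have hmem : comulHom ℓ (fMon ℓ a.f1 a.f3 a.f2) ∈
      leftTensor (fSpan ℓ Set.univ * kSpan ℓ) := by
    rw [← sub_add_cancel (comulHom ℓ (fMon ℓ a.f1 a.f3 a.f2))]
    refine add_mem (leftTensor_mono ?_ hdF) (tmul_mem_leftTensor ?_ _)
    · gcongr
      exact qSpan_mono (Set.subset_univ _)
    · have hF : fMon ℓ a.f1 a.f3 a.f2 ∈ fSpan ℓ Set.univ := qMon_mem_qSpan (Set.mem_univ _)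
      simpa only [mul_one] using Submodule.mul_mem_mul hF one_mem_kSpan
  have hE : eMon ℓ a.e1 a.e3 a.e2 ∈ eSpan ℓ Set.univ := qMon_mem_qSpan (Set.mem_univ _)
  have hK := kMon_mem (ℓ := ℓ) a.k1 a.k2 a.s
  rw [pbw_eq]
  set F := fMon ℓ a.f1 a.f3 a.f2
  set E := eMon ℓ a.e1 a.e3 a.e2
  set K := kMon ℓ a.k1 a.k2 a.s with hKdef
  set κ := kMon ℓ (a.f1 + a.f3) (a.f3 + a.f2) 0
  -- the Cartan part moves to the right of any monomial in the `e_i`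
  have hsub : ∀ s t, fSpan ℓ s * kSpan ℓ * (eSpan ℓ t * kSpan ℓ) ≤
      fSpan ℓ s * eSpan ℓ t * kSpan ℓ := by
    intro s t
    calc fSpan ℓ s * kSpan ℓ * (eSpan ℓ t * kSpan ℓ)
        = fSpan ℓ s * (kSpan ℓ * eSpan ℓ t) * kSpan ℓ := by simp only [mul_assoc]
      _ ≤ fSpan ℓ s * (eSpan ℓ t * kSpan ℓ) * kSpan ℓ :=
        mul_le_mul' (mul_le_mul' le_rfl (kSpan_mul_eSpan t)) le_rfl
      _ = fSpan ℓ s * eSpan ℓ t * (kSpan ℓ * kSpan ℓ) := by simp only [mul_assoc]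
      _ ≤ fSpan ℓ s * eSpan ℓ t * kSpan ℓ := mul_le_mul' le_rfl kSpan_mul_kSpan
  have hsplit : comulHom ℓ (F * E * K) = (F * E * K) ⊗ₜ (κ * K) +
      (comulHom ℓ F - F ⊗ₜ κ) * (E * K) ⊗ₜ K +
      comulHom ℓ F * ((comulHom ℓ E - E ⊗ₜ 1) * K ⊗ₜ K) := by
    rw [map_mul, map_mul, hKdef, comul_kMon, ← hKdef,
      show (F * E * K) ⊗ₜ[ℂ] (κ * K) = F ⊗ₜ κ * (E ⊗ₜ 1 * K ⊗ₜ K) by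
        simp only [Algebra.TensorProduct.tmul_mul_tmul, mul_assoc, one_mul],
      show (E * K) ⊗ₜ[ℂ] K = E ⊗ₜ 1 * K ⊗ₜ K by
        simp only [Algebra.TensorProduct.tmul_mul_tmul, one_mul]]
    noncomm_ring
  have hr1 : (topForm hℓ η).rTensor (U0 ℓ) ((comulHom ℓ F - F ⊗ₜ κ) * (E * K) ⊗ₜ K) = 0 := by
    refine rTensor_eq_zero (fun x hx => topForm_eq_zero hℓ η ?_ hx) (mul_mem_leftTensor
      (hsub _ Set.univ) hdF (tmul_mem_leftTensor (Submodule.mul_mem_mul hE hK) _))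
    exact Or.inl (not_lt.2 a.fWeight_le)
  have hr2 : (topForm hℓ η).rTensor (U0 ℓ)
      (comulHom ℓ F * ((comulHom ℓ E - E ⊗ₜ 1) * K ⊗ₜ K)) = 0 := by
    have hEK : (comulHom ℓ E - E ⊗ₜ 1) * K ⊗ₜ K ∈
        leftTensor (eSpan ℓ (Set.Iio a.eWeight) * kSpan ℓ) := by
      refine mul_mem_leftTensor ?_ hdE (tmul_mem_leftTensor hK _)
      rw [mul_assoc]
      exact mul_le_mul' le_rfl kSpan_mul_kSpan
    refine rTensor_eq_zero (fun x hx => topForm_eq_zero hℓ η ?_ hx)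
      (mul_mem_leftTensor (hsub Set.univ _) hmem hEK)
    exact Or.inr (not_lt.2 a.eWeight_le)
  rw [map_smul, map_smul, hsplit, map_add, map_add, hr1, hr2, add_zero, add_zero,
    LinearMap.rTensor_tmul, map_smul, TensorProduct.smul_tmul']

theorem isRightIntegral_topForm (hℓ : 3 ≤ ℓ) (η : ℂ) : IsRightIntegral (topForm hℓ η) := by
  have H : (TensorProduct.lid ℂ (U0 ℓ)).toLinearMap ∘ₗ (topForm hℓ η).rTensor (U0 ℓ) ∘ₗ
      (comulHom ℓ).toLinearMap = (topForm hℓ η).smulRight (1 : U0 ℓ) := by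
    refine (pbwBasis hℓ).ext fun a => ?_
    simp only [pbwBasis_apply, LinearMap.comp_apply, AlgHom.toLinearMap_apply,
      topForm_rTensor_comul, LinearEquiv.coe_coe, TensorProduct.lid_tmul, LinearMap.smulRight_apply]
    by_cases h : IsTop ℓ a
    · rw [kMon_of_isTop hℓ h]
    · rw [topForm_pbw, if_neg h, zero_smul, zero_smul]
  exact fun x => LinearMap.congr_fun H x

end integral

end QSl21

end

theorem mainTheorem8 (ℓ : ℕ) [Fact (Odd ℓ)] (hℓ : 3 ≤ ℓ) :
    ∃ b : Module.Basis (QSl21.PBWIndex ℓ) ℂ (QSl21.U0 ℓ), (∀ a, b a = QSl21.pbw ℓ a) ∧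
      ∀ η : ℂ, η ≠ 0 →
        IsRightIntegral (b.constr ℂ (fun a => if QSl21.IsTop ℓ a then η else 0)) :=
  ⟨QSl21.pbwBasis hℓ, QSl21.pbwBasis_apply hℓ, fun η _ => QSl21.isRightIntegral_topForm hℓ η⟩
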